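/- Tropical setting. $\mathbb T=\mathbb R\cup\{-\infty\}$ with tropical sum $\max$ and tropical product $+$. A tropical variety $X$ is a topological space with an atlas of homeomorphisms $\Phi_\alpha$ from open sets $U_\alpha$ onto open subsets of pure-dimensional finite balanced rational polyhedral complexes in $\mathbb T^{n_\alpha}$ with all weights $1$, each maximal polyhedron being the closure in $\mathbb T^{n_\alpha}$ of its part in $\mathbb R^{n_\alpha}$; the transition functions on the finite parts are restrictions of $\mathbb Z$-affine linear maps. A point is inner if some chart sends it into $\mathbb R^{n_\alpha}$. A regular function on an open set is a continuous $\mathbb T$-valued function which, on inner points, is locally in charts a tropical Laurent polynomial or constantly $-\infty$; a rational function is locally, on inner points, a difference of two tropical polynomials. An invertible function is a regular function $u$ such that $-u$ is regular too. A divisor $D=\{(U_\alpha,f_\alpha)\}$ on $X$ is a Cartier divisor: an open cover with rational functions $f_\alpha$ such that each $f_\alpha-f_\beta$ agrees, at inner points of $U_\alpha\cap U_\beta$, with an invertible function. Two divisors are identified if their union is a divisor. $|D|$ is the set of effective divisors (those representable by regular local equations) linearly equivalent to $D$. The support of a divisor is the set of points near which a local equation is not invertible, and a divisor passes a point if its support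 contains the point. $\Gamma(X,\mathcal O(D))$ is the tropical module of regular sections of $\mathcal O(D)$: the families of regular functions $s_\alpha$ on $U_\alpha$ with $s_\alpha-s_\beta=f_\alpha-f_\beta$ on overlaps. Cartwright's invariant $h^0(X,D)$ is the least $k\in\mathbb Z_{\ge0}$ for which there are points $p_1,\dots,p_k\in X$ such that no $E\in|D|$ passes all of them, and $\infty$ if there is no such $k$. For a finitely generated submodule $M\subseteq\Gamma(X,\mathcal O(D))$ let $U(M)$ be the complement of the union of the supports of the divisors of the minimal generators of $M$ (the extremals of $M$ other than $-\infty$). For $y\in U(M)$ let $l_M(y)$ be the number of elements of $M$ that are invertible (finite and $\mathbb Z$-affine linear) near $y$, where two of them are counted once if near $y$ they differ by an additive constant. For $x\notin U(M)$ let $l_M(x)$ be the maximum of $l_M(y)$ over all $y$ in connected components of $U(M)$ whose closure contains $x$ (and $0$ if there are none). Define $$h^0_a(X,D)=\sup\{k\ge 0 : \exists\, s_1,\dots,s_k\in\Gamma(X,\mathcal O(D))\ \ \forall x\in X:\ l_{\langle s_1,\dots,s_k\rangle}(x)=k\},$$ $$h^0_b(X,D)=\sup\{k\ge 0 : \forall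 x\in X\ \ \exists\, s_1,\dots,s_k\in\Gamma(X,\mathcal O(D)):\ l_{\langle s_1,\dots,s_k\rangle}(x)=k\}$$ in $\mathbb Z_{\ge0}\cup\{\infty\}$. Proposition. Let $D$ be a divisor on a tropical variety $X$. Then $h^0_a(X,D)\le h^0(X,D)$, and if the tropical module $\Gamma(X,\mathcal O(D))$ is finitely generated, then also $h^0(X,D)\le h^0_b(X,D)$; that is, $$h^0_a(X,D)\le h^0(X,D)\le h^0_b(X,D).$$ -/

import Mathlib

open Set Topology TopologicalSpace

noncomputable section

namespace Trop

/-! ### Tropical numbers and rational polyhedra -/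

/-- The tropical semifield as a topological space: `ℝ ∪ {-∞}`, realised inside the extended
reals.  Tropical sum is `max`, tropical product is `+`. -/
abbrev TNum : Type := {x : EReal // x ≠ ⊤}

/-- The inclusion of `ℝ^n` into `𝕋^n`. -/
def finitePart {n : ℕ} (y : Fin n → ℝ) : Fin n → TNum :=
  fun i => ⟨(y i : EReal), EReal.coe_ne_top (y i)⟩

/-- The `ℤ`-affine linear function `y ↦ b + a · y` on `ℝ^n`, encoded by `m = (a, b)` with
integral slope `a` and real constant `b`. -/
def zAffine {n : ℕ} (m : (Fin n → ℤ) × ℝ) (y : Fin n → ℝ) : ℝ :=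
  m.2 + ∑ i, (m.1 i : ℝ) * y i

/-- The subset of `ℝ^n` cut out by finitely many inequalities `a · y + b ≥ 0`
with `a` integral and `b` real. -/
def polyhedron {n : ℕ} (H : Finset ((Fin n → ℤ) × ℝ)) : Set (Fin n → ℝ) :=
  {y | ∀ m ∈ H, 0 ≤ zAffine m y}

/-- `F` is a face of the rational polyhedron `P ⊆ ℝ^n`: some of the inequalities defining `P`
are turned into equations.  (The empty set and `P` itself are faces.) -/
def IsFace {n : ℕ} (F P : Set (Fin n → ℝ)) : Prop :=
  ∃ H : Finset ((Fin n → ℤ) × ℝ), P = polyhedron H ∧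
    ∃ J ⊆ H, F = {y ∈ P | ∀ m ∈ J, zAffine m y = 0}

/-- The polyhedron in `𝕋^n` with finite part `P`: the closure of `P` in `𝕋^n`. -/
def tClosure {n : ℕ} (P : Set (Fin n → ℝ)) : Set (Fin n → TNum) :=
  closure (finitePart '' P)

/-- `G ⊆ 𝕋^n` is a face of the polyhedron in `𝕋^n` with finite part `P`: it is the intersection
of (the closure of) a face of `P` with a coordinate face `{t | t i = -∞ for all i ∈ I}` of `𝕋^n`. -/
def IsTFace {n : ℕ} (G : Set (Fin n → TNum)) (P : Set (Fin n → ℝ)) : Prop :=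
  ∃ F, IsFace F P ∧ ∃ I : Set (Fin n),
    G = tClosure F ∩ {t | ∀ i ∈ I, (t i : EReal) = ⊥}

/-- `v` is a primitive integral vector pointing from the codimension one face `E` into the
polyhedron `P`: its class generates the lattice of integral vectors parallel to `P` modulo the
directions parallel to `E`. -/
def IsPrimitiveNormal {n : ℕ} (E P : Set (Fin n → ℝ)) (v : Fin n → ℤ) : Prop :=
  (fun i => (v i : ℝ)) ∉ vectorSpan ℝ E ∧
  (∃ y ∈ E, ∃ ε : ℝ, 0 < ε ∧ (y + ε • fun i => (v i : ℝ)) ∈ P) ∧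
  ∀ w : Fin n → ℤ, (fun i => (w i : ℝ)) ∈ vectorSpan ℝ P →
    ∃ k : ℤ, (fun i => ((w i - k * v i : ℤ) : ℝ)) ∈ vectorSpan ℝ E

open Classical in
/-- A `d`-dimensional balanced rational polyhedral complex in `𝕋^n` with all weights `1`, given by
the finite parts of its (finitely many) `d`-dimensional polyhedra. -/
structure BalancedComplex (n d : ℕ) where
  facets : Finset (Set (Fin n → ℝ))
  polyhedral : ∀ P ∈ facets, ∃ H, P = polyhedron H
  nonempty : ∀ P ∈ facets, P.Nonempty
  pure : ∀ P ∈ facets, Module.finrank ℝ (vectorSpan ℝ P) = d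
  /-- the intersection of any subcollection is a common face of its members -/
  inter : ∀ S ⊆ facets, S.Nonempty → ∀ P ∈ S, IsTFace (⋂ Q ∈ S, tClosure Q) P
  /-- balancing at every `(d-1)`-dimensional cell meeting `ℝ^n` -/
  balanced : ∀ E : Set (Fin n → ℝ), E.Nonempty → (∃ P ∈ facets, IsFace E P) →
    Module.finrank ℝ (vectorSpan ℝ E) + 1 = d →
    ∃ v : Set (Fin n → ℝ) → Fin n → ℤ,
      (∀ P ∈ facets, E ⊆ P → IsPrimitiveNormal E P (v P)) ∧
      (∑ P ∈ facets with E ⊆ P, fun i => (v P i : ℝ)) ∈ vectorSpan ℝ E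

/-- The underlying subset of `𝕋^n` of a complex. -/
def BalancedComplex.support {n d : ℕ} (C : BalancedComplex n d) : Set (Fin n → TNum) :=
  ⋃ P ∈ C.facets, tClosure P

/-! ### Tropical varieties -/

/-- A chart: a homeomorphism from an open subset of `X` onto an open subset of a balanced
complex in some `𝕋^n`, whose image meets `ℝ^n`. -/
structure Chart (X : Type*) [TopologicalSpace X] where
  n : ℕ
  d : ℕ
  cx : BalancedComplex n d
  hom : OpenPartialHomeomorph X cx.support
  meets : ∃ x ∈ hom.source, ∃ y : Fin n → ℝ, (hom x : Fin n → TNum) = finitePart y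

/-- The point `x` lies in the chart and its image there is the finite point `y ∈ ℝ^n`. -/
def Chart.IsCoord {X : Type*} [TopologicalSpace X] (φ : Chart X) (x : X) (y : Fin φ.n → ℝ) :
    Prop :=
  x ∈ φ.hom.source ∧ (φ.hom x : Fin φ.n → TNum) = finitePart y

/-- A tropical variety: a topological space with an atlas of charts whose transition functions
are, on the finite parts, restrictions of `ℤ`-affine linear maps. -/
class TropicalVariety (X : Type*) [TopologicalSpace X] where
  atlas : Set (Chart X)
  cover : ∀ x : X, ∃ φ ∈ atlas, x ∈ φ.hom.source
  transition : ∀ φ ∈ atlas, ∀ ψ ∈ atlas,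
    ∃ (A : Matrix (Fin ψ.n) (Fin φ.n) ℤ) (b : Fin ψ.n → ℝ),
      ∀ x y, φ.IsCoord x y → x ∈ ψ.hom.source →
        ψ.IsCoord x (fun i => zAffine (A i, b i) y)

section Variety

variable {X : Type*} [TopologicalSpace X] [TropicalVariety X]

/-- Inner points: points of sedentarity zero in some chart. -/
def IsInner (x : X) : Prop :=
  ∃ φ ∈ TropicalVariety.atlas (X := X), ∃ y, φ.IsCoord x y

/-- `g : ℝ^n → ℝ` is a tropical Laurent polynomial (different from the constant `-∞`). -/
def IsLaurent {n : ℕ} (g : (Fin n → ℝ) → ℝ) : Prop :=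
  ∃ (S : Finset ((Fin n → ℤ) × ℝ)) (hS : S.Nonempty), ∀ y, g y = S.sup' hS (fun m => zAffine m y)

/-- `f` is a rational function on `U` (nowhere identically `-∞`): near every point of `U` it is,
in a chart, a difference of two tropical (Laurent) polynomials.  A rational function is recorded
by its values at inner points; its values elsewhere are irrelevant. -/
def IsRational (U : Set X) (f : X → ℝ) : Prop :=
  ∀ p ∈ U, ∃ φ ∈ TropicalVariety.atlas (X := X), p ∈ φ.hom.source ∧
    ∃ W : Set X, IsOpen W ∧ p ∈ W ∧ ∃ g h, IsLaurent g ∧ IsLaurent h ∧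
      ∀ x ∈ W, ∀ y, φ.IsCoord x y → f x = g y - h y

/-- `f : U → ℝ ∪ {-∞}` is a regular function on `U`: it is continuous, does not take the
value `+∞`, and near every point of `U` it is, in a chart, a tropical Laurent polynomial (that is,
a tropical polynomial minus a `ℤ`-affine linear function) or the constant `-∞`. -/
def IsRegular (U : Set X) (f : X → EReal) : Prop :=
  ContinuousOn f U ∧ (∀ x ∈ U, f x ≠ ⊤) ∧
  ∀ p ∈ U, ∃ φ ∈ TropicalVariety.atlas (X := X), p ∈ φ.hom.source ∧
    ∃ W : Set X, IsOpen W ∧ p ∈ W ∧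
      ((∀ x ∈ W, ∀ y, φ.IsCoord x y → f x = ⊥) ∨
        ∃ g, IsLaurent g ∧ ∀ x ∈ W, ∀ y, φ.IsCoord x y → f x = (g y : EReal))

/-- Invertible regular functions: the tropical inverse `-f` is regular as well.  In particular
`f` is real-valued on `U`. -/
def IsInvertible (U : Set X) (f : X → EReal) : Prop :=
  IsRegular U f ∧ IsRegular U (fun x => - f x)

variable (X) in
/-- Cartier divisors: collections of pairs `(U, f)` of an open set and a rational function on it,
such that the open sets cover `X` and the differences of the functions are, at inner points,
invertible regular functions on the overlaps. -/
structure Divisor where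
  pairs : Set (Opens X × (X → ℝ))
  rational : ∀ P ∈ pairs, IsRational (P.1 : Set X) P.2
  cover : ∀ x : X, ∃ P ∈ pairs, x ∈ P.1
  compat : ∀ P ∈ pairs, ∀ Q ∈ pairs, ∃ u : X → EReal,
    IsInvertible ((P.1 : Set X) ∩ Q.1) u ∧
      ∀ x ∈ (P.1 : Set X) ∩ Q.1, IsInner x → u x = ((P.2 x - Q.2 x : ℝ) : EReal)

namespace Divisor

/-- `E` and `D + div h` are the same divisor, i.e. the collections `{(U, f)}` of `E` and
`{(V, g + h)}` (for `(V, g)` in `D`) together still satisfy the compatibility of a divisor. -/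
def EqAddDiv (E D : Divisor X) (h : X → ℝ) : Prop :=
  ∀ P ∈ E.pairs, ∀ Q ∈ D.pairs, ∃ u : X → EReal,
    IsInvertible ((P.1 : Set X) ∩ Q.1) u ∧
      ∀ x ∈ (P.1 : Set X) ∩ Q.1, IsInner x → u x = ((P.2 x - (Q.2 x + h x) : ℝ) : EReal)

/-- The identification of divisors. -/
def Same (E D : Divisor X) : Prop := E.EqAddDiv D (fun _ => 0)

/-- Linear equivalence: the divisors differ by the divisor of a rational function on `X`. -/
def LinEquiv (E D : Divisor X) : Prop :=
  ∃ h : X → ℝ, IsRational (univ : Set X) h ∧ E.EqAddDiv D h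

/-- A divisor is effective if it is represented by a collection of regular functions. -/
def Effective (D : Divisor X) : Prop :=
  ∃ D' : Divisor X, D'.Same D ∧ ∀ P ∈ D'.pairs, ∃ s : X → EReal,
    IsRegular (P.1 : Set X) s ∧ ∀ x ∈ P.1, IsInner x → s x = (P.2 x : EReal)

/-- The complete linear system `|D|`. -/
def linearSystem (D : Divisor X) : Set (Divisor X) :=
  {E | E.Effective ∧ E.LinEquiv D}

/-- The support of a divisor: the points near which some local equation is not an invertible
regular function. -/
def supp (D : Divisor X) : Set X :=
  {p | ∃ P ∈ D.pairs, p ∈ P.1 ∧ ¬ ∃ W : Set X, IsOpen W ∧ p ∈ W ∧ W ⊆ P.1 ∧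
    ∃ u : X → EReal, IsInvertible W u ∧ ∀ x ∈ W, IsInner x → u x = (P.2 x : EReal)}

/-- Cartwright's `h⁰(X, D)`: the least `k` such that there are `k` points which no divisor of `|D|`
passes through simultaneously, and `∞` if there is no such `k`. -/
def h0 (D : Divisor X) : ℕ∞ :=
  sInf {N : ℕ∞ | ∃ k : ℕ, N = k ∧ ∃ p : Fin k → X,
    ¬ ∃ E ∈ D.linearSystem, ∀ i, p i ∈ E.supp}

/-! ### Sections of `𝒪(D)` -/

/-- A global regular section of the line bundle `𝒪(D)`, the line bundle trivialised over each `U`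
with `(U, f)` in `D` and with transition functions the differences of the local equations.  In the
trivialisations it is a family of regular functions; each of them is extended by `-∞` outside
of its domain.  (Both sides of the transition law are continuous, so that it suffices to state it
at inner points.) -/
@[ext]
structure GlobalSection (D : Divisor X) where
  val : D.pairs → X → EReal
  regular : ∀ P, IsRegular (P.1.1 : Set X) (val P)
  eq_bot : ∀ P, ∀ x ∉ P.1.1, val P x = ⊥
  compat : ∀ P Q : D.pairs, ∀ x ∈ P.1.1, x ∈ Q.1.1 → IsInner x →
    val P x = ((P.1.2 x - Q.1.2 x : ℝ) : EReal) + val Q x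

variable {D : Divisor X}

/-- The support of `div s`: the points near which `s`, in some trivialisation, is not an
invertible regular function. -/
def GlobalSection.supp (s : GlobalSection D) : Set X :=
  {p | ∃ P : D.pairs, p ∈ P.1.1 ∧ ¬ ∃ W : Set X, IsOpen W ∧ p ∈ W ∧ W ⊆ P.1.1 ∧
    IsInvertible W (s.val P)}

/-- The submodule `⟨s₁, …, s_k⟩` of `Γ(X, 𝒪(D))`: all tropical linear combinations. -/
def span {k : ℕ} (s : Fin k → GlobalSection D) : Set (GlobalSection D) :=
  {m | ∃ c : Fin k → TNum, ∀ P x, m.val P x = ⨆ i, ((c i : EReal) + (s i).val P x)}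

variable (D) in
/-- `Γ(X, 𝒪(D))` is a finitely generated tropical module. -/
def FinGen : Prop :=
  ∃ (k : ℕ) (s : Fin k → GlobalSection D), span s = univ

/-- `m ≠ -∞` is an extremal of `M`.  For finitely generated `M` the extremals form the minimal
generating set, which is unique up to tropical scalars. -/
def IsExtremal (M : Set (GlobalSection D)) (m : GlobalSection D) : Prop :=
  m ∈ M ∧ (∃ P x, m.val P x ≠ ⊥) ∧
  ¬ ∃ a ∈ M, ∃ b ∈ M, (∀ P x, m.val P x = max (a.val P x) (b.val P x)) ∧ a ≠ m ∧ b ≠ m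

/-- `U(M)`: the complement of the supports of the divisors of the minimal generators of `M`. -/
def smoothLocus (M : Set (GlobalSection D)) : Set X :=
  {x | ∀ m, IsExtremal M m → x ∉ m.supp}

/-- Two sections agree up to a tropical scalar on a neighbourhood of `y`. -/
def SameMonomialAt (y : X) (m m' : GlobalSection D) : Prop :=
  ∃ c : ℝ, ∀ P : D.pairs, y ∈ P.1.1 → ∃ W : Set X, IsOpen W ∧ y ∈ W ∧
    ∀ x ∈ W, m.val P x = (c : EReal) + m'.val P x

/-- The number of monomials in `M` around `y`, up to tropical scalars: the elements of `M` which
are finite and `ℤ`-affine linear near `y` are counted up to adding constants. -/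
def monomialCount (M : Set (GlobalSection D)) (y : X) : ℕ∞ :=
  ((fun m => {m' | m' ∈ M ∧ y ∉ m'.supp ∧ SameMonomialAt y m m'}) ''
    {m | m ∈ M ∧ y ∉ m.supp}).encard

open Classical in
/-- `l_M(x)`: at points of `U(M)` the number of monomials around `x`; at other points the maximum
of these numbers over the components of `U(M)` whose closure contains `x`. -/
def slopeCount (M : Set (GlobalSection D)) (x : X) : ℕ∞ :=
  if x ∈ smoothLocus M then monomialCount M x
  else ⨆ y ∈ {y | y ∈ smoothLocus M ∧ x ∈ closure (connectedComponentIn (smoothLocus M) y)},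
    monomialCount M y

variable (D)

/-- `h⁰_a(X, D)`: the maximal `k` such that there are `k` sections generating a module with
`l(x) = k` at all `x` (and `∞` if there is no maximum). -/
def h0a : ℕ∞ :=
  sSup {N : ℕ∞ | ∃ k : ℕ, N = k ∧ ∃ s : Fin k → GlobalSection D,
    ∀ x : X, slopeCount (span s) x = k}

/-- `h⁰_b(X, D)`: the maximal `k` such that at each `x` there are `k` sections, which may depend
on `x`, generating a module with `l(x) = k` (and `∞` if there is no maximum). -/
def h0b : ℕ∞ :=
  sSup {N : ℕ∞ | ∃ k : ℕ, N = k ∧ ∀ x : X, ∃ s : Fin k → GlobalSection D,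
    slopeCount (span s) x = k}

end Divisor

end Variety

end Trop

end

/-! Both inequalities rest on a maximum principle: a regular function bounded above by an invertible
one agrees with it near every point where the two are equal (`IsRegular.eventually_eq_of_le`). At
finite points this comes down to the fact that a linear function with a local maximum on a balanced
complex is constant on the facets through that point (`linear_max_aux`): balancing gives it in
codimension one, and higher codimension is reduced to lower by induction. At points at infinity,
Fourier–Motzkin elimination replaces the point of contact by a finite one (`laurent_max`).
Consequently, if a tropical combination of sections is invertible near a point, every term attaining
the maximum there agrees with it nearby (`sameMonomialAt_of_touch`).

For `h0a ≤ h0`, let k sections generate a module with k slopes everywhere and let j < k points be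
given. Requiring the maximum of `c l + s l` to be attained twice (or to be -∞) at each point is a
tropical linear system with more unknowns than equations, so it has a nontrivial solution
(`exists_tropical_solution`). Were the resulting section invertible near one of the points, two of
the generators would agree there up to a constant, although points with k different monomials lie
arbitrarily close. So its divisor passes all j points.

For `h0 ≤ h0b`, choose near x an open cell on which every generator of the module of sections is -∞
or affine, and in it a segment along which different monomials have different slopes. If r slopes
occur, a section finite at inner points restricts to a convex piecewise linear function with fewer
than r break points, so no divisor of the linear system passes r chosen points of the segment and
`h0 ≤ r` (`h0_le_card_slopes`). For every k ≤ r, on the other hand, k generators with different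
slopes generate a module with exactly k slopes at x (`slopeCount_eq_of_connected`). -/

namespace Trop

open Module

/-! ### Rational polyhedra, lineality spaces and elimination of variables. -/

section Affine

variable {n : ℕ}

/-- The linear part of a `ℤ`-affine function. -/
noncomputable def zLin (m : (Fin n → ℤ) × ℝ) : (Fin n → ℝ) →ₗ[ℝ] ℝ :=
  ∑ i, (m.1 i : ℝ) • LinearMap.proj i

theorem zAffine_eq (m : (Fin n → ℤ) × ℝ) (y : Fin n → ℝ) : zAffine m y = m.2 + zLin m y := by
  simp [zAffine, zLin]

theorem zAffine_add (m : (Fin n → ℤ) × ℝ) (y v : Fin n → ℝ) :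
    zAffine m (y + v) = zAffine m y + zLin m v := by
  simp only [zAffine_eq, map_add]; ring

theorem zAffine_sub (m m' : (Fin n → ℤ) × ℝ) (y : Fin n → ℝ) :
    zAffine (m.1 - m'.1, m.2 - m'.2) y = zAffine m y - zAffine m' y := by
  simp only [zAffine, Pi.sub_apply, Int.cast_sub, sub_mul, Finset.sum_sub_distrib]
  ring

theorem zAffine_lineMap (m : (Fin n → ℤ) × ℝ) (y z : Fin n → ℝ) (t : ℝ) :
    zAffine m (y + t • (z - y)) = (1 - t) * zAffine m y + t * zAffine m z := by
  simp only [zAffine_eq, map_add, map_smul, map_sub, smul_eq_mul]; ring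

theorem continuous_zAffine (m : (Fin n → ℤ) × ℝ) : Continuous (zAffine m) := by
  unfold zAffine; fun_prop

theorem isClosed_polyhedron (H : Finset ((Fin n → ℤ) × ℝ)) : IsClosed (polyhedron H) := by
  have : polyhedron H = ⋂ m ∈ H, {y | 0 ≤ zAffine m y} := by ext; simp [polyhedron]
  rw [this]
  exact isClosed_biInter fun m _ => isClosed_le continuous_const (continuous_zAffine m)

theorem convex_polyhedron (H : Finset ((Fin n → ℤ) × ℝ)) : Convex ℝ (polyhedron H) := by
  rw [convex_iff_add_mem]
  intro x hx y hy a b ha hb hab m hm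
  have h1 := hx m hm
  have h2 := hy m hm
  have : zAffine m (a • x + b • y) = a * zAffine m x + b * zAffine m y := by
    simp only [zAffine_eq, map_add, map_smul, smul_eq_mul]
    linear_combination (-m.2) * hab
  rw [this]; positivity

theorem eventually_zAffine_pos (H : Finset ((Fin n → ℤ) × ℝ)) (p : Fin n → ℝ) :
    ∀ᶠ y in 𝓝 p, ∀ m ∈ H, 0 < zAffine m p → 0 < zAffine m y := by
  rw [Filter.eventually_all_finset]
  intro m _
  by_cases h : 0 < zAffine m p
  · filter_upwards [(continuous_zAffine m).continuousAt.eventually_const_lt h] with y hy _ using hy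
  · exact Filter.Eventually.of_forall fun _ h' => absurd h' h

/-- The directions in which one can move back and forth from `p` inside `polyhedron H`. -/
noncomputable def lineality (H : Finset ((Fin n → ℤ) × ℝ)) (p : Fin n → ℝ) :
    Submodule ℝ (Fin n → ℝ) :=
  ⨅ m ∈ {m ∈ (H : Set ((Fin n → ℤ) × ℝ)) | zAffine m p = 0}, LinearMap.ker (zLin m)

theorem mem_lineality {H : Finset ((Fin n → ℤ) × ℝ)} {p v : Fin n → ℝ} :
    v ∈ lineality H p ↔ ∀ m ∈ H, zAffine m p = 0 → zLin m v = 0 := by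
  simp [lineality, Submodule.mem_iInf]

/-- The right-hand side depends only on the polyhedron as a set, so that facets given by different
systems of inequalities can be compared. Strict inequalities survive small moves; a tight one
survives moves in both directions only if its linear part vanishes. -/
theorem mem_lineality_iff {H : Finset ((Fin n → ℤ) × ℝ)} {p v : Fin n → ℝ}
    (hp : p ∈ polyhedron H) :
    v ∈ lineality H p ↔
      ∃ ε : ℝ, 0 < ε ∧ p + ε • v ∈ polyhedron H ∧ p + ε • (-v) ∈ polyhedron H := by
  rw [mem_lineality]
  constructor
  · intro h
    have key : ∀ w : Fin n → ℝ, (∀ m ∈ H, zAffine m p = 0 → zLin m w = 0) →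
        ∀ᶠ ε : ℝ in 𝓝 0, p + ε • w ∈ polyhedron H := by
      intro w hw
      have hc : Filter.Tendsto (fun ε : ℝ => p + ε • w) (𝓝 0) (𝓝 p) := by
        have : Continuous (fun ε : ℝ => p + ε • w) := by fun_prop
        simpa using this.tendsto 0
      filter_upwards [hc.eventually (eventually_zAffine_pos H p)] with ε hε m hm
      rcases (hp m hm).eq_or_lt' with h0 | h0
      · rw [zAffine_add, map_smul, hw m hm h0, h0]; simp
      · exact (hε m hm h0).le
    have h1 := (key v h).and (key (-v) (fun m hm h0 => by simp [h m hm h0]))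
    obtain ⟨ε, hε, hpos⟩ :=
      ((h1.filter_mono nhdsWithin_le_nhds).and (self_mem_nhdsWithin (s := Ioi (0 : ℝ)))).exists
    exact ⟨ε, hpos, hε.1, hε.2⟩
  · rintro ⟨ε, hε, h1, h2⟩ m hm h0
    have h1 := h1 m hm
    have h2 := h2 m hm
    simp only [zAffine_add, h0, map_smul, map_neg, smul_eq_mul, zero_add] at h1 h2
    have := mul_nonneg_iff_of_pos_left hε |>.1 h1
    have := mul_nonneg_iff_of_pos_left hε |>.1 h2
    linarith

theorem lineality_le_vectorSpan {H : Finset ((Fin n → ℤ) × ℝ)} {p : Fin n → ℝ}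
    (hp : p ∈ polyhedron H) : lineality H p ≤ vectorSpan ℝ (polyhedron H) := by
  intro v hv
  obtain ⟨ε, hε, h1, -⟩ := (mem_lineality_iff hp).1 hv
  have := vsub_mem_vectorSpan ℝ h1 hp
  simp only [vsub_eq_sub, add_sub_cancel_left] at this
  exact (Submodule.smul_mem_iff _ hε.ne').1 this

theorem eq_of_vectorSpan_le_ker {P : Set (Fin n → ℝ)} {L : (Fin n → ℝ) →ₗ[ℝ] ℝ}
    (h : vectorSpan ℝ P ≤ LinearMap.ker L) {y p : Fin n → ℝ} (hy : y ∈ P) (hp : p ∈ P) :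
    L y = L p := by
  have := h (vsub_mem_vectorSpan ℝ hy hp)
  rw [LinearMap.mem_ker, vsub_eq_sub, map_sub] at this
  linarith

/-- `p` lies between `y` and the reflected point. The inequalities in `J` are nonnegative at both
ends and zero at `p`, hence zero at `y`. -/
theorem IsFace.mem_of_reflect {F P : Set (Fin n → ℝ)} (hF : IsFace F P) {p y : Fin n → ℝ}
    (hp : p ∈ F) (hy : y ∈ P) {ε : ℝ} (hε : 0 < ε) (h : p + ε • (p - y) ∈ P) : y ∈ F := by
  obtain ⟨H, rfl, J, hJ, rfl⟩ := hF
  refine ⟨hy, fun m hm => ?_⟩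
  have h1 := hp.2 m hm
  have h2 := hy m (hJ hm)
  have h3 := h m (hJ hm)
  simp only [zAffine_eq, map_add, map_smul, map_sub, smul_eq_mul] at h1 h2 h3 ⊢
  nlinarith

theorem IsFace.isClosed {F P : Set (Fin n → ℝ)} (hF : IsFace F P) : IsClosed F := by
  obtain ⟨H, rfl, J, hJ, rfl⟩ := hF
  have : {y ∈ polyhedron H | ∀ m ∈ J, zAffine m y = 0} =
      polyhedron H ∩ ⋂ m ∈ J, {y | zAffine m y = 0} := by ext; simp
  rw [this]
  exact (isClosed_polyhedron H).inter
    (isClosed_biInter fun m _ => isClosed_eq (continuous_zAffine m) continuous_const)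

theorem exists_between_of_finite {α β : Type*} [Finite α] [Finite β] (l : α → ℝ) (u : β → ℝ)
    (h : ∀ i j, l i ≤ u j) : ∃ t, (∀ i, l i ≤ t) ∧ ∀ j, t ≤ u j := by
  rcases isEmpty_or_nonempty α with hα | hα
  · rcases isEmpty_or_nonempty β with hβ | hβ
    · exact ⟨0, fun i => hα.elim i, fun j => hβ.elim j⟩
    · obtain ⟨j, hj⟩ := Finite.exists_min u
      exact ⟨u j, fun i => hα.elim i, hj⟩
  · obtain ⟨i, hi⟩ := Finite.exists_max l
    exact ⟨l i, hi, fun j => h i j⟩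

/-- Fourier–Motzkin: a finite system of weak affine inequalities that can be solved up to
arbitrarily small perturbations of the constants can be solved. -/
theorem exists_forall_nonneg_of_relaxed (n : ℕ) : ∀ {ι : Type} [Finite ι] (a : ι → Fin n → ℝ)
    (b w : ι → ℝ), (∀ ε : ℝ, 0 < ε → ∃ y : Fin n → ℝ, ∀ i, 0 ≤ b i + ε * w i + ∑ j, a i j * y j) →
    ∃ y : Fin n → ℝ, ∀ i, 0 ≤ b i + ∑ j, a i j * y j := by
  induction n with
  | zero =>
    intro ι _ a b w h
    refine ⟨0, fun i => ?_⟩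
    simp only [Finset.univ_eq_empty, Finset.sum_empty, add_zero] at h ⊢
    by_contra! hb
    have hw : 0 < |w i| + 1 := by positivity
    -- For this `ε` the perturbation `ε * w i` is at most half of `-b i`, too little to compensate a
    -- negative `b i`.
    obtain ⟨-, hε⟩ := h (-b i / (2 * (|w i| + 1))) (by apply div_pos <;> linarith)
    have h1 := hε i
    have h2 : -b i / (2 * (|w i| + 1)) * w i ≤ -b i / 2 := by
      rw [div_mul_eq_mul_div, div_le_div_iff₀ (by positivity) (by norm_num)]
      nlinarith [le_abs_self (w i)]
    linarith
  | succ n ih =>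
    intro ι _ a b w h
    -- One new row for each row free of the variable 0, and one for each pair of rows with opposite
    -- signs in it; `c` forms the nonnegative combination of a pair that cancels this variable.
    -- Since `c` is linear, the perturbation keeps its form and the relaxed hypothesis passes to the
    -- smaller system.
    let κ := {i // a i 0 = 0} ⊕ ({i // 0 < a i 0} × {i // a i 0 < 0})
    let c : κ → (ι → ℝ) → ℝ := fun k f =>
      Sum.elim (fun i : {i // a i 0 = 0} => f i)
      (fun ij : {i // 0 < a i 0} × {i // a i 0 < 0} =>
        -a ij.2 0 * f ij.1 + a ij.1 0 * f ij.2) k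
    have clin : ∀ k (f g : ι → ℝ) (t : ℝ), c k (fun i => f i + t * g i) = c k f + t * c k g := by
      rintro (k | k) f g t
      · rfl
      · simp only [c, Sum.elim_inr]; ring
    have csum : ∀ k (y : Fin n → ℝ), ∑ j : Fin n, c k (fun i => a i j.succ) * y j =
        c k (fun i => ∑ j : Fin n, a i j.succ * y j) := by
      rintro (k | k) y
      · rfl
      · simp only [c, Sum.elim_inr, add_mul, Finset.sum_add_distrib, Finset.mul_sum]
        congr 1 <;> exact Finset.sum_congr rfl fun j _ => by ring
    have cpos : ∀ k (f : ι → ℝ) (y : ℝ), (∀ i, 0 ≤ f i + a i 0 * y) → 0 ≤ c k f := by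
      rintro (⟨i, hi⟩ | ⟨⟨i, hi⟩, ⟨j, hj⟩⟩) f y hf
      · simpa [c, hi] using hf i
      · have h1 := mul_nonneg (neg_nonneg.2 hj.le) (hf i)
        have h2 := mul_nonneg hi.le (hf j)
        simp only [c, Sum.elim_inr]
        nlinarith
    obtain ⟨y, hy⟩ := ih (fun (k : κ) (j : Fin n) => c k (fun i => a i j.succ)) (fun k => c k b)
      (fun k => c k w) (by
        intro ε hε
        obtain ⟨y, hy⟩ := h ε hε
        refine ⟨fun j => y j.succ, fun k => ?_⟩
        rw [csum k (fun j => y j.succ), ← clin]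
        have := cpos k (fun i => b i + ε * w i + 1 * ∑ j : Fin n, a i j.succ * y j.succ) (y 0) (by
          intro i
          have := hy i
          rw [Fin.sum_univ_succ] at this
          linarith)
        have h2 := clin k (fun i => b i + ε * w i) (fun i => ∑ j : Fin n, a i j.succ * y j.succ) 1
        rw [one_mul] at h2
        rwa [h2] at this)
    have hy' : ∀ k, 0 ≤ c k (fun i => b i + ∑ j : Fin n, a i j.succ * y j) := by
      intro k
      have h1 := hy k
      rw [csum] at h1
      have h2 := clin k b (fun i => ∑ j : Fin n, a i j.succ * y j) 1
      simp only [one_mul] at h2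
      rwa [h2]
    set R : ι → ℝ := fun i => b i + ∑ j : Fin n, a i j.succ * y j with hR
    -- The rows of the pairs say that every lower bound for the eliminated variable is at most every
    -- upper bound.
    obtain ⟨t, ht1, ht2⟩ := exists_between_of_finite
      (fun i : {i // 0 < a i 0} => -R i / a i 0) (fun j : {i // a i 0 < 0} => R j / -a j 0) (by
        rintro ⟨i, hi⟩ ⟨j, hj⟩
        have := hy' (Sum.inr (⟨i, hi⟩, ⟨j, hj⟩))
        simp only [c, Sum.elim_inr] at this
        rw [div_le_div_iff₀ hi (neg_pos.2 hj)]
        linarith)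
    refine ⟨Fin.cons t y, fun i => ?_⟩
    have : b i + ∑ j, a i j * (Fin.cons t y : Fin (n + 1) → ℝ) j = R i + a i 0 * t := by
      rw [Fin.sum_univ_succ]; simp [hR]; ring
    rw [this]
    rcases lt_trichotomy (a i 0) 0 with hi | hi | hi
    · have := ht2 ⟨i, hi⟩
      rw [le_div_iff₀ (neg_pos.2 hi)] at this
      simp only at this
      linarith
    · have := hy' (Sum.inl ⟨i, hi⟩)
      rw [hi]; simpa [c] using this
    · have := ht1 ⟨i, hi⟩
      rw [div_le_iff₀ hi] at this
      simp only at this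
      linarith

/-- A `ℤ`-affine function that comes arbitrarily close to `c` from below on a polyhedron
attains a value at least `c`. -/
theorem exists_le_zAffine {H : Finset ((Fin n → ℤ) × ℝ)} {m : (Fin n → ℤ) × ℝ} {c : ℝ}
    (h : ∀ ε : ℝ, 0 < ε → ∃ y ∈ polyhedron H, c - ε ≤ zAffine m y) :
    ∃ y ∈ polyhedron H, c ≤ zAffine m y := by
  -- Only the row `none`, which belongs to `m`, is relaxed; the inequalities of `H` get weight 0.
  obtain ⟨y, hy⟩ := exists_forall_nonneg_of_relaxed n (ι := Option H)
    (fun o => o.elim (fun i => (m.1 i : ℝ)) (fun m' i => (m'.1.1 i : ℝ)))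
    (fun o => o.elim (m.2 - c) (fun m' => m'.1.2)) (fun o => o.elim 1 (fun _ => 0)) (by
      intro ε hε
      obtain ⟨y, hy, hc⟩ := h ε hε
      refine ⟨y, ?_⟩
      rintro (_ | ⟨m', hm'⟩)
      · simp only [zAffine] at hc
        simp only [Option.elim]
        linarith
      · simpa [zAffine] using hy m' hm')
  refine ⟨y, fun m' hm' => hy (some ⟨m', hm'⟩), ?_⟩
  have := hy none
  simp only [Option.elim] at this
  simp only [zAffine]
  linarith

end Affine

end Trop

namespace Trop

open Module

/-! ### Facets of a balanced complex, and balancing in codimension one. -/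

section FinitePart

variable {n : ℕ}

theorem isEmbedding_finitePart : IsEmbedding (finitePart (n := n)) := by
  have h : IsEmbedding (fun r : ℝ => (⟨(r : EReal), EReal.coe_ne_top r⟩ : TNum)) :=
    EReal.isEmbedding_coe.codRestrict {x : EReal | x ≠ ⊤} (fun r => EReal.coe_ne_top r)
  exact IsEmbedding.piMap (fun _ : Fin n => h)

theorem finitePart_injective : Function.Injective (finitePart (n := n)) :=
  isEmbedding_finitePart.injective

theorem finitePart_mem_tClosure {P : Set (Fin n → ℝ)} (hP : IsClosed P) {y : Fin n → ℝ} :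
    finitePart y ∈ tClosure P ↔ y ∈ P := by
  have := isEmbedding_finitePart.isInducing.closure_eq_preimage_closure_image P
  rw [hP.closure_eq] at this
  exact (Set.ext_iff.1 this y).symm

end FinitePart

namespace BalancedComplex

variable {n d : ℕ} (C : BalancedComplex n d)

open Classical in
/-- A system of inequalities defining the facet `P`. -/
noncomputable def ineq (P : Set (Fin n → ℝ)) : Finset ((Fin n → ℤ) × ℝ) :=
  if h : P ∈ C.facets then (C.polyhedral P h).choose else ∅

variable {C}

theorem eq_polyhedron {P : Set (Fin n → ℝ)} (hP : P ∈ C.facets) : P = polyhedron (C.ineq P) := by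
  rw [ineq, dif_pos hP]
  exact (C.polyhedral P hP).choose_spec

theorem mem_facet {P : Set (Fin n → ℝ)} (hP : P ∈ C.facets) {y : Fin n → ℝ} :
    y ∈ P ↔ ∀ m ∈ C.ineq P, 0 ≤ zAffine m y := by
  conv_lhs => rw [eq_polyhedron hP]
  rfl

theorem isClosed_facet {P : Set (Fin n → ℝ)} (hP : P ∈ C.facets) : IsClosed P := by
  rw [eq_polyhedron hP]; exact isClosed_polyhedron _

theorem convex_facet {P : Set (Fin n → ℝ)} (hP : P ∈ C.facets) : Convex ℝ P := by
  rw [eq_polyhedron hP]; exact convex_polyhedron _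

/-- `C.inter` yields a face in `𝕋^n`, that is, a face of `P` cut with a coordinate face at infinity.
A common finite point forces `I` to be empty. -/
theorem isFace_inter {P Q : Set (Fin n → ℝ)} (hP : P ∈ C.facets) (hQ : Q ∈ C.facets)
    (h : (P ∩ Q).Nonempty) : IsFace (P ∩ Q) P := by
  classical
  obtain ⟨p, hpP, hpQ⟩ := h
  have hmem : ∀ y, finitePart y ∈ ⋂ R ∈ ({P, Q} : Finset (Set (Fin n → ℝ))), tClosure R ↔
      y ∈ P ∩ Q := by
    intro y
    simp [finitePart_mem_tClosure (isClosed_facet hP), finitePart_mem_tClosure (isClosed_facet hQ)]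
  obtain ⟨F, hF, I, hI⟩ := C.inter {P, Q} (by
    intro R hR
    simp only [Finset.mem_insert, Finset.mem_singleton] at hR
    rcases hR with rfl | rfl <;> assumption) ⟨P, by simp⟩ P (by simp)
  have hp : finitePart p ∈ tClosure F ∩ {t | ∀ i ∈ I, (t i : EReal) = ⊥} := by
    have := (hmem p).2 ⟨hpP, hpQ⟩
    rwa [hI] at this
  have hIe : ∀ i, i ∉ I := fun i hi => EReal.coe_ne_bot (p i) (hp.2 i hi)
  have : P ∩ Q = F := by
    ext y
    rw [← hmem y, hI, ← finitePart_mem_tClosure hF.isClosed (y := y)]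
    simp [hIe]
  rwa [this]

/-- The finite part of the support of the complex. -/
def finSupport (C : BalancedComplex n d) : Set (Fin n → ℝ) := ⋃ P ∈ C.facets, P

theorem mem_finSupport {y : Fin n → ℝ} : y ∈ C.finSupport ↔ ∃ P ∈ C.facets, y ∈ P := by
  simp [finSupport]

theorem finitePart_mem_support {y : Fin n → ℝ} : finitePart y ∈ C.support ↔ y ∈ C.finSupport := by
  simp only [support, mem_finSupport, mem_iUnion, exists_prop]
  exact exists_congr fun P => and_congr_right fun hP => finitePart_mem_tClosure (isClosed_facet hP)

/-- `p` is the midpoint of a segment of `P` in the direction `v`; the face `P ∩ Q` contains `p` and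
therefore the whole segment. -/
theorem lineality_le {P Q : Set (Fin n → ℝ)} (hP : P ∈ C.facets) (hQ : Q ∈ C.facets)
    {p : Fin n → ℝ} (hpP : p ∈ P) (hpQ : p ∈ Q) :
    lineality (C.ineq P) p ≤ lineality (C.ineq Q) p := by
  intro v hv
  have eP := eq_polyhedron hP
  have eQ := eq_polyhedron hQ
  obtain ⟨ε, hε, h1, h2⟩ := (mem_lineality_iff (eP ▸ hpP)).1 hv
  rw [← eP] at h1 h2
  have hF := isFace_inter hP hQ ⟨p, hpP, hpQ⟩
  refine (mem_lineality_iff (eQ ▸ hpQ)).2 ⟨ε, hε, ?_, ?_⟩ <;> rw [← eQ]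
  · exact (hF.mem_of_reflect (p := p) ⟨hpP, hpQ⟩ h1 one_pos (by
      convert h2 using 1; simp)).2
  · exact (hF.mem_of_reflect (p := p) ⟨hpP, hpQ⟩ h2 one_pos (by
      convert h1 using 1; simp)).2

theorem lineality_eq {P Q : Set (Fin n → ℝ)} (hP : P ∈ C.facets) (hQ : Q ∈ C.facets)
    {p : Fin n → ℝ} (hpP : p ∈ P) (hpQ : p ∈ Q) :
    lineality (C.ineq P) p = lineality (C.ineq Q) p :=
  le_antisymm (lineality_le hP hQ hpP hpQ) (lineality_le hQ hP hpQ hpP)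

theorem lineality_le_vectorSpan {P : Set (Fin n → ℝ)} (hP : P ∈ C.facets)
    {p : Fin n → ℝ} (hp : p ∈ P) : lineality (C.ineq P) p ≤ vectorSpan ℝ P := by
  conv_rhs => rw [eq_polyhedron hP]
  exact Trop.lineality_le_vectorSpan (by rwa [← eq_polyhedron hP])

/-- A linear function with a local maximum at `p` vanishes on the lineality space at `p`. -/
theorem map_lineality_eq_zero {P : Set (Fin n → ℝ)} (hP : P ∈ C.facets)
    {p : Fin n → ℝ} (hp : p ∈ P) {L : (Fin n → ℝ) →ₗ[ℝ] ℝ} (hL : ∀ y ∈ P, L y ≤ L p)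
    {v : Fin n → ℝ} (hv : v ∈ lineality (C.ineq P) p) : L v = 0 := by
  have eP := eq_polyhedron hP
  obtain ⟨ε, hε, h1, h2⟩ := (mem_lineality_iff (eP ▸ hp)).1 hv
  rw [← eP] at h1 h2
  have h1 := hL _ h1
  have h2 := hL _ h2
  simp only [map_add, map_smul, map_neg, smul_eq_mul] at h1 h2
  have : ε * L v = 0 := by linarith
  rcases mul_eq_zero.1 this with h | h
  · exact absurd h hε.ne'
  · exact h

/-- The linear maximum principle at points in the relative interior of a cell of codimension one:
this is where balancing enters. -/
theorem linear_max_of_codim_one {p : Fin n → ℝ} {P : Set (Fin n → ℝ)} (hP : P ∈ C.facets)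
    (hp : p ∈ P) (hd : finrank ℝ (lineality (C.ineq P) p) + 1 = d) {L : (Fin n → ℝ) →ₗ[ℝ] ℝ}
    (hL : ∀ Q ∈ C.facets, p ∈ Q → ∀ y ∈ Q, L y ≤ L p) :
    ∀ Q ∈ C.facets, p ∈ Q → ∀ y ∈ Q, L y = L p := by
  classical
  have eP := eq_polyhedron hP
  set V := lineality (C.ineq P) p with hV
  have hLV : ∀ v ∈ V, L v = 0 := fun v hv => map_lineality_eq_zero hP hp (hL P hP hp) hv
  -- The cell with `p` in its relative interior: all inequalities tight at `p` become equations. Its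
  -- direction space is `V`, so it has codimension one and balancing applies to it.
  set E : Set (Fin n → ℝ) := {y ∈ P | ∀ m ∈ {m ∈ C.ineq P | zAffine m p = 0}, zAffine m y = 0}
    with hE
  have hpE : p ∈ E := ⟨hp, fun m hm => (Finset.mem_filter.1 hm).2⟩
  have hEV : ∀ y ∈ E, y - p ∈ V := by
    intro y hy
    rw [hV, mem_lineality]
    intro m hm h0
    have h1 := hy.2 m (Finset.mem_filter.2 ⟨hm, h0⟩)
    simp only [zAffine_eq, map_sub] at h0 h1 ⊢
    linarith
  have hVE : vectorSpan ℝ E = V := by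
    apply le_antisymm
    · rw [vectorSpan_eq_span_vsub_set_right ℝ hpE, Submodule.span_le]
      rintro _ ⟨y, hy, rfl⟩
      exact hEV y hy
    · intro v hv
      obtain ⟨ε, hε, h1, -⟩ := (mem_lineality_iff (eP ▸ hp)).1 hv
      rw [← eP] at h1
      have hmem : p + ε • v ∈ E := by
        refine ⟨h1, fun m hm => ?_⟩
        rw [Finset.mem_filter] at hm
        rw [zAffine_add, hm.2, map_smul, mem_lineality.1 hv m hm.1 hm.2]; simp
      have := vsub_mem_vectorSpan ℝ hmem hpE
      simp only [vsub_eq_sub, add_sub_cancel_left] at this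
      exact (Submodule.smul_mem_iff _ hε.ne').1 this
  have hsub : ∀ Q ∈ C.facets, p ∈ Q → E ⊆ Q := by
    intro Q hQ hpQ y hy
    obtain ⟨ε, hε, -, h2⟩ := (mem_lineality_iff (eP ▸ hp)).1 (hEV y hy)
    rw [← eP, neg_sub] at h2
    exact ((isFace_inter hP hQ ⟨p, hp, hpQ⟩).mem_of_reflect ⟨hp, hpQ⟩ hy.1 hε h2).2
  obtain ⟨v, hv, hsum⟩ := C.balanced E ⟨p, hpE⟩
    ⟨P, hP, C.ineq P, eP, _, Finset.filter_subset _ _, rfl⟩ (by rw [hVE]; exact hd)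
  have hstep : ∀ Q ∈ C.facets, E ⊆ Q → ∃ y ∈ E, ∃ ε : ℝ, 0 < ε ∧
      y + ε • (fun i => (v Q i : ℝ)) ∈ Q := fun Q hQ hEQ => (hv Q hQ hEQ).2.1
  -- A short move from `E` along `v Q` stays in `Q`, where `L` is at most `L p`; since `L` is
  -- constant along `E`, it is nonpositive on `v Q`. The sum of the `v Q` lies in `V`, where `L`
  -- vanishes, so all these values are zero.
  have hle : ∀ Q ∈ C.facets.filter (fun Q => E ⊆ Q), L (fun i => (v Q i : ℝ)) ≤ 0 := by
    intro Q hQ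
    rw [Finset.mem_filter] at hQ
    obtain ⟨y, hy, ε, hε, hyQ⟩ := hstep Q hQ.1 hQ.2
    have h1 := hL Q hQ.1 (hQ.2 hpE) _ hyQ
    have h2 := hLV _ (hEV y hy)
    simp only [map_add, map_smul, map_sub, smul_eq_mul] at h1 h2
    nlinarith
  have hzero : ∀ Q ∈ C.facets.filter (fun Q => E ⊆ Q), L (fun i => (v Q i : ℝ)) = 0 := by
    rw [← Finset.sum_eq_zero_iff_of_nonpos hle, ← map_sum]
    exact hLV _ (hVE ▸ hsum)
  intro Q hQ hpQ y hy
  have hEQ := hsub Q hQ hpQ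
  refine eq_of_vectorSpan_le_ker ?_ hy hpQ
  obtain ⟨z, hz, ε, hε, hzQ⟩ := hstep Q hQ hEQ
  have hvQ : (fun i => (v Q i : ℝ)) ∈ vectorSpan ℝ Q := by
    have := vsub_mem_vectorSpan ℝ hzQ (hEQ hz)
    simp only [vsub_eq_sub, add_sub_cancel_left] at this
    exact (Submodule.smul_mem_iff _ hε.ne').1 this
  have hnot : (fun i => (v Q i : ℝ)) ∉ V := hVE ▸ (hv Q hQ hEQ).1
  set W := V ⊔ Submodule.span ℝ {fun i => (v Q i : ℝ)} with hW
  have hWle : W ≤ vectorSpan ℝ Q := by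
    refine sup_le ?_ ?_
    · rw [← hVE]; exact vectorSpan_mono ℝ hEQ
    · rw [Submodule.span_singleton_le_iff_mem]; exact hvQ
  have hlt : V < W := by
    refine lt_of_le_of_ne le_sup_left fun h => hnot ?_
    rw [h]
    exact Submodule.mem_sup_right (Submodule.mem_span_singleton_self _)
  -- Dimension count: `V` has dimension d - 1 and does not contain the primitive vector.
  have hWeq : W = vectorSpan ℝ Q := by
    apply Submodule.eq_of_le_of_finrank_le hWle
    rw [C.pure Q hQ, ← hd]
    exact Submodule.finrank_lt_finrank_of_lt hlt
  rw [← hWeq, hW]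
  refine sup_le (fun w hw => hLV w hw) ?_
  rw [Submodule.span_singleton_le_iff_mem]
  exact hzero Q (Finset.mem_filter.2 ⟨hQ, hEQ⟩)

end BalancedComplex

end Trop

namespace Trop

open Module

/-! ### The linear maximum principle, by induction on the codimension. -/

namespace BalancedComplex

variable {n d : ℕ} {C : BalancedComplex n d}

/-- Near `p`, every facet contains `p`, and inequalities strict at `p` remain strict. -/
theorem eventually_facet (C : BalancedComplex n d) (p : Fin n → ℝ) :
    ∀ᶠ y in 𝓝 p, ∀ Q ∈ C.facets, (y ∈ Q → p ∈ Q) ∧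
      ∀ m ∈ C.ineq Q, 0 < zAffine m p → 0 < zAffine m y := by
  rw [Filter.eventually_all_finset]
  intro Q hQ
  refine Filter.Eventually.and ?_ (eventually_zAffine_pos _ _)
  by_cases hp : p ∈ Q
  · exact Filter.Eventually.of_forall fun _ _ => hp
  · filter_upwards [(isClosed_facet hQ).isOpen_compl.mem_nhds hp] with y hy hyQ
    exact absurd hyQ hy

/-- `π` projects along `V` onto a complement. It stands for the quotient by the directions in which
one can move freely, while all computations stay in the original space. -/
theorem exists_linear_section {E : Type*} [AddCommGroup E] [Module ℝ E] (V : Submodule ℝ E) :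
    ∃ π : E →ₗ[ℝ] E, (∀ x, x - π x ∈ V) ∧ ∀ v ∈ V, π v = 0 := by
  obtain ⟨g, hg⟩ := V.mkQ.exists_rightInverse_of_surjective V.range_mkQ
  refine ⟨g ∘ₗ V.mkQ, fun x => ?_, fun v hv => ?_⟩
  · refine (Submodule.ext_iff.1 V.ker_mkQ _).1 ?_
    rw [LinearMap.mem_ker, map_sub, sub_eq_zero]
    exact (LinearMap.congr_fun hg (V.mkQ x)).symm
  · rw [← Submodule.ker_mkQ V, LinearMap.mem_ker] at hv
    rw [LinearMap.comp_apply, hv, map_zero]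

theorem isCompact_slice {F : Type*} [NormedAddCommGroup F] [NormedSpace ℝ F]
    [FiniteDimensional ℝ F] (T : (Fin n → ℝ) ≃L[ℝ] F) (π : (Fin n → ℝ) →ₗ[ℝ] (Fin n → ℝ))
    (p : Fin n → ℝ) (r : ℝ) {𝓕 : Finset (Set (Fin n → ℝ))} (h : ∀ Q ∈ 𝓕, IsClosed Q) :
    IsCompact {x | π x = x ∧ ‖T x‖ = r ∧ ∃ Q ∈ 𝓕, p + x ∈ Q} := by
  have h1 : IsCompact {x | ‖T x‖ = r} := by
    have := (isCompact_sphere (0 : F) r).image T.symm.continuous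
    convert this using 1
    ext x
    constructor
    · intro hx; exact ⟨T x, by simpa using hx, by simp⟩
    · rintro ⟨w, hw, rfl⟩; simpa using hw
  have h2 : IsClosed (⋃ Q ∈ 𝓕, {x | p + x ∈ Q}) :=
    isClosed_biUnion_finset fun Q hQ => (h Q hQ).preimage (by fun_prop)
  have h3 : IsClosed {x | π x = x} :=
    isClosed_eq (LinearMap.continuous_of_finiteDimensional π) continuous_id
  have h4 : {x | π x = x ∧ ‖T x‖ = r ∧ ∃ Q ∈ 𝓕, p + x ∈ Q} =
      {x | ‖T x‖ = r} ∩ ({x | π x = x} ∩ ⋃ Q ∈ 𝓕, {x | p + x ∈ Q}) := by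
    ext x
    simp only [Set.mem_ofPred_eq, mem_inter_iff, mem_iUnion, exists_prop]
    tauto
  rw [h4]
  exact h1.inter_right (h3.inter h2)

open Classical in
/-- The linear maximum principle on balanced complexes. -/
theorem linear_max_aux (j : ℕ) : ∀ {p : Fin n → ℝ} {P : Set (Fin n → ℝ)}, P ∈ C.facets → p ∈ P →
    d ≤ finrank ℝ (lineality (C.ineq P) p) + j → ∀ {L : (Fin n → ℝ) →ₗ[ℝ] ℝ},
    (∀ Q ∈ C.facets, p ∈ Q → ∀ y ∈ Q, L y ≤ L p) →
    ∀ Q ∈ C.facets, p ∈ Q → ∀ y ∈ Q, L y = L p := by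
  -- `j` bounds `d` minus the dimension of the lineality space at `p`. Codimension zero and one are
  -- settled directly; from codimension two on, the induction hypothesis is applied at nearby
  -- points.
  induction j with
  | zero =>
    intro p P hP hp hd L hL Q hQ hpQ y hy
    rw [lineality_eq hP hQ hp hpQ] at hd
    refine eq_of_vectorSpan_le_ker ?_ hy hpQ
    rw [← Submodule.eq_of_le_of_finrank_le (lineality_le_vectorSpan hQ hpQ)
      (by rw [C.pure Q hQ]; exact hd)]
    exact fun v hv => map_lineality_eq_zero hQ hpQ (hL Q hQ hpQ) hv
  | succ j ih =>
    intro p P hP hp hd L hL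
    rcases Nat.lt_or_ge d (finrank ℝ (lineality (C.ineq P) p) + 2) with hd2 | hd2
    · rcases Nat.lt_or_ge (finrank ℝ (lineality (C.ineq P) p)) d with h | h
      · exact linear_max_of_codim_one hP hp (by omega) hL
      · exact ih hP hp (by omega) hL
    set V := lineality (C.ineq P) p with hV
    have hVQ : ∀ Q ∈ C.facets, p ∈ Q → lineality (C.ineq Q) p = V :=
      fun Q hQ hpQ => lineality_eq hQ hP hpQ hp
    have hLV : ∀ v ∈ V, L v = 0 := fun v hv => map_lineality_eq_zero hP hp (hL P hP hp) hv
    obtain ⟨π, hπV, hπ0⟩ := exists_linear_section V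
    have hππ : ∀ x, π (π x) = π x := fun x => by
      have := hπ0 _ (hπV x)
      rw [map_sub, sub_eq_zero] at this
      exact this.symm
    have hLπ : ∀ x, L (π x) = L x := fun x => by
      have := hLV _ (hπV x)
      rw [map_sub] at this; linarith
    obtain ⟨T⟩ : Nonempty ((Fin n → ℝ) ≃L[ℝ] EuclideanSpace ℝ (Fin n)) :=
      ⟨(EuclideanSpace.equiv (Fin n) ℝ).symm⟩
    obtain ⟨r, hr, hG⟩ : ∃ r : ℝ, 0 < r ∧ ∀ x, ‖T x‖ ≤ r → ∀ Q ∈ C.facets, (p + x ∈ Q → p ∈ Q) ∧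
        ∀ m ∈ C.ineq Q, 0 < zAffine m p → 0 < zAffine m (p + x) := by
      have hc : Filter.Tendsto (fun w => p + T.symm w) (𝓝 0) (𝓝 p) := by
        have : Continuous (fun w => p + T.symm w) := by fun_prop
        simpa using this.tendsto 0
      have := hc.eventually (C.eventually_facet p)
      obtain ⟨r, hr, hb⟩ := Metric.nhds_basis_closedBall.eventually_iff.1 this
      refine ⟨r, hr, fun x hx => ?_⟩
      have := hb (x := T x) (by simpa using hx)
      simpa using this
    -- Near `p` a facet is a cone invariant under `V`: the inequalities tight at `p` are homogeneous
    -- in `x` and do not see `V`, the others stay positive in the ball of radius `r`.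
    have F1 : ∀ Q ∈ C.facets, p ∈ Q → ∀ x, p + x ∈ Q → ∀ t : ℝ, 0 ≤ t → ‖T (t • π x)‖ ≤ r →
        p + t • π x ∈ Q := by
      intro Q hQ hpQ x hx t ht hn
      rw [mem_facet hQ] at hpQ hx ⊢
      intro m hm
      rcases (hpQ m hm).eq_or_lt' with h0 | h0
      · have h1 := hx m hm
        have h2 : zLin m (x - π x) = 0 :=
          mem_lineality.1 ((hVQ Q hQ ((mem_facet hQ).2 hpQ)).symm ▸ hπV x) m hm h0
        rw [zAffine_add, h0, zero_add] at h1 ⊢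
        rw [map_sub] at h2
        rw [map_smul, smul_eq_mul]
        exact mul_nonneg ht (by linarith)
      · exact ((hG _ hn Q hQ).2 m hm h0).le
    -- The inequalities tight at `p + x` are already tight at `p`, so the lineality space at `p + x`
    -- contains `V`; it also contains `x`, hence is strictly larger.
    have F2 : ∀ Q ∈ C.facets, p ∈ Q → ∀ x, p + x ∈ Q → ‖T x‖ ≤ r → x ∉ V →
        d ≤ finrank ℝ (lineality (C.ineq Q) (p + x)) + j := by
      intro Q hQ hpQ x hx hn hxV
      have ht : ∀ m ∈ C.ineq Q, zAffine m (p + x) = 0 → zAffine m p = 0 := by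
        intro m hm h0
        rcases ((mem_facet hQ).1 hpQ m hm).eq_or_lt' with h1 | h1
        · exact h1
        · exact absurd h0 ((hG x hn Q hQ).2 m hm h1).ne'
      have hlt : V < lineality (C.ineq Q) (p + x) := by
        refine lt_of_le_of_ne ?_ fun h => hxV ?_
        · intro v hv
          rw [← hVQ Q hQ hpQ, mem_lineality] at hv
          exact mem_lineality.2 fun m hm h0 => hv m hm (ht m hm h0)
        · rw [h, mem_lineality]
          intro m hm h0
          have h1 := ht m hm h0
          rw [zAffine_add, h1, zero_add] at h0
          exact h0
      have := Submodule.finrank_lt_finrank_of_lt hlt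
      omega
    by_contra! hcon
    obtain ⟨P₀, hP₀, hpP₀, y₀, hy₀, hne⟩ := hcon
    -- The link of the cell at `p`, restricted to the facets on which `L` is not constant. It is
    -- compact, and nonempty by the assumption to be refuted.
    obtain ⟨S, hSdef⟩ : ∃ S : Set (Fin n → ℝ), S = {x | π x = x ∧ ‖T x‖ = r ∧
      ∃ Q ∈ C.facets.filter (fun Q => p ∈ Q ∧ ∃ y ∈ Q, L y ≠ L p), p + x ∈ Q} := ⟨_, rfl⟩
    have hSmem : ∀ x, x ∈ S ↔ π x = x ∧ ‖T x‖ = r ∧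
        ∃ Q ∈ C.facets, (p ∈ Q ∧ ∃ y ∈ Q, L y ≠ L p) ∧ p + x ∈ Q := fun x => by
      rw [hSdef]; simp only [Set.mem_ofPred_eq, Finset.mem_filter, and_assoc]
    have hSV : ∀ x ∈ S, x ∉ V := by
      intro x hx hxV
      obtain ⟨hx, hxr, -⟩ := (hSmem x).1 hx
      rw [hπ0 x hxV] at hx
      rw [← hx, map_zero, norm_zero] at hxr
      exact hr.ne hxr
    have hScpt : IsCompact S := by
      rw [hSdef]
      exact isCompact_slice T π p r fun Q hQ => isClosed_facet (Finset.mem_filter.1 hQ).1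
    have Fscale : ∀ Q ∈ C.facets, p ∈ Q → (∃ y ∈ Q, L y ≠ L p) → ∀ x, p + x ∈ Q → π x ≠ 0 →
        (r / ‖T (π x)‖) • π x ∈ S := by
      intro Q hQ hpQ hQL x hx hπx
      have hpos : 0 < ‖T (π x)‖ := by simpa using hπx
      have hn : ‖T ((r / ‖T (π x)‖) • π x)‖ = r := by
        rw [map_smul, norm_smul, Real.norm_of_nonneg (by positivity)]
        field_simp
      exact (hSmem _).2 ⟨by rw [map_smul, hππ], hn, Q, hQ, ⟨hpQ, hQL⟩,
        F1 Q hQ hpQ x hx _ (by positivity) hn.le⟩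
    have hSne : S.Nonempty := by
      refine ⟨_, Fscale P₀ hP₀ hpP₀ ⟨y₀, hy₀, hne⟩ (y₀ - p) (by simpa using hy₀) fun h => hne ?_⟩
      have := hLπ (y₀ - p)
      rw [h, map_zero, map_sub] at this
      linarith
    -- If `L x = 0`, then `p + x` is again a maximum of `L` on the facets through it, and the
    -- induction hypothesis makes `L` constant on `Q`.
    have F4 : ∀ x ∈ S, L x < 0 := by
      intro x hx
      obtain ⟨-, hxr, Q, hQ, ⟨hpQ, y, hy, hyL⟩, hxQ⟩ := (hSmem x).1 hx
      have h1 := hL Q hQ hpQ _ hxQ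
      rw [map_add] at h1
      refine lt_of_le_of_ne (by linarith) fun h0 => hyL ?_
      have h2 : L (p + x) = L p := by rw [map_add, h0, add_zero]
      have h3 := ih (p := p + x) hQ hxQ (F2 Q hQ hpQ x hxQ hxr.le (hSV x hx)) (L := L) (by
        intro R hR hxR z hz
        rw [h2]
        exact hL R hR ((hG x hxr.le R hR).1 hxR) z hz) Q hQ hxQ y hy
      rw [h3, h2]
    obtain ⟨x₁, hx₁, hmax⟩ := hScpt.exists_isMaxOn hSne (f := L)
      (LinearMap.continuous_of_finiteDimensional L).continuousOn
    obtain ⟨hx₁π, hx₁r, Q, hQ, ⟨hpQ, -⟩, hxQ⟩ := (hSmem x₁).1 hx₁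
    have hμ := F4 x₁ hx₁
    set μ := -L x₁ with hμdef
    -- The tilt is chosen so that `L'` takes the same value at `p + x₁` as at `p`. By `F5` and
    -- Cauchy–Schwarz, `L'` still has its maximum there on the facets through `p + x₁`, so the
    -- induction hypothesis makes it constant on `Q`.
    obtain ⟨L', hL'⟩ : ∃ L' : (Fin n → ℝ) →ₗ[ℝ] ℝ,
        ∀ x, L' x = L x + μ / r ^ 2 * inner ℝ (T x₁) (T (π x)) :=
      ⟨L + (μ / r ^ 2) • (((innerSL ℝ (T x₁)).toLinearMap ∘ₗ T.toLinearEquiv.toLinearMap) ∘ₗ π),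
        fun x => rfl⟩
    have hL'x₁ : L' x₁ = 0 := by
      rw [hL', hx₁π, real_inner_self_eq_norm_sq, hx₁r]
      field_simp
      rw [hμdef]; ring
    have F5 : ∀ R ∈ C.facets, p + x₁ ∈ R → ∀ x, p + x ∈ R →
        L x ≤ -(μ / r) * ‖T (π x)‖ := by
      intro R hR hxR x hx
      have hpR := (hG x₁ hx₁r.le R hR).1 hxR
      by_cases h0 : π x = 0
      · have := hLπ x
        rw [h0, map_zero] at this
        rw [h0, ← this]; simp
      · have hs := Fscale R hR hpR ⟨p + x₁, hxR, by rw [map_add]; linarith⟩ x hx h0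
        have h1 : L _ ≤ L x₁ := hmax hs
        rw [map_smul, smul_eq_mul, hLπ] at h1
        have hpos : 0 < ‖T (π x)‖ := by simpa using h0
        have h2 : L x = (r / ‖T (π x)‖ * L x) * (‖T (π x)‖ / r) := by field_simp
        have h3 : -(μ / r) * ‖T (π x)‖ = L x₁ * (‖T (π x)‖ / r) := by rw [hμdef]; ring
        rw [h2, h3]
        exact mul_le_mul_of_nonneg_right h1 (by positivity)
    have hμ0 : 0 < μ := by rw [hμdef]; linarith
    have hCS : ∀ x, inner ℝ (T x₁) (T (π x)) ≤ r * ‖T (π x)‖ := fun x => by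
      have := real_inner_le_norm (T x₁) (T (π x))
      rwa [hx₁r] at this
    have hsplit : ∀ x, -(μ / r) * ‖T (π x)‖ = - (μ / r ^ 2 * (r * ‖T (π x)‖)) := fun x => by
      field_simp
    have hconst := ih (p := p + x₁) hQ hxQ (F2 Q hQ hpQ x₁ hxQ hx₁r.le (hSV x₁ hx₁)) (L := L') (by
      intro R hR hxR y hy
      have h1 := F5 R hR hxR (y - p) (by simpa using hy)
      have h2 := mul_le_mul_of_nonneg_left (hCS (y - p)) (by positivity : 0 ≤ μ / r ^ 2)
      have h3 := hL' (y - p)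
      rw [hsplit] at h1
      rw [map_sub] at h3
      rw [map_add, hL'x₁]
      linarith) Q hQ hxQ
    -- Constancy of `L'` means equality in Cauchy–Schwarz: modulo `V`, every direction of `Q` is a
    -- multiple of `x₁`. So `Q` has dimension at most one more than `V`, contrary to codimension at
    -- least two.
    have hspan : vectorSpan ℝ Q ≤ V ⊔ Submodule.span ℝ {x₁} := by
      rw [vectorSpan_eq_span_vsub_set_right ℝ hpQ, Submodule.span_le]
      rintro _ ⟨y, hy, rfl⟩
      simp only [vsub_eq_sub, SetLike.mem_coe]
      have h1 := F5 Q hQ hxQ (y - p) (by simpa using hy)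
      have h2 := hconst y hy
      have h3 := hL' (y - p)
      rw [map_sub] at h3
      rw [map_add, hL'x₁] at h2
      rw [hsplit] at h1
      have h4 : r * ‖T (π (y - p))‖ ≤ inner ℝ (T x₁) (T (π (y - p))) :=
        le_of_mul_le_mul_left (by linarith) (by positivity : 0 < μ / r ^ 2)
      have h5 := inner_eq_norm_mul_iff_real.1
        ((le_antisymm (hCS (y - p)) h4).trans (by rw [hx₁r]))
      rw [hx₁r, ← map_smul, ← map_smul] at h5
      have h6 := T.injective h5
      have h7 : π (y - p) ∈ Submodule.span ℝ {x₁} := by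
        rw [← Submodule.smul_mem_iff _ hr.ne', ← h6]
        exact Submodule.smul_mem _ _ (Submodule.mem_span_singleton_self _)
      rw [← sub_add_cancel (y - p) (π (y - p))]
      exact Submodule.add_mem_sup (hπV _) h7
    have h8 := Submodule.finrank_mono hspan
    rw [C.pure Q hQ] at h8
    have h9 := Submodule.finrank_add_le_finrank_add_finrank V (Submodule.span ℝ {x₁})
    have h10 := finrank_span_singleton (K := ℝ)
      (show x₁ ≠ 0 from fun h => hSV x₁ hx₁ (h ▸ V.zero_mem))
    omega

theorem linear_max {p : Fin n → ℝ} {L : (Fin n → ℝ) →ₗ[ℝ] ℝ}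
    (hL : ∀ Q ∈ C.facets, p ∈ Q → ∀ y ∈ Q, L y ≤ L p) {Q : Set (Fin n → ℝ)} (hQ : Q ∈ C.facets)
    (hp : p ∈ Q) {y : Fin n → ℝ} (hy : y ∈ Q) : L y = L p :=
  linear_max_aux d hQ hp (Nat.le_add_left _ _) hL Q hQ hp y hy

/-- A `ℤ`-affine function with a local maximum at `p` on the complex is constant on the facets
through `p`. -/
theorem zAffine_eq_of_local_max {p : Fin n → ℝ} {m : (Fin n → ℤ) × ℝ}
    (h : ∀ᶠ y in 𝓝 p, y ∈ C.finSupport → zAffine m y ≤ zAffine m p)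
    {Q : Set (Fin n → ℝ)} (hQ : Q ∈ C.facets) (hp : p ∈ Q) {y : Fin n → ℝ} (hy : y ∈ Q) :
    zAffine m y = zAffine m p := by
  rw [zAffine_eq, zAffine_eq, add_right_inj]
  refine linear_max (C := C) (fun R hR hpR z hz => ?_) hQ hp hy
  have hc : Filter.Tendsto (fun t : ℝ => p + t • (z - p)) (𝓝 0) (𝓝 p) := by
    have : Continuous (fun t : ℝ => p + t • (z - p)) := by fun_prop
    simpa using this.tendsto 0
  obtain ⟨t, ht, ht0, ht1⟩ := ((hc.eventually h).filter_mono nhdsWithin_le_nhds |>.and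
    (Ioo_mem_nhdsGT (zero_lt_one (α := ℝ)))).exists
  have h1 := ht (mem_finSupport.2 ⟨R, hR,
    (convex_facet hR).add_smul_sub_mem hpR hz ⟨ht0.le, ht1.le⟩⟩)
  rw [zAffine_add, map_smul, smul_eq_mul, map_sub] at h1
  have : t * (zLin m z - zLin m p) ≤ 0 := by linarith
  nlinarith

end BalancedComplex

end Trop

namespace Trop

open Module

/-! ### Generic points, polyhedral neighbourhoods in `𝕋^n`, and the maximum principle for Laurent
polynomials. -/

section Affine

variable {n : ℕ}

theorem eventually_zAffine_ne (m : (Fin n → ℤ) × ℝ) {y z : Fin n → ℝ}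
    (h : zAffine m y ≠ 0 ∨ zAffine m z ≠ 0) :
    ∀ᶠ τ : ℝ in 𝓝[>] 0, zAffine m (y + τ • (z - y)) ≠ 0 := by
  by_cases hy : zAffine m y = 0
  · filter_upwards [self_mem_nhdsWithin] with τ hτ
    rw [zAffine_lineMap, hy, mul_zero, zero_add]
    exact mul_ne_zero (ne_of_gt hτ) (h.resolve_left (not_not.2 hy))
  · have hc : Continuous (fun τ : ℝ => zAffine m (y + τ • (z - y))) :=
      (continuous_zAffine m).comp (by fun_prop)
    have := hc.continuousAt.eventually_ne (x := 0) (y := 0) (by simpa using hy)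
    exact this.filter_mono nhdsWithin_le_nhds

/-- A convex set contains a point at which none of finitely many `ℤ`-affine functions vanishes,
except those vanishing on the whole set. -/
theorem exists_generic {P : Set (Fin n → ℝ)} (hP : Convex ℝ P) (hne : P.Nonempty)
    (A : Finset ((Fin n → ℤ) × ℝ)) :
    ∃ y ∈ P, ∀ m ∈ A, (∃ z ∈ P, zAffine m z ≠ 0) → zAffine m y ≠ 0 := by
  classical
  induction A using Finset.induction_on with
  | empty => obtain ⟨y, hy⟩ := hne; exact ⟨y, hy, by simp⟩
  | insert a s _ ih =>
    obtain ⟨y, hy, hys⟩ := ih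
    by_cases ha : ∃ z ∈ P, zAffine a z ≠ 0
    · obtain ⟨z, hz, haz⟩ := ha
      have h1 : ∀ᶠ τ : ℝ in 𝓝[>] 0, ∀ m ∈ s, (∃ z ∈ P, zAffine m z ≠ 0) →
          zAffine m (y + τ • (z - y)) ≠ 0 := by
        rw [Filter.eventually_all_finset]
        intro m hm
        by_cases hmz : ∃ z ∈ P, zAffine m z ≠ 0
        · filter_upwards [eventually_zAffine_ne m (Or.inl (hys m hm hmz))] with τ hτ _ using hτ
        · exact Filter.Eventually.of_forall fun _ h => absurd h hmz
      obtain ⟨τ, ⟨h2, h3⟩, h4, h5⟩ := ((h1.and (eventually_zAffine_ne a (Or.inr haz))).and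
        (Ioo_mem_nhdsGT (zero_lt_one (α := ℝ)))).exists
      refine ⟨y + τ • (z - y), hP.add_smul_sub_mem hy hz ⟨h4.le, h5.le⟩, fun m hm hmz => ?_⟩
      rcases Finset.mem_insert.1 hm with rfl | hm
      · exact h3
      · exact h2 m hm hmz
    · refine ⟨y, hy, fun m hm hmz => ?_⟩
      rcases Finset.mem_insert.1 hm with rfl | hm
      · exact absurd hmz ha
      · exact hys m hm hmz

end Affine

section Box

/-- Closed rays and closed intervals with real endpoints are cut out by slopes ±1, so their traces
are rational polyhedra and can be added to the inequalities of a facet. -/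
theorem exists_interval_nhds (e : TNum) {N : Set TNum} (hN : N ∈ 𝓝 e) :
    ∃ B ∈ 𝓝 e, B ⊆ N ∧ ∃ K : Finset (ℤ × ℝ), ∀ r : ℝ,
      (⟨(r : EReal), EReal.coe_ne_top r⟩ : TNum) ∈ B ↔ ∀ k ∈ K, 0 ≤ k.2 + k.1 * r := by
  obtain ⟨e, he⟩ := e
  rw [nhds_subtype_eq_comap, Filter.mem_comap] at hN
  obtain ⟨M, hM, hMN⟩ := hN
  induction e with
  | top => exact absurd rfl he
  | bot =>
    obtain ⟨a, -, ha⟩ := EReal.nhds_bot_basis.mem_iff.1 hM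
    refine ⟨{x | (x : EReal) ≤ ((a - 1 : ℝ) : EReal)}, ?_, ?_, {(-1, a - 1)}, fun r => ?_⟩
    · rw [nhds_subtype_eq_comap]
      exact Filter.preimage_mem_comap (Iic_mem_nhds (EReal.bot_lt_coe _))
    · intro x hx
      have hlt : ((a - 1 : ℝ) : EReal) < (a : EReal) := by
        rw [EReal.coe_lt_coe_iff]; linarith
      exact hMN (ha (lt_of_le_of_lt hx hlt))
    · simp only [Set.mem_ofPred_eq, EReal.coe_le_coe_iff, Finset.mem_singleton, forall_eq]
      push_cast
      constructor <;> intro h <;> linarith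
  | coe a =>
    have h1 : (fun r : ℝ => (r : EReal)) ⁻¹' M ∈ 𝓝 a :=
      continuous_coe_real_ereal.continuousAt.preimage_mem_nhds hM
    obtain ⟨ε, hε, hb⟩ := Metric.nhds_basis_closedBall.mem_iff.1 h1
    rw [Real.closedBall_eq_Icc] at hb
    refine ⟨{x | (x : EReal) ∈ Icc (((a - ε : ℝ)) : EReal) ((a + ε : ℝ) : EReal)}, ?_, ?_,
      {(1, -(a - ε)), (-1, a + ε)}, fun r => ?_⟩
    · rw [nhds_subtype_eq_comap]
      refine Filter.preimage_mem_comap (Icc_mem_nhds ?_ ?_) <;>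
        · rw [EReal.coe_lt_coe_iff]; linarith
    · rintro ⟨x, hx'⟩ hx
      refine hMN ?_
      induction x with
      | top => exact absurd rfl hx'
      | bot => exact absurd hx.1 (not_le.2 (EReal.bot_lt_coe _))
      | coe x =>
        exact hb ⟨EReal.coe_le_coe_iff.1 hx.1, EReal.coe_le_coe_iff.1 hx.2⟩
    · simp only [Set.mem_ofPred_eq, mem_Icc, EReal.coe_le_coe_iff, Finset.mem_insert,
        Finset.mem_singleton, forall_eq_or_imp, forall_eq]
      push_cast
      constructor <;> rintro ⟨h1, h2⟩ <;> constructor <;> linarith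

variable {n : ℕ}

/-- Points of `𝕋^n` have a neighbourhood basis of sets whose finite parts are polyhedra. -/
theorem exists_box_nhds (t : Fin n → TNum) {N : Set (Fin n → TNum)} (hN : N ∈ 𝓝 t) :
    ∃ B ∈ 𝓝 t, B ⊆ N ∧ ∃ H : Finset ((Fin n → ℤ) × ℝ), ∀ y,
      finitePart y ∈ B ↔ y ∈ polyhedron H := by
  classical
  rw [nhds_pi, Filter.mem_pi'] at hN
  obtain ⟨I, M, hM, hMN⟩ := hN
  choose B hB hBM K hK using fun i => exists_interval_nhds (t i) (hM i)
  refine ⟨Set.pi univ B, set_pi_mem_nhds finite_univ fun i _ => hB i,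
    fun x hx => hMN fun i _ => hBM i (hx i trivial),
    Finset.univ.biUnion fun i => (K i).image fun k => (Pi.single i k.1, k.2), fun y => ?_⟩
  have hz : ∀ i (k : ℤ × ℝ), zAffine ((Pi.single i k.1 : Fin n → ℤ), k.2) y = k.2 + k.1 * y i := by
    intro i k
    simp only [zAffine]
    rw [Finset.sum_eq_single i]
    · simp
    · intro j _ hj; simp [Pi.single_eq_of_ne hj]
    · simp
  constructor
  · intro h m hm
    simp only [Finset.mem_biUnion, Finset.mem_univ, true_and, Finset.mem_image] at hm
    obtain ⟨i, k, hk, rfl⟩ := hm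
    rw [hz]
    exact (hK i (y i)).1 (h i trivial) k hk
  · intro h i _
    refine (hK i (y i)).2 fun k hk => ?_
    rw [← hz]
    exact h _ (Finset.mem_biUnion.2 ⟨i, Finset.mem_univ _, Finset.mem_image_of_mem _ hk⟩)

end Box

namespace BalancedComplex

variable {n d : ℕ} {C : BalancedComplex n d}

/-- The traces on the finite part of the complex of the neighbourhoods of `t ∈ 𝕋^n`. -/
noncomputable def finNhds (C : BalancedComplex n d) (t : Fin n → TNum) : Filter (Fin n → ℝ) :=
  Filter.comap finitePart (𝓝 t) ⊓ Filter.principal C.finSupport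

theorem eventually_finNhds {t : Fin n → TNum} {Q : (Fin n → ℝ) → Prop} :
    (∀ᶠ y in C.finNhds t, Q y) ↔
      ∀ᶠ t' in 𝓝 t, ∀ y, finitePart y = t' → y ∈ C.finSupport → Q y := by
  rw [finNhds, Filter.eventually_inf_principal, Filter.eventually_comap]

theorem finNhds_finitePart (q : Fin n → ℝ) : C.finNhds (finitePart q) = 𝓝[C.finSupport] q := by
  rw [finNhds, nhdsWithin, isEmbedding_finitePart.isInducing.nhds_eq_comap]

/-- The maximum principle for tropical Laurent polynomials on balanced complexes. -/
theorem laurent_max {t : Fin n → TNum} {g : (Fin n → ℝ) → ℝ} (hg : IsLaurent g) {c : ℝ}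
    (h1 : ∀ᶠ y in C.finNhds t, g y ≤ c)
    (h2 : ∀ ε : ℝ, 0 < ε → ∀ᶠ y in C.finNhds t, c - ε ≤ g y) :
    ∀ᶠ y in C.finNhds t, g y = c := by
  classical
  obtain ⟨S, hS, hgS⟩ := hg
  rw [eventually_finNhds] at h1 ⊢
  have h3 : ∀ᶠ t' in 𝓝 t, ∀ P ∈ C.facets, t' ∈ tClosure P → t ∈ tClosure P := by
    rw [Filter.eventually_all_finset]
    intro P _
    by_cases ht : t ∈ tClosure P
    · exact Filter.Eventually.of_forall fun _ _ => ht
    · have ho : (tClosure P)ᶜ ∈ 𝓝 t := isClosed_closure.isOpen_compl.mem_nhds ht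
      filter_upwards [ho] with t' ht' h using absurd h ht'
  obtain ⟨B, hB, hBN, H, hH⟩ := exists_box_nhds t (h1.eventually_nhds.and h3)
  filter_upwards [hB] with t' ht' y hy hyC
  subst hy
  obtain ⟨P, hP, hyP⟩ := mem_finSupport.1 hyC
  have htP : t ∈ tClosure P :=
    (hBN ht').2 P hP ((finitePart_mem_tClosure (isClosed_facet hP)).2 hyP)
  have hle : ∀ z ∈ C.finSupport, finitePart z ∈ B → g z ≤ c := fun z hz hzB =>
    (hBN hzB).1.self_of_nhds z rfl hz
  have hQ : ∀ z, z ∈ polyhedron (C.ineq P ∪ H) ↔ z ∈ P ∧ finitePart z ∈ B := by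
    intro z
    rw [hH, mem_facet hP]
    simp only [polyhedron, Set.mem_ofPred_eq, Finset.mem_union, or_imp, forall_and]
  -- Only finitely many monomials compete and `t` is a limit of points of `P`, so a single one comes
  -- arbitrarily close to `c` on the part of `P` in the box.
  obtain ⟨m, hm, hmε⟩ : ∃ m ∈ S, ∀ ε : ℝ, 0 < ε → ∃ z ∈ polyhedron (C.ineq P ∪ H),
      c - ε ≤ zAffine m z := by
    by_contra! hcon
    choose! ε hε hlt using hcon
    have hε0 : 0 < S.inf' hS ε := (Finset.lt_inf'_iff hS).2 hε
    have h4 := eventually_finNhds.1 (h2 _ hε0)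
    obtain ⟨_, ⟨hzB, hz4⟩, z, hzP, rfl⟩ := mem_closure_iff_nhds.1 htP _ (Filter.inter_mem hB h4)
    have h5 := hz4 z rfl (mem_finSupport.2 ⟨P, hP, hzP⟩)
    rw [hgS z] at h5
    obtain ⟨m, hm, hmz⟩ := Finset.exists_mem_eq_sup' hS (fun m => zAffine m z)
    rw [hmz] at h5
    have h6 := hlt m hm z ((hQ z).2 ⟨hzP, hzB⟩)
    have h7 := Finset.inf'_le ε hm
    linarith
  -- Elimination gives a finite point where this monomial reaches `c`, even if `t` is at infinity.
  -- From `m ≤ g ≤ c` the monomial has a local maximum at `q`, so it is constant on `P` and bounds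
  -- `g` below by `c`.
  obtain ⟨q, hq, hqc⟩ := exists_le_zAffine hmε
  rw [hQ] at hq
  have hmg : ∀ z, zAffine m z ≤ g z := fun z => by
    rw [hgS]; exact Finset.le_sup' (fun m => zAffine m z) hm
  have hqC : q ∈ C.finSupport := mem_finSupport.2 ⟨P, hP, hq.1⟩
  have hmq : zAffine m q = c := le_antisymm ((hmg q).trans (hle q hqC hq.2)) hqc
  have hloc : ∀ᶠ z in 𝓝 q, z ∈ C.finSupport → zAffine m z ≤ zAffine m q := by
    filter_upwards [isEmbedding_finitePart.continuous.continuousAt.eventually (hBN hq.2).1]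
      with z hz hzC
    rw [hmq]
    exact (hmg z).trans (hz z rfl hzC)
  have hmy := zAffine_eq_of_local_max hloc hP hq.1 hyP
  exact le_antisymm (hle y hyC ht') (by rw [← hmq, ← hmy]; exact hmg y)

/-- Near a point of the relative interior of a facet, the complex coincides with that facet. -/
theorem eventually_mem_facet {P : Set (Fin n → ℝ)} (hP : P ∈ C.facets) {z : Fin n → ℝ}
    (hz : z ∈ P) (hgen : ∀ m ∈ C.ineq P, (∃ y ∈ P, zAffine m y ≠ 0) → zAffine m z ≠ 0) :
    ∀ᶠ y in 𝓝 z, y ∈ C.finSupport → y ∈ P := by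
  filter_upwards [C.eventually_facet z] with y hy hyC
  obtain ⟨Q, hQ, hyQ⟩ := mem_finSupport.1 hyC
  have hzQ := (hy Q hQ).1 hyQ
  -- An inequality of `P` tight at `z` is tight on all of `P`, so `z` can be passed slightly on the
  -- way from `x`; reflection then puts `x` in the face `P ∩ Q`.
  have hPQ : P ⊆ Q := by
    intro x hx
    have hc : Filter.Tendsto (fun ε : ℝ => z + ε • (z - x)) (𝓝 0) (𝓝 z) := by
      have : Continuous (fun ε : ℝ => z + ε • (z - x)) := by fun_prop
      simpa using this.tendsto 0
    obtain ⟨ε, hε, hε0⟩ := ((hc.eventually (eventually_zAffine_pos (C.ineq P) z)).filter_mono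
      nhdsWithin_le_nhds |>.and (self_mem_nhdsWithin (s := Ioi (0 : ℝ)))).exists
    refine ((isFace_inter hP hQ ⟨z, hz, hzQ⟩).mem_of_reflect ⟨hz, hzQ⟩ hx hε0 ?_).2
    rw [mem_facet hP] at hz ⊢
    intro m hm
    by_cases h0 : ∃ y ∈ P, zAffine m y ≠ 0
    · exact (hε m hm (lt_of_le_of_ne (hz m hm) (hgen m hm h0).symm)).le
    · push Not at h0
      have h1 := h0 z ((mem_facet hP).2 hz)
      have h2 := h0 x hx
      simp only [zAffine_eq] at h1 h2
      simp only [zAffine_eq, map_add, map_smul, map_sub, smul_eq_mul]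
      have h3 : m.2 + (zLin m z + ε * (zLin m z - zLin m x)) = 0 := by
        linear_combination (1 + ε) * h1 - ε * h2
      rw [h3]
  have hface := isFace_inter hQ hP ⟨z, hzQ, hz⟩
  rw [inter_eq_right.2 hPQ] at hface
  -- A face of full dimension is the whole polyhedron: its equations vanish on the directions of
  -- `P`, which are those of `Q`.
  have hspan : vectorSpan ℝ P = vectorSpan ℝ Q :=
    Submodule.eq_of_le_of_finrank_eq (vectorSpan_mono ℝ hPQ) (by rw [C.pure P hP, C.pure Q hQ])
  obtain ⟨H, rfl, J, hJ, hPJ⟩ := hface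
  rw [hPJ]
  refine ⟨hyQ, fun m hm => ?_⟩
  have hker : vectorSpan ℝ P ≤ LinearMap.ker (zLin m) := by
    rw [vectorSpan_eq_span_vsub_set_right ℝ hz, Submodule.span_le]
    rintro _ ⟨x, hx, rfl⟩
    have h1 := (hPJ ▸ hx : x ∈ {y ∈ polyhedron H | ∀ m ∈ J, zAffine m y = 0}).2 m hm
    have h2 := (hPJ ▸ hz : z ∈ {y ∈ polyhedron H | ∀ m ∈ J, zAffine m y = 0}).2 m hm
    simp only [zAffine_eq] at h1 h2
    simp only [vsub_eq_sub, SetLike.mem_coe, LinearMap.mem_ker, map_sub]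
    linarith
  have h1 := eq_of_vectorSpan_le_ker (hspan ▸ hker) hyQ hzQ
  have h2 := (hPJ ▸ hz : z ∈ {y ∈ polyhedron H | ∀ m ∈ J, zAffine m y = 0}).2 m hm
  rw [zAffine_eq, h1, ← zAffine_eq, h2]

end BalancedComplex

end Trop

namespace Trop

open Module

/-! ### Cells on which finitely many Laurent polynomials are affine. -/

namespace BalancedComplex

variable {n d : ℕ} {C : BalancedComplex n d}

/-- Arbitrarily close to any point of the complex there is a convex relatively open piece of the
finite part on which none of finitely many given `ℤ`-affine functions changes its sign. -/
theorem exists_sign_cell {t : Fin n → TNum} (ht : t ∈ C.support)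
    (A : Finset ((Fin n → ℤ) × ℝ)) {U : Set (Fin n → ℝ)} (hU : U ∈ C.finNhds t) :
    ∃ Z : Set (Fin n → ℝ), Convex ℝ Z ∧ Z.Nonempty ∧ t ∈ closure (finitePart '' Z) ∧ Z ⊆ U ∧
      Z ⊆ C.finSupport ∧ (∀ z ∈ Z, Z ∈ 𝓝[C.finSupport] z) ∧
      ∀ m ∈ A, ∀ y ∈ Z, ∀ z ∈ Z, 0 < zAffine m y → 0 < zAffine m z := by
  classical
  simp only [support, mem_iUnion, exists_prop] at ht
  obtain ⟨P, hP, htP⟩ := ht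
  obtain ⟨B, hB, hBN, H, hH⟩ := exists_box_nhds t (eventually_finNhds.1 hU)
  set 𝒜 := C.ineq P ∪ H ∪ A with h𝒜
  obtain ⟨y₀, hy₀, hgen⟩ := exists_generic (convex_facet hP)
    (image_nonempty.1 (closure_nonempty_iff.1 ⟨t, htP⟩)) 𝒜
  let G : Set (Fin n → ℝ) := {y | y ∈ P ∧ y ∈ polyhedron H ∧
    ∀ m ∈ 𝒜, (∃ z ∈ P, zAffine m z ≠ 0) → zAffine m y ≠ 0}
  let Z : (𝒜 → Prop) → Set (Fin n → ℝ) := fun σ => {y ∈ G | ∀ m : 𝒜, 0 < zAffine m.1 y ↔ σ m}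
  -- Moving points of `P` near `t` slightly towards the generic point `y₀` makes them generic.
  have hGt : t ∈ closure (finitePart '' G) := by
    rw [mem_closure_iff]
    intro O hO htO
    obtain ⟨_, ⟨hyO, hyB⟩, y, hyP, rfl⟩ := mem_closure_iff.1 htP (O ∩ interior B)
      (hO.inter isOpen_interior) ⟨htO, mem_interior_iff_mem_nhds.2 hB⟩
    have hc : Continuous (fun τ : ℝ => finitePart (y + τ • (y₀ - y))) :=
      isEmbedding_finitePart.continuous.comp (by fun_prop)
    have h1 : ∀ᶠ τ : ℝ in 𝓝[>] 0, finitePart (y + τ • (y₀ - y)) ∈ O ∩ interior B := by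
      have h0 : O ∩ interior B ∈ 𝓝 (finitePart (y + (0 : ℝ) • (y₀ - y))) :=
        (hO.inter isOpen_interior).mem_nhds (by simpa using ⟨hyO, hyB⟩)
      exact (hc.continuousAt.eventually h0).filter_mono nhdsWithin_le_nhds
    have h2 : ∀ᶠ τ : ℝ in 𝓝[>] 0, ∀ m ∈ 𝒜, (∃ z ∈ P, zAffine m z ≠ 0) →
        zAffine m (y + τ • (y₀ - y)) ≠ 0 := by
      rw [Filter.eventually_all_finset]
      intro m hm
      by_cases hmz : ∃ z ∈ P, zAffine m z ≠ 0
      · filter_upwards [eventually_zAffine_ne m (Or.inr (hgen m hm hmz))] with τ hτ _ using hτ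
      · exact Filter.Eventually.of_forall fun _ h => absurd h hmz
    obtain ⟨τ, ⟨h3, h4⟩, h5, h6⟩ := ((h1.and h2).and
      (Ioo_mem_nhdsGT (zero_lt_one (α := ℝ)))).exists
    exact ⟨_, h3.1, _, ⟨(convex_facet hP).add_smul_sub_mem hyP hy₀ ⟨h5.le, h6.le⟩,
      (hH _).1 (interior_subset h3.2), h4⟩, rfl⟩
  -- There are finitely many sign patterns, so the points of one of them accumulate at `t`.
  obtain ⟨σ, hσ⟩ : ∃ σ, t ∈ closure (finitePart '' Z σ) := by
    have hGZ : G = ⋃ σ, Z σ := by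
      ext y
      simp only [Z, mem_iUnion, mem_sep_iff]
      exact ⟨fun h => ⟨fun m => 0 < zAffine m.1 y, h, fun m => Iff.rfl⟩, fun ⟨σ, h, _⟩ => h⟩
    rw [hGZ, image_iUnion, closure_iUnion_of_finite, mem_iUnion] at hGt
    exact hGt
  have hsign : ∀ y ∈ Z σ, ∀ z ∈ Z σ, ∀ m ∈ 𝒜, 0 < zAffine m y → 0 < zAffine m z :=
    fun y hy z hz m hm h => (hz.2 ⟨m, hm⟩).2 ((hy.2 ⟨m, hm⟩).1 h)
  have hZP : ∀ y ∈ Z σ, y ∈ P := fun y hy => hy.1.1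
  refine ⟨Z σ, ?_, image_nonempty.1 (closure_nonempty_iff.1 ⟨t, hσ⟩), hσ, ?_, ?_, ?_,
    fun m hm y hy z hz h => hsign y hy z hz m (by simp [h𝒜, hm]) h⟩
  · rw [convex_iff_segment_subset]
    intro y hy z hz
    rw [segment_eq_image']
    rintro _ ⟨τ, ⟨hτ0, hτ1⟩, rfl⟩
    have key : ∀ m ∈ 𝒜, (∃ z ∈ P, zAffine m z ≠ 0) → zAffine m (y + τ • (z - y)) ≠ 0 ∧
        (0 < zAffine m (y + τ • (z - y)) ↔ 0 < zAffine m y) := by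
      intro m hm hmz
      rw [zAffine_lineMap]
      have hy0 := hy.1.2.2 m hm hmz
      have hz0 := hz.1.2.2 m hm hmz
      rcases lt_or_gt_of_ne hy0 with h1 | h1
      · have h2 : zAffine m z < 0 := by
          by_contra! h
          exact h1.not_gt (hsign z hz y hy m hm (lt_of_le_of_ne h hz0.symm))
        have : (1 - τ) * zAffine m y + τ * zAffine m z < 0 := by
          rcases hτ0.eq_or_lt with rfl | h
          · simpa using h1
          · nlinarith
        exact ⟨this.ne, ⟨fun h => absurd h this.not_gt, fun h => absurd h h1.not_gt⟩⟩
      · have h2 := hsign y hy z hz m hm h1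
        have : 0 < (1 - τ) * zAffine m y + τ * zAffine m z := by
          rcases hτ0.eq_or_lt with rfl | h
          · simpa using h1
          · nlinarith
        exact ⟨this.ne', ⟨fun _ => h1, fun _ => this⟩⟩
    have hxP : y + τ • (z - y) ∈ P :=
      (convex_facet hP).add_smul_sub_mem (hZP y hy) (hZP z hz) ⟨hτ0, hτ1⟩
    refine ⟨⟨hxP, (convex_polyhedron H).add_smul_sub_mem hy.1.2.1 hz.1.2.1 ⟨hτ0, hτ1⟩,
      fun m hm hmz => (key m hm hmz).1⟩, fun m => ?_⟩
    rw [← hy.2 m]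
    by_cases hmz : ∃ z ∈ P, zAffine m.1 z ≠ 0
    · exact (key m m.2 hmz).2
    · push Not at hmz
      rw [hmz _ hxP, hmz _ (hZP y hy)]
  · intro y hy
    exact hBN ((hH y).2 hy.1.2.1) y rfl (mem_finSupport.2 ⟨P, hP, hZP y hy⟩)
  · exact fun y hy => mem_finSupport.2 ⟨P, hP, hZP y hy⟩
  · intro z hz
    have h1 := eventually_mem_facet hP (hZP z hz) fun m hm h =>
      hz.1.2.2 m (by simp [h𝒜, hm]) h
    have h2 : ∀ᶠ y in 𝓝 z, ∀ m ∈ 𝒜, zAffine m z ≠ 0 →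
        zAffine m y ≠ 0 ∧ (0 < zAffine m y ↔ 0 < zAffine m z) := by
      rw [Filter.eventually_all_finset]
      intro m _
      have hcont := (continuous_zAffine m).continuousAt (x := z)
      rcases lt_trichotomy (zAffine m z) 0 with h | h | h
      · filter_upwards [hcont.eventually_lt_const h] with y hy _
        exact ⟨hy.ne, ⟨fun h' => absurd h' hy.not_gt, fun h' => absurd h' h.not_gt⟩⟩
      · exact Filter.Eventually.of_forall fun _ h' => absurd h h'
      · filter_upwards [hcont.eventually_const_lt h] with y hy _
        exact ⟨hy.ne', ⟨fun _ => h, fun _ => hy⟩⟩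
    rw [mem_nhdsWithin_iff_eventually]
    filter_upwards [h1, h2] with y hy1 hy2 hyC
    have hyP := hy1 hyC
    refine ⟨⟨hyP, fun m hm => ?_, fun m hm hmz => (hy2 m hm (hz.1.2.2 m hm hmz)).1⟩, fun m => ?_⟩
    · by_cases hmz : ∃ z ∈ P, zAffine m z ≠ 0
      · have hm' : m ∈ 𝒜 := by simp [h𝒜, hm]
        have h0 := hz.1.2.2 m hm' hmz
        exact ((hy2 m hm' h0).2.2 (lt_of_le_of_ne (hz.1.2.1 m hm) h0.symm)).le
      · push Not at hmz
        exact (hmz y hyP).ge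
    · rw [← hz.2 m]
      by_cases hmz : ∃ z ∈ P, zAffine m.1 z ≠ 0
      · exact (hy2 m m.2 (hz.1.2.2 m m.2 hmz)).2
      · push Not at hmz
        rw [hmz y hyP, hmz z (hZP z hz)]

/-- Arbitrarily close to any point of the complex there is a convex relatively open piece of the
finite part on which finitely many tropical Laurent polynomials are `ℤ`-affine. -/
theorem exists_cell {t : Fin n → TNum} (ht : t ∈ C.support) {ι : Type*} [Finite ι]
    {g : ι → (Fin n → ℝ) → ℝ} (hg : ∀ i, IsLaurent (g i)) {U : Set (Fin n → ℝ)}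
    (hU : U ∈ C.finNhds t) :
    ∃ Z : Set (Fin n → ℝ), Convex ℝ Z ∧ Z.Nonempty ∧ t ∈ closure (finitePart '' Z) ∧ Z ⊆ U ∧
      Z ⊆ C.finSupport ∧ (∀ z ∈ Z, Z ∈ 𝓝[C.finSupport] z) ∧
      ∀ i, ∃ m, ∀ z ∈ Z, g i z = zAffine m z := by
  classical
  have := Fintype.ofFinite ι
  choose S hS hgS using hg
  -- The sign conditions are imposed on the differences of monomials, so that a monomial maximal at
  -- one point of the cell is maximal on all of it.
  obtain ⟨Z, h1, ⟨z₀, hz₀⟩, h3, h4, h5, h6, h7⟩ := exists_sign_cell ht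
    (Finset.univ.biUnion fun i => (S i ×ˢ S i).image
      fun p => (p.1.1 - p.2.1, p.1.2 - p.2.2)) hU
  refine ⟨Z, h1, ⟨z₀, hz₀⟩, h3, h4, h5, h6, fun i => ?_⟩
  obtain ⟨m, hm, hmz⟩ := Finset.exists_mem_eq_sup' (hS i) (fun m => zAffine m z₀)
  refine ⟨m, fun z hz => ?_⟩
  rw [hgS]
  refine le_antisymm (Finset.sup'_le _ _ fun m' hm' => ?_)
    (Finset.le_sup' (fun m => zAffine m z) hm)
  by_contra! hlt
  have := h7 (m'.1 - m.1, m'.2 - m.2) (Finset.mem_biUnion.2 ⟨i, Finset.mem_univ _,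
    Finset.mem_image.2 ⟨(m', m), Finset.mem_product.2 ⟨hm', hm⟩, rfl⟩⟩) z hz z₀ hz₀
    (by rw [zAffine_sub]; linarith)
  rw [zAffine_sub, sub_pos] at this
  have h8 := Finset.le_sup' (fun m => zAffine m z₀) hm'
  rw [hmz] at h8
  exact this.not_ge h8

end BalancedComplex

end Trop

namespace Trop

/-! ### Laurent polynomials in charts, inner points, regular functions. -/

section Laurent

variable {n : ℕ}

theorem isLaurent_iff {g : (Fin n → ℝ) → ℝ} : IsLaurent g ↔ ∃ S : Finset ((Fin n → ℤ) × ℝ),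
    ∀ y, (∀ m ∈ S, zAffine m y ≤ g y) ∧ ∃ m ∈ S, g y = zAffine m y := by
  constructor
  · rintro ⟨S, hS, hg⟩
    refine ⟨S, fun y => ⟨fun m hm => ?_, ?_⟩⟩
    · rw [hg]; exact Finset.le_sup' (fun m => zAffine m y) hm
    · obtain ⟨m, hm, h⟩ := Finset.exists_mem_eq_sup' hS (fun m => zAffine m y)
      exact ⟨m, hm, by rw [hg, h]⟩
  · rintro ⟨S, h⟩
    have hS : S.Nonempty := by obtain ⟨m, hm, -⟩ := (h 0).2; exact ⟨m, hm⟩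
    refine ⟨S, hS, fun y => le_antisymm ?_ (Finset.sup'_le _ _ (h y).1)⟩
    obtain ⟨m, hm, h'⟩ := (h y).2
    rw [h']
    exact Finset.le_sup' (fun m => zAffine m y) hm

theorem isLaurent_zAffine (m : (Fin n → ℤ) × ℝ) : IsLaurent (zAffine m) :=
  isLaurent_iff.2 ⟨{m}, fun y => by simp⟩

theorem isLaurent_const (c : ℝ) : IsLaurent (fun _ : Fin n → ℝ => c) := by
  convert isLaurent_zAffine ((0, c) : (Fin n → ℤ) × ℝ) using 1
  ext y; simp [zAffine]

theorem IsLaurent.add {g h : (Fin n → ℝ) → ℝ} (hg : IsLaurent g) (hh : IsLaurent h) :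
    IsLaurent (fun y => g y + h y) := by
  classical
  rw [isLaurent_iff] at *
  obtain ⟨S, hS⟩ := hg
  obtain ⟨T, hT⟩ := hh
  have hz : ∀ (m m' : (Fin n → ℤ) × ℝ) y, zAffine (m + m') y = zAffine m y + zAffine m' y := by
    intro m m' y
    simp only [zAffine, Prod.fst_add, Prod.snd_add, Pi.add_apply, Int.cast_add, add_mul,
      Finset.sum_add_distrib]
    ring
  refine ⟨(S ×ˢ T).image fun p => p.1 + p.2, fun y => ⟨?_, ?_⟩⟩
  · intro _ hq
    obtain ⟨⟨m, m'⟩, hp, rfl⟩ := Finset.mem_image.1 hq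
    obtain ⟨hm, hm'⟩ := Finset.mem_product.1 hp
    rw [hz]
    exact add_le_add ((hS y).1 m hm) ((hT y).1 m' hm')
  · obtain ⟨m, hm, h1⟩ := (hS y).2
    obtain ⟨m', hm', h2⟩ := (hT y).2
    exact ⟨m + m', Finset.mem_image.2 ⟨(m, m'), Finset.mem_product.2 ⟨hm, hm'⟩, rfl⟩, by
      rw [hz, h1, h2]⟩

theorem IsLaurent.max {g h : (Fin n → ℝ) → ℝ} (hg : IsLaurent g) (hh : IsLaurent h) :
    IsLaurent (fun y => max (g y) (h y)) := by
  classical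
  rw [isLaurent_iff] at *
  obtain ⟨S, hS⟩ := hg
  obtain ⟨T, hT⟩ := hh
  refine ⟨S ∪ T, fun y => ⟨fun m hm => ?_, ?_⟩⟩
  · rcases Finset.mem_union.1 hm with hm | hm
    · exact ((hS y).1 m hm).trans (le_max_left _ _)
    · exact ((hT y).1 m hm).trans (le_max_right _ _)
  · rcases max_choice (g y) (h y) with h' | h' <;> rw [h']
    · obtain ⟨m, hm, h1⟩ := (hS y).2
      exact ⟨m, Finset.mem_union_left _ hm, h1⟩
    · obtain ⟨m, hm, h1⟩ := (hT y).2
      exact ⟨m, Finset.mem_union_right _ hm, h1⟩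

theorem IsLaurent.comp {k : ℕ} {g : (Fin k → ℝ) → ℝ} (hg : IsLaurent g)
    (A : Matrix (Fin k) (Fin n) ℤ) (b : Fin k → ℝ) :
    IsLaurent (fun y => g (fun i => zAffine (A i, b i) y)) := by
  classical
  rw [isLaurent_iff] at *
  obtain ⟨S, hS⟩ := hg
  let T : (Fin k → ℤ) × ℝ → (Fin n → ℤ) × ℝ := fun m =>
    (fun j => ∑ i, m.1 i * A i j, m.2 + ∑ i, (m.1 i : ℝ) * b i)
  have hT : ∀ m y, zAffine (T m) y = zAffine m (fun i => zAffine (A i, b i) y) := by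
    intro m y
    simp only [T, zAffine, mul_add, Finset.sum_add_distrib, Int.cast_sum, Int.cast_mul,
      Finset.sum_mul, Finset.mul_sum, add_assoc]
    congr 2
    rw [Finset.sum_comm]
    exact Finset.sum_congr rfl fun i _ => Finset.sum_congr rfl fun j _ => by ring
  refine ⟨S.image T, fun y => ⟨?_, ?_⟩⟩
  · simp only [Finset.mem_image]
    rintro _ ⟨m, hm, rfl⟩
    rw [hT]
    exact (hS _).1 m hm
  · obtain ⟨m, hm, h⟩ := (hS (fun i => zAffine (A i, b i) y)).2
    exact ⟨T m, Finset.mem_image_of_mem _ hm, by rw [hT, h]⟩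

end Laurent

theorem BalancedComplex.finNhds_neBot {n d : ℕ} {C : BalancedComplex n d} {t : Fin n → TNum}
    (ht : t ∈ C.support) : (C.finNhds t).NeBot := by
  simp only [support, mem_iUnion, exists_prop] at ht
  obtain ⟨P, hP, htP⟩ := ht
  rw [Filter.neBot_iff, ne_eq, ← Filter.eventually_false_iff_eq_bot, eventually_finNhds]
  intro h
  obtain ⟨_, hf, y, hy, rfl⟩ := mem_closure_iff_nhds.1 htP _ h
  exact hf y rfl (mem_finSupport.2 ⟨P, hP, hy⟩)

section Charts

variable {X : Type*} [TopologicalSpace X]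

theorem Chart.IsCoord.unique {φ : Chart X} {x : X} {y y' : Fin φ.n → ℝ} (h : φ.IsCoord x y)
    (h' : φ.IsCoord x y') : y = y' :=
  finitePart_injective (h.2.symm.trans h'.2)

/-- The dictionary by which results on complexes reach `X`: a property of the finite coordinates
near `p` is a property along the filter `finNhds`. -/
theorem Chart.eventually_coord {φ : Chart X} {p : X} (hp : p ∈ φ.hom.source)
    {Q : (Fin φ.n → ℝ) → Prop} :
    (∀ᶠ x in 𝓝 p, ∀ y, φ.IsCoord x y → Q y) ↔
      ∀ᶠ y in φ.cx.finNhds (φ.hom p : Fin φ.n → TNum), Q y := by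
  rw [BalancedComplex.eventually_finNhds]
  have h1 : (∀ᶠ t' in 𝓝 (φ.hom p : Fin φ.n → TNum),
      ∀ y, finitePart y = t' → y ∈ φ.cx.finSupport → Q y) ↔
      ∀ᶠ s : φ.cx.support in 𝓝 (φ.hom p), ∀ y, (s : Fin φ.n → TNum) = finitePart y → Q y := by
    rw [nhds_subtype_eq_comap, Filter.eventually_comap]
    refine Filter.eventually_congr (Filter.Eventually.of_forall fun t' => ⟨?_, ?_⟩)
    · rintro h ⟨s, hs⟩ rfl y hy
      exact h y hy.symm (BalancedComplex.finitePart_mem_support.1 (hy ▸ hs))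
    · rintro h y rfl hy
      exact h ⟨finitePart y, BalancedComplex.finitePart_mem_support.2 hy⟩ rfl y rfl
  rw [h1, φ.hom.eventually_nhds _ hp]
  constructor
  · intro h
    filter_upwards [h, φ.hom.open_source.mem_nhds hp] with x hx hxs y hy
    exact hx y ⟨hxs, hy⟩
  · intro h
    filter_upwards [h] with x hx y hy using hx y hy.2

variable [TropicalVariety X]

theorem exists_chart (x : X) : ∃ φ ∈ TropicalVariety.atlas (X := X), x ∈ φ.hom.source :=
  TropicalVariety.cover x

/-- Transition maps send finite points to finite points, so sedentarity zero does not depend on the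
chart. -/
theorem IsInner.exists_coord {x : X} (hx : IsInner x) {φ : Chart X}
    (hφ : φ ∈ TropicalVariety.atlas (X := X)) (hs : x ∈ φ.hom.source) : ∃ y, φ.IsCoord x y := by
  obtain ⟨ψ, hψ, y, hy⟩ := hx
  obtain ⟨A, b, h⟩ := TropicalVariety.transition ψ hψ φ hφ
  exact ⟨_, h x y hy hs⟩

theorem Chart.IsCoord.isInner {φ : Chart X} (hφ : φ ∈ TropicalVariety.atlas (X := X)) {x : X}
    {y : Fin φ.n → ℝ} (h : φ.IsCoord x y) : IsInner x := ⟨φ, hφ, y, h⟩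

/-- The polyhedra in `𝕋^n` are closures of their finite parts. This density is why conditions at
inner points determine continuous functions. -/
theorem frequently_isInner (p : X) : ∃ᶠ x in 𝓝 p, IsInner x := by
  obtain ⟨φ, hφ, hp⟩ := exists_chart p
  intro h
  have h1 : ∀ᶠ x in 𝓝 p, ∀ y, φ.IsCoord x y → False := by
    filter_upwards [h] with x hx y hy using hx (hy.isInner hφ)
  rw [Chart.eventually_coord hp, Filter.eventually_false_iff_eq_bot] at h1
  exact (BalancedComplex.finNhds_neBot (φ.hom p).2).ne h1

theorem mem_closure_isInner (p : X) : p ∈ closure {x : X | IsInner x} :=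
  mem_closure_iff_frequently.2 (frequently_isInner p)

theorem eq_of_eventually_inner {Y : Type*} [TopologicalSpace Y] [T2Space Y] {f g : X → Y} {p : X}
    (hf : ContinuousAt f p) (hg : ContinuousAt g p)
    (h : ∀ᶠ x in 𝓝 p, IsInner x → f x = g x) : f p = g p := by
  have : (𝓝[{x : X | IsInner x}] p).NeBot := mem_closure_iff_nhdsWithin_neBot.1
    (mem_closure_isInner p)
  refine tendsto_nhds_unique_of_eventuallyEq (l := 𝓝[{x : X | IsInner x}] p)
    (hf.tendsto.mono_left nhdsWithin_le_nhds) (hg.tendsto.mono_left nhdsWithin_le_nhds) ?_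
  rw [Filter.EventuallyEq, eventually_nhdsWithin_iff]
  exact h

/-- Continuous functions on an open set that agree at its inner points are equal. -/
theorem eqOn_of_inner {Y : Type*} [TopologicalSpace Y] [T2Space Y] {f g : X → Y} {U : Set X}
    (hU : IsOpen U) (hf : ContinuousOn f U) (hg : ContinuousOn g U)
    (h : ∀ x ∈ U, IsInner x → f x = g x) : EqOn f g U := fun p hp => by
  have hUp := hU.mem_nhds hp
  exact eq_of_eventually_inner (hf.continuousAt hUp) (hg.continuousAt hUp)
    (Filter.eventually_of_mem hUp h)

/-- Near `p` the function `f` is, in the chart `φ`, a tropical Laurent polynomial. -/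
def LaurentIn (φ : Chart X) (p : X) (f : X → EReal) : Prop :=
  ∃ g, IsLaurent g ∧ ∀ᶠ x in 𝓝 p, ∀ y, φ.IsCoord x y → f x = (g y : EReal)

theorem exists_transition {φ ψ : Chart X} (hφ : φ ∈ TropicalVariety.atlas (X := X))
    (hψ : ψ ∈ TropicalVariety.atlas (X := X)) {p : X} (hp : p ∈ φ.hom.source) :
    ∃ (A : Matrix (Fin φ.n) (Fin ψ.n) ℤ) (b : Fin φ.n → ℝ), ∀ᶠ x in 𝓝 p,
      ∀ y, ψ.IsCoord x y → φ.IsCoord x (fun i => zAffine (A i, b i) y) := by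
  obtain ⟨A, b, h⟩ := TropicalVariety.transition ψ hψ φ hφ
  refine ⟨A, b, ?_⟩
  filter_upwards [φ.hom.open_source.mem_nhds hp] with x hx y hy using h x y hy hx

theorem LaurentIn.change {φ ψ : Chart X} (hφ : φ ∈ TropicalVariety.atlas (X := X))
    (hψ : ψ ∈ TropicalVariety.atlas (X := X)) {p : X} (hp : p ∈ φ.hom.source) {f : X → EReal}
    (h : LaurentIn φ p f) : LaurentIn ψ p f := by
  obtain ⟨g, hg, hf⟩ := h
  obtain ⟨A, b, hAb⟩ := exists_transition hφ hψ hp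
  refine ⟨_, hg.comp A b, ?_⟩
  filter_upwards [hf, hAb] with x hx hxA y hy using hx _ (hxA y hy)

/-- Removes the choice of a chart: by the transition maps, a Laurent polynomial in one chart is one
in every chart around the point. -/
theorem isRegular_iff {U : Set X} {f : X → EReal} : IsRegular U f ↔
    ContinuousOn f U ∧ (∀ x ∈ U, f x ≠ ⊤) ∧ ∀ p ∈ U, (∀ᶠ x in 𝓝 p, IsInner x → f x = ⊥) ∨
      ∀ φ ∈ TropicalVariety.atlas (X := X), p ∈ φ.hom.source → LaurentIn φ p f := by
  refine and_congr_right fun _ => and_congr_right fun _ => forall₂_congr fun p _ => ⟨?_, ?_⟩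
  · rintro ⟨φ, hφ, hpφ, W, hW, hpW, h | ⟨g, hg, h⟩⟩
    · left
      filter_upwards [hW.mem_nhds hpW, φ.hom.open_source.mem_nhds hpφ] with x hx hxs hi
      obtain ⟨y, hy⟩ := hi.exists_coord hφ hxs
      exact h x hx y hy
    · right
      intro ψ hψ _
      exact LaurentIn.change hφ hψ hpφ ⟨g, hg, Filter.eventually_of_mem (hW.mem_nhds hpW) h⟩
  · intro h
    obtain ⟨φ, hφ, hpφ⟩ := exists_chart p
    refine ⟨φ, hφ, hpφ, ?_⟩
    rcases h with h | h
    · obtain ⟨W, hW, hWo, hpW⟩ := eventually_nhds_iff.1 h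
      exact ⟨W, hWo, hpW, Or.inl fun x hx y hy => hW x hx (hy.isInner hφ)⟩
    · obtain ⟨g, hg, h⟩ := h φ hφ hpφ
      obtain ⟨W, hW, hWo, hpW⟩ := eventually_nhds_iff.1 h
      exact ⟨W, hWo, hpW, Or.inr ⟨g, hg, hW⟩⟩

end Charts

section Regular

variable {X : Type*} [TopologicalSpace X] [TropicalVariety X] {U V : Set X} {f g u v : X → EReal}

theorem IsRegular.mono (h : IsRegular U f) (hVU : V ⊆ U) : IsRegular V f :=
  ⟨h.1.mono hVU, fun x hx => h.2.1 x (hVU hx), fun p hp => h.2.2 p (hVU hp)⟩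

theorem IsRegular.congr (hU : IsOpen U) (h : IsRegular U f) (hfg : EqOn f g U) :
    IsRegular U g := by
  rw [isRegular_iff] at *
  refine ⟨h.1.congr fun x hx => (hfg hx).symm, fun x hx => hfg hx ▸ h.2.1 x hx, fun p hp => ?_⟩
  refine (h.2.2 p hp).imp (fun h => ?_) fun h φ hφ hpφ => ?_
  · filter_upwards [h, hU.mem_nhds hp] with x hx hxU hi using hfg hxU ▸ hx hi
  · obtain ⟨l, hl, h⟩ := h φ hφ hpφ
    refine ⟨l, hl, ?_⟩
    filter_upwards [h, hU.mem_nhds hp] with x hx hxU y hy using hfg hxU ▸ hx y hy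

theorem isRegular_of_locally (h : ∀ p ∈ U, ∃ V, IsOpen V ∧ p ∈ V ∧ IsRegular V f) :
    IsRegular U f := by
  refine ⟨fun p hp => ?_, fun p hp => ?_, fun p hp => ?_⟩ <;> obtain ⟨V, hV, hpV, hr⟩ := h p hp
  · exact (hr.1.continuousAt (hV.mem_nhds hpV)).continuousWithinAt
  · exact hr.2.1 p hpV
  · exact hr.2.2 p hpV

theorem isRegular_bot : IsRegular U (fun _ => ⊥ : X → EReal) :=
  isRegular_iff.2 ⟨continuousOn_const, fun _ _ => bot_ne_top,
    fun _ _ => Or.inl (Filter.Eventually.of_forall fun _ _ => rfl)⟩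

theorem isRegular_const (c : ℝ) : IsRegular U (fun _ => (c : EReal) : X → EReal) :=
  isRegular_iff.2 ⟨continuousOn_const, fun _ _ => EReal.coe_ne_top c,
    fun _ _ => Or.inr fun _ _ _ => ⟨_, isLaurent_const c,
      Filter.Eventually.of_forall fun _ _ _ => rfl⟩⟩

theorem IsRegular.max (hf : IsRegular U f) (hg : IsRegular U g) :
    IsRegular U (fun x => max (f x) (g x)) := by
  rw [isRegular_iff] at *
  refine ⟨hf.1.sup hg.1, fun x hx => ?_, fun p hp => ?_⟩
  · rcases max_choice (f x) (g x) with h | h <;> rw [h]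
    exacts [hf.2.1 x hx, hg.2.1 x hx]
  · rcases hf.2.2 p hp with h1 | h1 <;> rcases hg.2.2 p hp with h2 | h2
    · left
      filter_upwards [h1, h2] with x hx hx' hi
      rw [hx hi, hx' hi, max_self]
    · right
      intro φ hφ hpφ
      obtain ⟨l, hl, h2⟩ := h2 φ hφ hpφ
      refine ⟨l, hl, ?_⟩
      filter_upwards [h1, h2] with x hx hx' y hy
      rw [hx (hy.isInner hφ), hx' y hy, max_eq_right bot_le]
    · right
      intro φ hφ hpφ
      obtain ⟨l, hl, h1⟩ := h1 φ hφ hpφ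
      refine ⟨l, hl, ?_⟩
      filter_upwards [h1, h2] with x hx hx' y hy
      rw [hx' (hy.isInner hφ), hx y hy, max_eq_left bot_le]
    · right
      intro φ hφ hpφ
      obtain ⟨l, hl, h1⟩ := h1 φ hφ hpφ
      obtain ⟨l', hl', h2⟩ := h2 φ hφ hpφ
      refine ⟨_, hl.max hl', ?_⟩
      filter_upwards [h1, h2] with x hx hx' y hy
      rw [hx y hy, hx' y hy, EReal.coe_strictMono.monotone.map_max]

theorem IsInvertible.ne_bot (h : IsInvertible U u) {x : X} (hx : x ∈ U) : u x ≠ ⊥ := fun h' =>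
  h.2.2.1 x hx (by simp [h'])

theorem IsInvertible.ne_top (h : IsInvertible U u) {x : X} (hx : x ∈ U) : u x ≠ ⊤ := h.1.2.1 x hx

theorem IsInvertible.mono (h : IsInvertible U u) (hVU : V ⊆ U) : IsInvertible V u :=
  ⟨h.1.mono hVU, h.2.mono hVU⟩

theorem IsInvertible.neg (h : IsInvertible U u) : IsInvertible U (fun x => -u x) :=
  ⟨h.2, by simpa only [neg_neg] using h.1⟩

theorem IsInvertible.congr (hU : IsOpen U) (h : IsInvertible U u) (huv : EqOn u v U) :
    IsInvertible U v :=
  ⟨h.1.congr hU huv, h.2.congr hU fun _ hx => congrArg (fun a => -a) (huv hx)⟩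

theorem isInvertible_const (c : ℝ) : IsInvertible U (fun _ => (c : EReal) : X → EReal) :=
  ⟨isRegular_const c, by simpa only [EReal.coe_neg] using isRegular_const (U := U) (-c)⟩

theorem IsRegular.add_invertible (hU : IsOpen U) (hf : IsRegular U f) (hu : IsInvertible U u) :
    IsRegular U (fun x => f x + u x) := by
  have h1 := isRegular_iff.1 hf
  have h2 := isRegular_iff.1 hu.1
  refine isRegular_iff.2 ⟨fun p hp => ?_, fun x hx => ?_, fun p hp => ?_⟩
  · have hc := (hf.1.continuousAt (hU.mem_nhds hp)).prodMk
      (hu.1.1.continuousAt (hU.mem_nhds hp))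
    exact (ContinuousAt.comp (x := p) (f := fun x => (f x, u x)) (EReal.continuousAt_add
      (p := (f p, u p)) (Or.inr (hu.ne_bot hp)) (Or.inr (hu.ne_top hp))) hc).continuousWithinAt
  · exact EReal.add_ne_top (hf.2.1 x hx) (hu.ne_top hx)
  · refine (h1.2.2 p hp).imp (fun h => ?_) fun h φ hφ hpφ => ?_
    · filter_upwards [h] with x hx hi
      rw [hx hi, EReal.bot_add]
    · obtain ⟨l, hl, h⟩ := h φ hφ hpφ
      rcases h2.2.2 p hp with h' | h'
      · exfalso
        obtain ⟨x, hx, hxb, hxU⟩ := ((frequently_isInner p).and_eventually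
          (h'.and (hU.mem_nhds hp))).exists
        exact hu.ne_bot hxU (hxb hx)
      · obtain ⟨l', hl', h'⟩ := h' φ hφ hpφ
        refine ⟨_, hl.add hl', ?_⟩
        filter_upwards [h, h'] with x hx hx' y hy
        rw [hx y hy, hx' y hy, EReal.coe_add]

theorem IsInvertible.add (hU : IsOpen U) (hu : IsInvertible U u) (hv : IsInvertible U v) :
    IsInvertible U (fun x => u x + v x) := by
  refine ⟨hu.1.add_invertible hU hv, (hu.2.add_invertible hU hv.neg).congr hU fun x hx => ?_⟩
  simp only
  rw [EReal.neg_add (Or.inl (hu.ne_bot hx)) (Or.inl (hu.ne_top hx)), sub_eq_add_neg]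

/-- Near a point where it is finite a regular function is a tropical Laurent polynomial. -/
theorem IsRegular.laurentIn (hU : IsOpen U) (hf : IsRegular U f) {p : X} (hp : p ∈ U)
    (hne : f p ≠ ⊥) {φ : Chart X} (hφ : φ ∈ TropicalVariety.atlas (X := X))
    (hpφ : p ∈ φ.hom.source) : LaurentIn φ p f := by
  rcases (isRegular_iff.1 hf).2.2 p hp with h | h
  · exact absurd (eq_of_eventually_inner (hf.1.continuousAt (hU.mem_nhds hp))
      (continuousAt_const (y := (⊥ : EReal))) h) hne
  · exact h φ hφ hpφ

/-- The maximum principle: a regular function bounded by an invertible one agrees with it near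
every point where the bound is attained. -/
theorem IsRegular.eventually_eq_of_le (hU : IsOpen U) (hf : IsRegular U f) (hu : IsInvertible U u)
    (hle : ∀ x ∈ U, f x ≤ u x) {p : X} (hp : p ∈ U) (heq : f p = u p) :
    ∀ᶠ x in 𝓝 p, f x = u x := by
  obtain ⟨φ, hφ, hpφ⟩ := exists_chart p
  obtain ⟨g, hg, hfg⟩ := hf.laurentIn hU hp (heq ▸ hu.ne_bot hp) hφ hpφ
  obtain ⟨g', hg', hug⟩ := hu.2.laurentIn hU hp (hu.neg.ne_bot hp) hφ hpφ
  have hug' : ∀ᶠ x in 𝓝 p, ∀ y, φ.IsCoord x y → u x = ((-g' y : ℝ) : EReal) := by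
    filter_upwards [hug] with x hx y hy
    rw [EReal.coe_neg, ← hx y hy, neg_neg]
  have hUp := hU.mem_nhds hp
  obtain ⟨r, hr⟩ : ∃ r : ℝ, u p = r :=
    ⟨(u p).toReal, (EReal.coe_toReal (hu.ne_top hp) (hu.ne_bot hp)).symm⟩
  -- `g + g'` represents `f - u`, which is at most 0 and, by continuity, arbitrarily close to 0 near
  -- `p`. The point `p` itself may be at infinity.
  have key : ∀ᶠ y in φ.cx.finNhds (φ.hom p : Fin φ.n → TNum), g y + g' y = 0 := by
    refine BalancedComplex.laurent_max (hg.add hg') ?_ fun ε hε => ?_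
    · rw [← Chart.eventually_coord hpφ]
      filter_upwards [hfg, hug', hUp] with x h1 h2 hxU y hy
      have := hle x hxU
      rw [h1 y hy, h2 y hy, EReal.coe_le_coe_iff] at this
      linarith
    · rw [← Chart.eventually_coord hpφ]
      have h3 : ∀ᶠ x in 𝓝 p, ((r - ε / 2 : ℝ) : EReal) < f x := by
        refine (hf.1.continuousAt hUp).eventually_const_lt ?_
        rw [heq, hr, EReal.coe_lt_coe_iff]; linarith
      have h4 : ∀ᶠ x in 𝓝 p, u x < ((r + ε / 2 : ℝ) : EReal) := by
        refine (hu.1.1.continuousAt hUp).eventually_lt_const ?_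
        rw [hr, EReal.coe_lt_coe_iff]; linarith
      filter_upwards [hfg, hug', h3, h4] with x h1 h2 h3 h4 y hy
      rw [h1 y hy, EReal.coe_lt_coe_iff] at h3
      rw [h2 y hy, EReal.coe_lt_coe_iff] at h4
      linarith
  rw [← Chart.eventually_coord hpφ] at key
  have hin : ∀ᶠ x in 𝓝 p, IsInner x → f x = u x := by
    filter_upwards [key, hfg, hug', φ.hom.open_source.mem_nhds hpφ] with x h0 h1 h2 hxs hi
    obtain ⟨y, hy⟩ := hi.exists_coord hφ hxs
    rw [h1 y hy, h2 y hy, EReal.coe_eq_coe_iff]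
    linarith [h0 y hy]
  filter_upwards [hin.eventually_nhds, hU.eventually_mem hp] with x hx hxU
  have hUx := hU.mem_nhds hxU
  exact eq_of_eventually_inner (hf.1.continuousAt hUx) (hu.1.1.continuousAt hUx) hx

end Regular

end Trop

namespace Trop

/-! ### Sections of `𝒪(D)`, tropical combinations and extremals. -/

theorem sup_const_add {ι : Type*} (T : Finset ι) (r : EReal) (f : ι → EReal) :
    T.sup (fun i => r + f i) = r + T.sup f := by
  classical
  induction T using Finset.induction_on with
  | empty => simp
  | insert a T _ ih => rw [Finset.sup_insert, Finset.sup_insert, ih, max_add_add_left]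

section Regular

variable {X : Type*} [TopologicalSpace X] [TropicalVariety X] {U : Set X} {f : X → EReal}

theorem IsRegular.const_add (hU : IsOpen U) (hf : IsRegular U f) (c : TNum) :
    IsRegular U (fun x => (c : EReal) + f x) := by
  obtain ⟨c, hc⟩ := c
  induction c with
  | top => exact absurd rfl hc
  | bot => simpa only [EReal.bot_add] using isRegular_bot
  | coe c =>
    simpa only [add_comm] using hf.add_invertible hU (isInvertible_const c)

theorem isRegular_finset_sup {ι : Type*} (T : Finset ι) {f : ι → X → EReal}
    (hf : ∀ i ∈ T, IsRegular U (f i)) : IsRegular U (fun x => T.sup fun i => f i x) := by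
  classical
  induction T using Finset.induction_on with
  | empty => simpa only [Finset.sup_empty] using isRegular_bot
  | insert a T _ ih =>
    simp only [Finset.sup_insert]
    exact (hf a (Finset.mem_insert_self _ _)).max
      (ih fun i hi => hf i (Finset.mem_insert_of_mem hi))

end Regular

namespace Divisor

variable {X : Type*} [TopologicalSpace X] [TropicalVariety X] {D : Divisor X}

theorem exists_pair (D : Divisor X) (x : X) : ∃ P : D.pairs, x ∈ P.1.1 := by
  obtain ⟨P, hP, hx⟩ := D.cover x
  exact ⟨⟨P, hP⟩, hx⟩

namespace GlobalSection

theorem val_ne_top (s : GlobalSection D) (P : D.pairs) (x : X) : s.val P x ≠ ⊤ := by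
  by_cases hx : x ∈ P.1.1
  · exact (s.regular P).2.1 x hx
  · rw [s.eq_bot P x hx]; exact bot_ne_top

/-- The transition functions of `𝒪(D)` relate the trivialisations of a section everywhere. -/
theorem exists_transition_unit (P Q : D.pairs) : ∃ u : X → EReal,
    IsInvertible ((P.1.1 : Set X) ∩ Q.1.1) u ∧
      ∀ s : GlobalSection D, ∀ x ∈ P.1.1, x ∈ Q.1.1 → s.val P x = s.val Q x + u x := by
  obtain ⟨u, hu, h⟩ := D.compat P.1 P.2 Q.1 Q.2
  have ho : IsOpen ((P.1.1 : Set X) ∩ Q.1.1) := P.1.1.isOpen.inter Q.1.1.isOpen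
  refine ⟨u, hu, fun s x hP hQ => ?_⟩
  refine eqOn_of_inner ho ((s.regular P).1.mono inter_subset_left)
    (((s.regular Q).mono inter_subset_right).add_invertible ho hu).1 (fun z hz hi => ?_) ⟨hP, hQ⟩
  rw [s.compat P Q z hz.1 hz.2 hi, h z hz hi, add_comm]

/-- The transition functions are invertible, so invertibility in one trivialisation implies it in
all others. -/
theorem notMem_supp_iff {s : GlobalSection D} {x : X} {P : D.pairs} (hx : x ∈ P.1.1) :
    x ∉ s.supp ↔ ∃ W : Set X, IsOpen W ∧ x ∈ W ∧ W ⊆ P.1.1 ∧ IsInvertible W (s.val P) := by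
  constructor
  · intro h
    by_contra hn
    exact h ⟨P, hx, hn⟩
  · rintro ⟨W, hW, hxW, hWP, hs⟩ ⟨Q, hxQ, hn⟩
    obtain ⟨u, hu, h⟩ := exists_transition_unit Q P
    have ho : IsOpen (W ∩ Q.1.1) := hW.inter Q.1.1.isOpen
    refine hn ⟨W ∩ Q.1.1, ho, ⟨hxW, hxQ⟩, inter_subset_right, ?_⟩
    refine ((hs.mono inter_subset_left).add ho (hu.mono fun z hz => ⟨hz.2, hWP hz.1⟩)).congr ho ?_
    exact fun z hz => (h s z hz.2 (hWP hz.1)).symm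

theorem eventually_notMem_supp {s : GlobalSection D} {x : X} (hx : x ∉ s.supp) :
    ∀ᶠ y in 𝓝 x, y ∉ s.supp := by
  obtain ⟨P, hP⟩ := D.exists_pair x
  obtain ⟨W, hW, hxW, hWP, hs⟩ := (notMem_supp_iff hP).1 hx
  filter_upwards [hW.mem_nhds hxW] with y hy
  exact (notMem_supp_iff (hWP hy)).2 ⟨W, hW, hy, hWP, hs⟩

theorem val_ne_bot {s : GlobalSection D} {x : X} (hx : x ∉ s.supp) {P : D.pairs}
    (hP : x ∈ P.1.1) : s.val P x ≠ ⊥ := by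
  obtain ⟨W, hW, hxW, hWP, hs⟩ := (notMem_supp_iff hP).1 hx
  exact hs.ne_bot hxW

end GlobalSection

open GlobalSection

theorem sameMonomialAt_iff {x : X} {m m' : GlobalSection D} {P : D.pairs} (hx : x ∈ P.1.1) :
    SameMonomialAt x m m' ↔ ∃ c : ℝ, ∀ᶠ z in 𝓝 x, m.val P z = (c : EReal) + m'.val P z := by
  constructor
  · rintro ⟨c, h⟩
    obtain ⟨W, hW, hxW, h⟩ := h P hx
    exact ⟨c, Filter.eventually_of_mem (hW.mem_nhds hxW) h⟩
  · rintro ⟨c, h⟩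
    refine ⟨c, fun Q hQ => ?_⟩
    obtain ⟨u, hu, hPQ⟩ := exists_transition_unit Q P
    have : ∀ᶠ z in 𝓝 x, m.val Q z = (c : EReal) + m'.val Q z := by
      filter_upwards [h, P.1.1.isOpen.mem_nhds hx, Q.1.1.isOpen.mem_nhds hQ] with z hz hzP hzQ
      rw [hPQ m z hzQ hzP, hPQ m' z hzQ hzP, hz, add_assoc]
    obtain ⟨W, h1, h2, h3⟩ := eventually_nhds_iff.1 this
    exact ⟨W, h2, h3, h1⟩

theorem SameMonomialAt.of_forall {m m' : GlobalSection D} {c : ℝ}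
    (h : ∀ P x, m.val P x = (c : EReal) + m'.val P x) (x : X) : SameMonomialAt x m m' :=
  ⟨c, fun P _ => ⟨univ, isOpen_univ, mem_univ _, fun z _ => h P z⟩⟩

theorem SameMonomialAt.refl (x : X) (m : GlobalSection D) : SameMonomialAt x m m :=
  .of_forall (c := 0) (fun P z => by simp) x

theorem SameMonomialAt.symm {x : X} {m m' : GlobalSection D} (h : SameMonomialAt x m m') :
    SameMonomialAt x m' m := by
  obtain ⟨P, hP⟩ := D.exists_pair x
  rw [sameMonomialAt_iff hP] at *
  obtain ⟨c, h⟩ := h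
  refine ⟨-c, ?_⟩
  filter_upwards [h] with z hz
  rw [hz, ← add_assoc, ← EReal.coe_add, neg_add_cancel, EReal.coe_zero, zero_add]

theorem SameMonomialAt.trans {x : X} {m m' m'' : GlobalSection D} (h : SameMonomialAt x m m')
    (h' : SameMonomialAt x m' m'') : SameMonomialAt x m m'' := by
  obtain ⟨P, hP⟩ := D.exists_pair x
  rw [sameMonomialAt_iff hP] at *
  obtain ⟨c, h⟩ := h
  obtain ⟨c', h'⟩ := h'
  refine ⟨c + c', ?_⟩
  filter_upwards [h, h'] with z hz hz'
  rw [hz, hz', ← add_assoc, ← EReal.coe_add]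

theorem SameMonomialAt.eventually {x : X} {m m' : GlobalSection D} (h : SameMonomialAt x m m') :
    ∀ᶠ y in 𝓝 x, SameMonomialAt y m m' := by
  obtain ⟨P, hP⟩ := D.exists_pair x
  rw [sameMonomialAt_iff hP] at h
  obtain ⟨c, h⟩ := h
  filter_upwards [h.eventually_nhds, P.1.1.isOpen.mem_nhds hP] with y hy hyP
  exact (sameMonomialAt_iff hyP).2 ⟨c, hy⟩

theorem SameMonomialAt.notMem_supp {x : X} {m m' : GlobalSection D} (h : SameMonomialAt x m m')
    (hx : x ∉ m'.supp) : x ∉ m.supp := by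
  obtain ⟨P, hP⟩ := D.exists_pair x
  obtain ⟨W, hW, hxW, hWP, hs⟩ := (notMem_supp_iff hP).1 hx
  obtain ⟨c, h⟩ := (sameMonomialAt_iff hP).1 h
  obtain ⟨V, h1, hV, hxV⟩ := eventually_nhds_iff.1 h
  have ho := hW.inter hV
  refine (notMem_supp_iff hP).2 ⟨W ∩ V, ho, ⟨hxW, hxV⟩, inter_subset_left.trans hWP, ?_⟩
  exact ((isInvertible_const c).add ho (hs.mono inter_subset_left)).congr ho
    fun z hz => (h1 z hz.2).symm

/-- If a multiple of `s` is bounded by `m` and touches it at a point near which `m` is invertible,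
then the two agree near that point. -/
theorem sameMonomialAt_of_touch {m s : GlobalSection D} {c : TNum} {P : D.pairs} {x : X}
    (hx : x ∈ P.1.1) (hle : ∀ z, (c : EReal) + s.val P z ≤ m.val P z)
    (heq : (c : EReal) + s.val P x = m.val P x) (hm : x ∉ m.supp) : SameMonomialAt x m s := by
  obtain ⟨W, hW, hxW, hWP, hs⟩ := (notMem_supp_iff hx).1 hm
  have h := (((s.regular P).mono hWP).const_add hW c).eventually_eq_of_le hW hs
    (fun z _ => hle z) hxW heq
  have hc : (c : EReal) ≠ ⊥ := fun hc => hs.ne_bot hxW (by rw [← heq, hc, EReal.bot_add])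
  rw [sameMonomialAt_iff hx]
  refine ⟨(c : EReal).toReal, ?_⟩
  rw [EReal.coe_toReal c.2 hc]
  filter_upwards [h] with z hz using hz.symm

section Span

variable {k : ℕ}

/-- The tropical linear combination of the sections `s i`, `i ∈ T`, with coefficients `c i`. -/
noncomputable def comb (T : Finset (Fin k)) (c : Fin k → TNum) (s : Fin k → GlobalSection D) :
    GlobalSection D where
  val P x := T.sup fun i => (c i : EReal) + (s i).val P x
  regular P := isRegular_finset_sup T fun i _ => ((s i).regular P).const_add P.1.1.isOpen (c i)
  eq_bot P x hx := by
    rw [← le_bot_iff]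
    exact Finset.sup_le fun i _ => by rw [(s i).eq_bot P x hx, EReal.add_bot]
  compat P Q x hP hQ hi := by
    rw [← sup_const_add]
    refine Finset.sup_congr rfl fun i _ => ?_
    rw [(s i).compat P Q x hP hQ hi, add_left_comm]

theorem mem_span_iff {s : Fin k → GlobalSection D} {m : GlobalSection D} :
    m ∈ span s ↔ ∃ c, m = comb Finset.univ c s := by
  refine exists_congr fun c => ?_
  rw [GlobalSection.ext_iff]
  simp only [funext_iff, comb, Finset.sup_univ_eq_iSup]

theorem comb_mem_span (T : Finset (Fin k)) (c : Fin k → TNum) (s : Fin k → GlobalSection D) :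
    comb T c s ∈ span s := by
  classical
  refine mem_span_iff.2 ⟨fun i => if i ∈ T then c i else ⟨⊥, bot_ne_top⟩, ?_⟩
  ext P x
  simp only [comb]
  refine le_antisymm (Finset.sup_le fun i hi => ?_) (Finset.sup_le fun i _ => ?_)
  · refine le_trans ?_ (Finset.le_sup (Finset.mem_univ i))
    rw [if_pos hi]
  · by_cases hi : i ∈ T
    · rw [if_pos hi]
      exact Finset.le_sup (f := fun i => (c i : EReal) + (s i).val P x) hi
    · rw [if_neg hi]
      simp

theorem mem_span_self (s : Fin k → GlobalSection D) (l : Fin k) : s l ∈ span s := by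
  have : s l = comb {l} (fun _ => ⟨0, EReal.zero_ne_top⟩) s := by
    ext P x; simp [comb]
  rw [this]
  exact comb_mem_span _ _ _

/-- The extremals of a finitely generated module are multiples of generators. -/
theorem IsExtremal.exists_eq {s : Fin k → GlobalSection D} {m : GlobalSection D}
    (hm : IsExtremal (span s) m) :
    ∃ l, ∃ c : ℝ, ∀ P x, m.val P x = (c : EReal) + (s l).val P x := by
  classical
  obtain ⟨hmem, ⟨P₀, x₀, hne⟩, hext⟩ := hm
  obtain ⟨c, hc⟩ := mem_span_iff.1 hmem
  -- Extremality removes one term at a time: a combination over `insert a T` equals its `a`-term or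
  -- its part over `T`.
  have key : ∀ T : Finset (Fin k), m = comb T c s → ∃ l, m = comb {l} c s := by
    intro T
    induction T using Finset.induction_on with
    | empty => intro h; exact absurd (by rw [h]; simp [comb]) hne
    | insert a T _ ih =>
      intro h
      by_contra! hcon
      refine hext ⟨comb {a} c s, comb_mem_span _ _ _, comb T c s, comb_mem_span _ _ _,
        fun P x => ?_, (hcon a).symm, fun h' => ?_⟩
      · rw [h]; simp only [comb, Finset.sup_insert, Finset.sup_singleton]
      · obtain ⟨l, hl⟩ := ih h'.symm
        exact hcon l hl
  obtain ⟨l, hl⟩ := key _ hc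
  have hl' : ∀ P x, m.val P x = (c l : EReal) + (s l).val P x := by
    intro P x; rw [hl]; simp [comb]
  have hcl : (c l : EReal) ≠ ⊥ := fun h => hne (by rw [hl', h, EReal.bot_add])
  refine ⟨l, (c l : EReal).toReal, ?_⟩
  rwa [EReal.coe_toReal (c l).2 hcl]

/-- The sections `s i`, `i ∈ A`, generate the span of all `s i`. -/
def Generates (s : Fin k → GlobalSection D) (A : Finset (Fin k)) : Prop :=
  ∀ m ∈ span s, ∃ c, m = comb A c s

theorem generates_univ (s : Fin k → GlobalSection D) : Generates s Finset.univ :=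
  fun _ hm => mem_span_iff.1 hm

/-- Substituting the expression for `s l` changes the coefficient of `s i` to `max (c i) (c l + e
i)`. -/
theorem Generates.erase {s : Fin k → GlobalSection D} {A : Finset (Fin k)} (hA : Generates s A)
    {l : Fin k} (hl : l ∈ A) {e : Fin k → TNum} (he : s l = comb (A.erase l) e s) :
    Generates s (A.erase l) := by
  intro m hm
  obtain ⟨c, rfl⟩ := hA m hm
  have htop : ∀ i, max (c i : EReal) ((c l : EReal) + e i) ≠ ⊤ := fun i => by
    rcases max_choice (c i : EReal) ((c l : EReal) + e i) with h | h <;> rw [h]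
    exacts [(c i).2, EReal.add_ne_top (c l).2 (e i).2]
  refine ⟨fun i => ⟨_, htop i⟩, ?_⟩
  ext P x
  have h1 : (s l).val P x = (A.erase l).sup fun i => (e i : EReal) + (s i).val P x := by
    conv_lhs => rw [he]
    rfl
  have h2 : ∀ i, max (c i : EReal) ((c l : EReal) + e i) + (s i).val P x =
      ((c i : EReal) + (s i).val P x) ⊔ ((c l : EReal) + ((e i : EReal) + (s i).val P x)) :=
    fun i => by rw [← add_assoc, ← max_add_add_right]
  simp only [comb, h2]
  rw [← Finset.insert_erase hl, Finset.sup_insert, Finset.erase_insert (Finset.notMem_erase l A),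
    h1, ← sup_const_add, ← Finset.sup_sup, sup_comm]
  rfl

/-- A minimal generating subfamily consists of extremals. -/
theorem exists_generates (s : Fin k → GlobalSection D) :
    ∃ A, Generates s A ∧ ∀ l ∈ A, IsExtremal (span s) (s l) := by
  obtain ⟨A, hA, hmin⟩ := (wellFounded_lt (α := Finset (Fin k))).has_min {A | Generates s A}
    ⟨_, generates_univ s⟩
  refine ⟨A, hA, fun l hl => ?_⟩
  have hno : ∀ e, s l ≠ comb (A.erase l) e s := fun e he =>
    hmin _ (hA.erase hl he) (Finset.erase_ssubset hl)
  have hex : ∃ P x, (s l).val P x ≠ ⊥ := by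
    by_contra! h
    refine hno (fun _ => ⟨⊥, bot_ne_top⟩) ?_
    ext P x
    rw [h]
    simp [comb]
  refine ⟨mem_span_self s l, hex, ?_⟩
  rintro ⟨a, ha, b, hb, hab, hane, hbne⟩
  obtain ⟨P₀, x₀, hx₀⟩ := hex
  -- A nonnegative coefficient of `s l` in `a` would give `s l ≤ a`, hence equality.
  have key : ∀ a : GlobalSection D, (∀ P x, a.val P x ≤ (s l).val P x) → a ≠ s l →
      ∀ α, a = comb A α s → (α l : EReal) < 0 := by
    intro a hle hne α hα
    have h1 : ∀ P x, (α l : EReal) + (s l).val P x ≤ a.val P x := fun P x => by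
      rw [hα]
      exact Finset.le_sup (f := fun i => (α i : EReal) + (s i).val P x) hl
    by_contra! h0
    refine hne ?_
    ext P x
    refine le_antisymm (hle P x) (le_trans ?_ (h1 P x))
    calc (s l).val P x = 0 + (s l).val P x := (zero_add _).symm
      _ ≤ _ := by gcongr
  obtain ⟨α, hα⟩ := hA a ha
  obtain ⟨β, hβ⟩ := hA b hb
  have hαl := key a (fun P x => by rw [hab]; exact le_max_left _ _) hane α hα
  have hβl := key b (fun P x => by rw [hab]; exact le_max_right _ _) hbne β hβ
  have htop : ∀ i, max (α i : EReal) (β i : EReal) ≠ ⊤ := fun i => by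
    rcases max_choice (α i : EReal) (β i : EReal) with h | h <;> rw [h]
    exacts [(α i).2, (β i).2]
  refine hno (fun i => ⟨_, htop i⟩) ?_
  ext P x
  -- Adding a negative coefficient keeps the first term strictly below `s l` wherever `s l` is
  -- finite, so the remaining generators already produce `s l`, contrary to minimality.
  have h1 : (s l).val P x = max ((max (α l : EReal) (β l : EReal)) + (s l).val P x)
      ((comb (A.erase l) (fun i => ⟨_, htop i⟩) s).val P x) := by
    have h2 : ∀ i, max (α i : EReal) (β i : EReal) + (s i).val P x =
        ((α i : EReal) + (s i).val P x) ⊔ ((β i : EReal) + (s i).val P x) :=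
      fun i => (max_add_add_right _ _ _).symm
    refine (hab P x).trans ?_
    rw [h2, hα, hβ]
    simp only [comb, h2]
    rw [← Finset.insert_erase hl, Finset.sup_insert, Finset.sup_insert,
      Finset.erase_insert (Finset.notMem_erase l A), max_max_max_comm, ← Finset.sup_sup]
    rfl
  rcases max_choice ((max (α l : EReal) (β l : EReal)) + (s l).val P x)
      ((comb (A.erase l) (fun i => ⟨_, htop i⟩) s).val P x) with h2 | h2
  · have h3 := h1.trans h2
    by_cases hb : (s l).val P x = ⊥
    · refine le_antisymm (by rw [hb]; exact bot_le) ?_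
      conv_rhs => rw [h1]
      exact le_max_right _ _
    · exfalso
      have h4 : max (α l : EReal) (β l : EReal) < 0 := max_lt hαl hβl
      have h5 := EReal.add_lt_add_right_coe h4 ((s l).val P x).toReal
      rw [EReal.coe_toReal ((s l).val_ne_top P x) hb, zero_add, ← h3] at h5
      exact lt_irrefl _ h5
  · exact h1.trans h2

end Span

end Divisor

end Trop

namespace Trop

/-! ### Counting monomials and slopes. -/

namespace Divisor

open GlobalSection

variable {X : Type*} [TopologicalSpace X] [TropicalVariety X] {D : Divisor X} {k : ℕ}
  {s : Fin k → GlobalSection D}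

/-- The class of the monomial `m` among the elements of `M` around `x`. -/
def monomialClass (M : Set (GlobalSection D)) (x : X) (m : GlobalSection D) :
    Set (GlobalSection D) :=
  {m' | m' ∈ M ∧ x ∉ m'.supp ∧ SameMonomialAt x m m'}

theorem monomialCount_eq (M : Set (GlobalSection D)) (x : X) :
    monomialCount M x = (monomialClass M x '' {m | m ∈ M ∧ x ∉ m.supp}).encard := rfl

theorem SameMonomialAt.monomialClass_eq {M : Set (GlobalSection D)} {x : X}
    {m m' : GlobalSection D} (h : SameMonomialAt x m m') :
    monomialClass M x m = monomialClass M x m' := by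
  ext e
  exact and_congr_right fun _ => and_congr_right fun _ => ⟨h.symm.trans, h.trans⟩

/-- The term attaining the maximum at `x` touches the invertible `m` from below, so the maximum
principle identifies them. Hence there are never more monomials than generators. -/
theorem Generates.exists_sameMonomialAt {A : Finset (Fin k)} (hA : Generates s A)
    {m : GlobalSection D} (hm : m ∈ span s) {x : X} (hx : x ∉ m.supp) :
    ∃ l ∈ A, SameMonomialAt x m (s l) := by
  obtain ⟨P, hP⟩ := D.exists_pair x
  obtain ⟨c, rfl⟩ := hA m hm
  have hne : A.Nonempty := by
    rw [Finset.nonempty_iff_ne_empty]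
    rintro rfl
    exact val_ne_bot hx hP (by simp [comb])
  obtain ⟨l, hl, h⟩ := Finset.exists_mem_eq_sup A hne fun i => (c i : EReal) + (s i).val P x
  refine ⟨l, hl, sameMonomialAt_of_touch (c := c l) hP (fun z => ?_) h.symm hx⟩
  exact Finset.le_sup (f := fun i => (c i : EReal) + (s i).val P z) hl

theorem Generates.image_subset {A : Finset (Fin k)} (hA : Generates s A) (x : X) :
    monomialClass (span s) x '' {m | m ∈ span s ∧ x ∉ m.supp} ⊆
      (fun l => monomialClass (span s) x (s l)) '' A := by
  rintro _ ⟨m, ⟨hm, hx⟩, rfl⟩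
  obtain ⟨l, hl, h⟩ := hA.exists_sameMonomialAt hm hx
  exact ⟨l, hl, h.symm.monomialClass_eq⟩

theorem Generates.monomialCount_le {A : Finset (Fin k)} (hA : Generates s A) (x : X) :
    monomialCount (span s) x ≤ A.card := by
  rw [monomialCount_eq]
  refine (encard_le_encard (hA.image_subset x)).trans ((encard_image_le _ _).trans ?_)
  rw [encard_coe_eq_coe_finsetCard]

theorem monomialCount_span_le (s : Fin k → GlobalSection D) (x : X) :
    monomialCount (span s) x ≤ k := by
  simpa using (generates_univ s).monomialCount_le x

theorem slopeCount_span_le (s : Fin k → GlobalSection D) (x : X) :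
    slopeCount (span s) x ≤ k := by
  unfold slopeCount
  split_ifs
  · exact monomialCount_span_le s x
  · exact iSup₂_le fun y _ => monomialCount_span_le s y

/-- If somewhere there are as many monomials as generators, all generators are extremal. -/
theorem isExtremal_of_le_monomialCount {x : X} (h : (k : ℕ∞) ≤ monomialCount (span s) x)
    (l : Fin k) : IsExtremal (span s) (s l) := by
  obtain ⟨A, hA, hext⟩ := exists_generates s
  have h1 := h.trans (hA.monomialCount_le x)
  rw [Nat.cast_le] at h1
  have h2 : A = Finset.univ := Finset.eq_univ_of_card A
    (le_antisymm (Finset.card_le_univ A) (by simpa using h1))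
  exact hext l (h2 ▸ Finset.mem_univ l)

/-- Otherwise the classes of the generators other than `s b` would already be all the classes, at
most k - 1 of them. -/
theorem not_sameMonomialAt_of_le_monomialCount {x : X}
    (h : (k : ℕ∞) ≤ monomialCount (span s) x) {a b : Fin k} (hab : a ≠ b) :
    ¬ SameMonomialAt x (s a) (s b) := by
  intro hs
  have h1 : (fun l => monomialClass (span s) x (s l)) '' (Finset.univ : Finset (Fin k)) ⊆
      (fun l => monomialClass (span s) x (s l)) '' (Finset.univ.erase b : Finset (Fin k)) := by
    rintro _ ⟨l, -, rfl⟩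
    by_cases hl : l = b
    · exact ⟨a, by simp [hab], by rw [hl]; exact hs.monomialClass_eq⟩
    · exact ⟨l, by simp [hl], rfl⟩
  have h2 := h.trans ((encard_le_encard (((generates_univ s).image_subset x).trans h1)).trans
    (encard_image_le _ _))
  rw [encard_coe_eq_coe_finsetCard, Nat.cast_le, Finset.card_erase_of_mem (Finset.mem_univ b),
    Finset.card_univ, Fintype.card_fin] at h2
  have := b.pos
  omega

/-- Extremals are scalar multiples of generators, so testing the generators suffices. -/
theorem mem_smoothLocus_of_forall {x : X} (h : ∀ l, x ∉ (s l).supp) :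
    x ∈ smoothLocus (span s) := by
  intro m hm
  obtain ⟨l, c, hlc⟩ := hm.exists_eq
  exact (SameMonomialAt.of_forall hlc x).notMem_supp (h l)

theorem le_monomialCount {x : X} (h : ∀ l, x ∉ (s l).supp)
    (hne : ∀ a b, a ≠ b → ¬ SameMonomialAt x (s a) (s b)) :
    (k : ℕ∞) ≤ monomialCount (span s) x := by
  have hinj : Function.Injective fun l => monomialClass (span s) x (s l) := by
    intro a b hab
    by_contra hne'
    have : s b ∈ monomialClass (span s) x (s b) := ⟨mem_span_self s b, h b, .refl x _⟩
    rw [show monomialClass (span s) x (s b) = monomialClass (span s) x (s a) from hab.symm] at this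
    exact hne a b hne' this.2.2
  have h1 : range (fun l => monomialClass (span s) x (s l)) ⊆
      monomialClass (span s) x '' {m | m ∈ span s ∧ x ∉ m.supp} := by
    rintro _ ⟨l, rfl⟩
    exact ⟨s l, ⟨mem_span_self s l, h l⟩, rfl⟩
  rw [monomialCount_eq]
  refine le_trans ?_ (encard_le_encard h1)
  rw [← image_univ, hinj.encard_image, encard_univ]
  simp

/-- If the generators are invertible and pairwise different on a connected set having `x` in its
closure, there are as many slopes as generators at `x`. -/
theorem slopeCount_eq_of_connected {x : X} {Z : Set X} (hZ : IsPreconnected Z)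
    (hx : x ∈ closure Z) (hinv : ∀ z ∈ Z, ∀ l, z ∉ (s l).supp)
    (hne : ∀ z ∈ Z, ∀ a b, a ≠ b → ¬ SameMonomialAt z (s a) (s b)) :
    slopeCount (span s) x = k := by
  refine le_antisymm (slopeCount_span_le s x) ?_
  have hcount : ∀ z ∈ Z, (k : ℕ∞) ≤ monomialCount (span s) z := fun z hz =>
    le_monomialCount (hinv z hz) (hne z hz)
  obtain ⟨z, hz⟩ := closure_nonempty_iff.1 ⟨x, hx⟩
  unfold slopeCount
  split_ifs with hxs
  -- The count on `Z` makes all generators extremal, hence invertible at `x`. Two of them agreeing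
  -- near `x` would agree near points of `Z`.
  · have hxl : ∀ l, x ∉ (s l).supp := fun l =>
      hxs _ (isExtremal_of_le_monomialCount (hcount z hz) l)
    refine le_monomialCount hxl fun a b hab hsame => ?_
    obtain ⟨y, hy, hyZ⟩ := mem_closure_iff_nhds.1 hx _ hsame.eventually
    exact hne y hyZ a b hab hy
  · have hZs : Z ⊆ smoothLocus (span s) := fun y hy => mem_smoothLocus_of_forall (hinv y hy)
    refine (hcount z hz).trans (le_iSup₂_of_le z ⟨hZs hz, ?_⟩ le_rfl)
    exact closure_mono (hZ.subset_connectedComponentIn hz hZs) hx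

/-- If there are `k ≠ 0` slopes at `x`, arbitrarily close to `x` there are points with `k`
slopes of the smooth locus. -/
theorem mem_closure_smoothLocus {M : Set (GlobalSection D)} {x : X} (h : slopeCount M x ≠ 0) :
    x ∈ closure (smoothLocus M) := by
  unfold slopeCount at h
  split_ifs at h with hx
  · exact subset_closure hx
  · by_contra hcl
    refine h (le_antisymm (iSup₂_le fun y hy => absurd ?_ hcl) bot_le)
    exact closure_mono (connectedComponentIn_subset _ _) hy.2

end Divisor

end Trop

namespace Trop

/-! ### Tropical linear systems, solved over Hahn series. -/

section Cramer

/-- The tropical absolute value of a Hahn series: minus the order. -/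
noncomputable def tropVal (x : HahnSeries ℝ ℚ) : EReal :=
  open Classical in if x = 0 then ⊥ else ((-x.order : ℝ) : EReal)

theorem tropVal_zero : tropVal 0 = ⊥ := if_pos rfl

theorem tropVal_of_ne {x : HahnSeries ℝ ℚ} (hx : x ≠ 0) : tropVal x = ((-x.order : ℝ) : EReal) :=
  if_neg hx

theorem tropVal_mul (x y : HahnSeries ℝ ℚ) : tropVal (x * y) = tropVal x + tropVal y := by
  by_cases hx : x = 0
  · rw [hx, zero_mul, tropVal_zero, EReal.bot_add]
  by_cases hy : y = 0
  · rw [hy, mul_zero, tropVal_zero, EReal.add_bot]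
  rw [tropVal_of_ne hx, tropVal_of_ne hy, tropVal_of_ne (mul_ne_zero hx hy),
    HahnSeries.order_mul hx hy, ← EReal.coe_add]
  congr 1
  ring

theorem exists_tropVal_eq {a : EReal} (ha : a ≠ ⊤) : ∃ x, tropVal x = a := by
  induction a with
  | top => exact absurd rfl ha
  | bot => exact ⟨0, tropVal_zero⟩
  | coe a =>
    refine ⟨HahnSeries.single (-a) 1, ?_⟩
    rw [tropVal_of_ne (by simp), HahnSeries.order_single one_ne_zero, neg_neg]

theorem orderTop_lt_of_tropVal_lt {x y : HahnSeries ℝ ℚ} (h : tropVal y < tropVal x) :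
    x.orderTop < y.orderTop := by
  have hx : x ≠ 0 := by rintro rfl; rw [tropVal_zero] at h; exact not_lt_bot h
  by_cases hy : y = 0
  · rw [hy, HahnSeries.orderTop_zero, lt_top_iff_ne_top]
    exact HahnSeries.orderTop_ne_top.2 hx
  · rw [tropVal_of_ne hx, tropVal_of_ne hy, EReal.coe_lt_coe_iff, neg_lt_neg_iff] at h
    rwa [← HahnSeries.order_eq_orderTop_of_ne_zero hx,
      ← HahnSeries.order_eq_orderTop_of_ne_zero hy, WithTop.coe_lt_coe]

/-- In a vanishing sum the maximal absolute value is attained at least twice. -/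
theorem exists_ne_of_sum_eq_zero {ι : Type*} [Fintype ι] {x : ι → HahnSeries ℝ ℚ}
    (hsum : ∑ i, x i = 0) {a : ι} (ha : tropVal (x a) ≠ ⊥) :
    ∃ b, b ≠ a ∧ tropVal (x a) ≤ tropVal (x b) := by
  classical
  by_contra! hcon
  have hxa : x a ≠ 0 := fun h => ha (by rw [h, tropVal_zero])
  rw [← Finset.add_sum_erase _ _ (Finset.mem_univ a)] at hsum
  -- If the term `a` were strictly dominant, its order would be smaller than that of the sum of the
  -- others, which is its negative.
  have h1 : (HahnSeries.addVal ℝ ℚ) (x a) <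
      (HahnSeries.addVal ℝ ℚ) (∑ i ∈ Finset.univ.erase a, x i) := by
    refine AddValuation.map_lt_sum _ ?_ fun i hi => ?_
    · rw [HahnSeries.addVal_apply]; exact HahnSeries.orderTop_ne_top.2 hxa
    · rw [HahnSeries.addVal_apply, HahnSeries.addVal_apply]
      exact orderTop_lt_of_tropVal_lt (hcon i (Finset.ne_of_mem_erase hi))
  rw [eq_neg_of_add_eq_zero_left hsum, AddValuation.map_neg] at h1
  exact lt_irrefl _ h1

/-- A homogeneous tropical linear system with more unknowns than equations has a nontrivial
solution: in each equation the maximum is attained twice or is `-∞`. -/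
theorem exists_tropical_solution {j k : ℕ} (hjk : j < k) {A : Fin j → Fin k → EReal}
    (hA : ∀ i l, A i l ≠ ⊤) : ∃ c : Fin k → TNum, (∃ l, (c l : EReal) ≠ ⊥) ∧
      ∀ i a, (c a : EReal) + A i a ≠ ⊥ → ∃ b, b ≠ a ∧ (c a : EReal) + A i a ≤ c b + A i b := by
  -- The entries are lifted to Hahn series with real exponents. The lifted matrix has a nonzero
  -- kernel vector, and its valuations are the tropical solution.
  choose B hB using fun i l => exists_tropVal_eq (hA i l)
  obtain ⟨z, hz, hz0⟩ := Submodule.exists_mem_ne_zero_of_ne_bot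
    (LinearMap.ker_ne_bot_of_finrank_lt (f := Matrix.mulVecLin (Matrix.of B)) (by simpa using hjk))
  have htop : ∀ x, tropVal x ≠ ⊤ := fun x => by
    unfold tropVal; split_ifs; exacts [bot_ne_top, EReal.coe_ne_top _]
  refine ⟨fun l => ⟨tropVal (z l), htop _⟩, ?_, fun i a ha => ?_⟩
  · obtain ⟨l, hl⟩ := Function.ne_iff.1 hz0
    refine ⟨l, ?_⟩
    simp only
    rw [tropVal_of_ne hl]
    exact EReal.coe_ne_bot _
  · have hsum : ∑ l, B i l * z l = 0 := congrFun (LinearMap.mem_ker.1 hz) i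
    have hv : ∀ l, tropVal (B i l * z l) = tropVal (z l) + A i l := fun l => by
      rw [tropVal_mul, hB, add_comm]
    simp only [← hv] at ha ⊢
    exact exists_ne_of_sum_eq_zero hsum ha

end Cramer

/-! ### Divisors of the linear system versus sections of `𝒪(D)`. -/

section Rational

variable {X : Type*} [TopologicalSpace X] [TropicalVariety X] {U : Set X}

theorem isRational_of_eventually {f : X → ℝ} (h : ∀ p ∈ U, ∃ φ ∈ TropicalVariety.atlas (X := X),
    p ∈ φ.hom.source ∧ ∃ g h, IsLaurent g ∧ IsLaurent h ∧
      ∀ᶠ x in 𝓝 p, ∀ y, φ.IsCoord x y → f x = g y - h y) : IsRational U f := by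
  intro p hp
  obtain ⟨φ, hφ, hpφ, g, l, hg, hl, h⟩ := h p hp
  obtain ⟨W, hW, hWo, hpW⟩ := eventually_nhds_iff.1 h
  exact ⟨φ, hφ, hpφ, W, hWo, hpW, g, l, hg, hl, hW⟩

theorem IsRational.exists_in {f : X → ℝ} (h : IsRational U f) {p : X} (hp : p ∈ U) {ψ : Chart X}
    (hψ : ψ ∈ TropicalVariety.atlas (X := X)) : ∃ g h, IsLaurent g ∧ IsLaurent h ∧
      ∀ᶠ x in 𝓝 p, ∀ y, ψ.IsCoord x y → f x = g y - h y := by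
  obtain ⟨φ, hφ, hpφ, W, hW, hpW, g, l, hg, hl, h⟩ := h p hp
  obtain ⟨A, b, hAb⟩ := exists_transition hφ hψ hpφ
  refine ⟨_, _, hg.comp A b, hl.comp A b, ?_⟩
  filter_upwards [hW.mem_nhds hpW, hAb] with x hx hxA y hy using h x hx _ (hxA y hy)

end Rational

namespace Divisor

open GlobalSection

variable {X : Type*} [TopologicalSpace X] [TropicalVariety X] {D : Divisor X}

theorem GlobalSection.exists_laurent {m : GlobalSection D}
    (hm : ∀ P x, x ∈ P.1.1 → IsInner x → m.val P x ≠ ⊥) (P : D.pairs) {p : X} (hp : p ∈ P.1.1)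
    {φ : Chart X} (hφ : φ ∈ TropicalVariety.atlas (X := X)) (hpφ : p ∈ φ.hom.source) :
    ∃ g, IsLaurent g ∧ ∀ᶠ x in 𝓝 p, ∀ y, φ.IsCoord x y → (m.val P x).toReal = g y := by
  rcases (isRegular_iff.1 (m.regular P)).2.2 p hp with h | h
  · exfalso
    obtain ⟨x, hx, hxb, hxP⟩ := ((frequently_isInner p).and_eventually
      (h.and (P.1.1.isOpen.mem_nhds hp))).exists
    exact hm P x hxP hx (hxb hx)
  · obtain ⟨g, hg, h⟩ := h φ hφ hpφ
    refine ⟨g, hg, ?_⟩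
    filter_upwards [h] with x hx y hy
    rw [hx y hy, EReal.toReal_coe]

theorem GlobalSection.toReal_sub {m : GlobalSection D}
    (hm : ∀ P x, x ∈ P.1.1 → IsInner x → m.val P x ≠ ⊥) {P Q : D.pairs} {x : X}
    (hP : x ∈ P.1.1) (hQ : x ∈ Q.1.1) (hi : IsInner x) :
    (m.val P x).toReal - P.1.2 x = (m.val Q x).toReal - Q.1.2 x := by
  have h := m.compat P Q x hP hQ hi
  rw [h, EReal.toReal_add (EReal.coe_ne_top _) (EReal.coe_ne_bot _) (m.val_ne_top Q x)
    (hm Q x hQ hi), EReal.toReal_coe]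
  ring

/-- The divisor of a section which is finite at all inner points. -/
noncomputable def GlobalSection.div (m : GlobalSection D)
    (hm : ∀ P x, x ∈ P.1.1 → IsInner x → m.val P x ≠ ⊥) : Divisor X where
  pairs := range fun P : D.pairs => (P.1.1, fun x => (m.val P x).toReal)
  rational := by
    rintro _ ⟨P, rfl⟩
    refine isRational_of_eventually fun p hp => ?_
    obtain ⟨φ, hφ, hpφ⟩ := exists_chart p
    obtain ⟨g, hg, h⟩ := m.exists_laurent hm P hp hφ hpφ
    refine ⟨φ, hφ, hpφ, g, _, hg, isLaurent_const 0, ?_⟩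
    filter_upwards [h] with x hx y hy
    rw [hx y hy, sub_zero]
  cover x := by
    obtain ⟨P, hP⟩ := D.exists_pair x
    exact ⟨_, ⟨P, rfl⟩, hP⟩
  compat := by
    rintro _ ⟨P, rfl⟩ _ ⟨Q, rfl⟩
    obtain ⟨u, hu, h⟩ := D.compat P.1 P.2 Q.1 Q.2
    refine ⟨u, hu, fun x hx hi => ?_⟩
    rw [h x hx hi]
    congr 1
    have := m.toReal_sub hm hx.1 hx.2 hi
    simp only
    linarith

theorem GlobalSection.div_mem_linearSystem (m : GlobalSection D)
    (hm : ∀ P x, x ∈ P.1.1 → IsInner x → m.val P x ≠ ⊥) : m.div hm ∈ D.linearSystem := by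
  have hcoe : ∀ (P : D.pairs) x, x ∈ P.1.1 → IsInner x →
      m.val P x = ((m.val P x).toReal : EReal) := fun P x hx hi =>
    (EReal.coe_toReal (m.val_ne_top P x) (hm P x hx hi)).symm
  refine ⟨⟨m.div hm, ?_, ?_⟩, ?_⟩
  · intro P hP Q hQ
    obtain ⟨u, hu, h⟩ := (m.div hm).compat P hP Q hQ
    exact ⟨u, hu, fun x hx hi => by rw [h x hx hi, add_zero]⟩
  · rintro _ ⟨P, rfl⟩
    exact ⟨m.val P, m.regular P, hcoe P⟩
  · choose R hR using D.exists_pair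
    have hh : ∀ (P : D.pairs) x, x ∈ P.1.1 → IsInner x →
        (m.val (R x) x).toReal - (R x).1.2 x = (m.val P x).toReal - P.1.2 x :=
      fun P x hx hi => m.toReal_sub hm (hR x) hx hi
    -- The section minus the local equation of `D` is the same in all trivialisations at inner
    -- points; `R x` is an arbitrary choice of one.
    refine ⟨fun x => (m.val (R x) x).toReal - (R x).1.2 x, ?_, ?_⟩
    · refine isRational_of_eventually fun p _ => ?_
      obtain ⟨φ, hφ, hpφ⟩ := exists_chart p
      obtain ⟨g, hg, h⟩ := m.exists_laurent hm (R p) (hR p) hφ hpφ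
      obtain ⟨a, b, ha, hb, h'⟩ := (D.rational _ (R p).2).exists_in (hR p) hφ
      refine ⟨φ, hφ, hpφ, _, _, hg.add hb, ha, ?_⟩
      filter_upwards [h, h', (R p).1.1.isOpen.mem_nhds (hR p)] with x h1 h2 hx y hy
      rw [hh (R p) x hx (hy.isInner hφ), h1 y hy, h2 y hy]
      ring
    · rintro _ ⟨P, rfl⟩ Q hQ
      obtain ⟨u, hu, h⟩ := D.compat P.1 P.2 Q hQ
      refine ⟨u, hu, fun x hx hi => ?_⟩
      rw [h x hx hi]
      congr 1
      simp only
      rw [hh P x hx.1 hi]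
      ring

/-- A unit agreeing with the local equation at inner points agrees with the section everywhere
nearby, by density and continuity. -/
theorem GlobalSection.supp_subset_supp_div (m : GlobalSection D)
    (hm : ∀ P x, x ∈ P.1.1 → IsInner x → m.val P x ≠ ⊥) : m.supp ⊆ (m.div hm).supp := by
  rintro p ⟨P, hp, hn⟩
  refine ⟨_, ⟨P, rfl⟩, hp, ?_⟩
  rintro ⟨W, hW, hpW, hWP, u, hu, h⟩
  refine hn ⟨W, hW, hpW, hWP, hu.congr hW ?_⟩
  refine eqOn_of_inner hW hu.1.1 ((m.regular P).1.mono hWP) fun x hx hi => ?_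
  rw [h x hx hi]
  exact EReal.coe_toReal (m.val_ne_top P x) (hm P x (hWP hx) hi)

open Classical in
/-- A function `h` such that all local equations of `D + div h` are, at inner points, locally the
restrictions of regular functions comes from a section of `𝒪(D)`. -/
theorem exists_globalSection {h : X → ℝ} (H : ∀ P : D.pairs, ∀ p ∈ P.1.1, ∃ V : Set X, IsOpen V ∧
    p ∈ V ∧ V ⊆ P.1.1 ∧ ∃ w : X → EReal, IsRegular V w ∧
      ∀ x ∈ V, IsInner x → w x = ((P.1.2 x + h x : ℝ) : EReal)) :
    ∃ m : GlobalSection D, ∀ P : D.pairs, ∀ x ∈ P.1.1, IsInner x →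
      m.val P x = ((P.1.2 x + h x : ℝ) : EReal) := by
  -- Outside the inner points the value is the limit from them, which exists because the local
  -- functions `w` are continuous.
  let F : D.pairs → X → EReal := fun P x => if x ∈ P.1.1 then
    extendFrom {x : X | IsInner x} (fun x => ((P.1.2 x + h x : ℝ) : EReal)) x else ⊥
  have hF : ∀ (P : D.pairs) (V : Set X) (w : X → EReal), IsOpen V → V ⊆ P.1.1 → IsRegular V w →
      (∀ x ∈ V, IsInner x → w x = ((P.1.2 x + h x : ℝ) : EReal)) → EqOn w (F P) V := by
    intro P V w hV hVP hw hwh x hx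
    have hxP : x ∈ P.1.1 := hVP hx
    simp only [F]
    rw [if_pos hxP]
    refine (extendFrom_eq (mem_closure_isInner x) ?_).symm
    refine ((hw.1.continuousAt (hV.mem_nhds hx)).tendsto.mono_left
      (nhdsWithin_le_nhds (s := {x : X | IsInner x}))).congr' ?_
    rw [Filter.EventuallyEq, eventually_nhdsWithin_iff]
    exact Filter.eventually_of_mem (hV.mem_nhds hx) hwh
  have hval : ∀ P : D.pairs, ∀ x ∈ P.1.1, IsInner x →
      F P x = ((P.1.2 x + h x : ℝ) : EReal) := by
    intro P x hx hi
    obtain ⟨V, hV, hxV, hVP, w, hw, hwh⟩ := H P x hx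
    rw [← hF P V w hV hVP hw hwh hxV, hwh x hxV hi]
  refine ⟨⟨F, fun P => isRegular_of_locally fun p hp => ?_, fun P x hx => if_neg hx,
    fun P Q x hP hQ hi => ?_⟩, hval⟩
  · obtain ⟨V, hV, hpV, hVP, w, hw, hwh⟩ := H P p hp
    exact ⟨V, hV, hpV, hw.congr hV (hF P V w hV hVP hw hwh)⟩
  · rw [hval P x hP hi, hval Q x hQ hi, ← EReal.coe_add]
    congr 1
    ring

/-- Every divisor of `|D|` is cut out by a section of `𝒪(D)`. -/
theorem exists_section_of_mem_linearSystem {E : Divisor X} (hE : E ∈ D.linearSystem) :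
    ∃ m : GlobalSection D, (∀ P x, x ∈ P.1.1 → IsInner x → m.val P x ≠ ⊥) ∧ E.supp ⊆ m.supp := by
  obtain ⟨⟨D', hD', hreg⟩, h, -, hh⟩ := hE
  obtain ⟨m, hm⟩ := exists_globalSection (D := D) (h := h) (by
    intro P p hp
    obtain ⟨R, hR, hpR⟩ := D'.cover p
    obtain ⟨Q, hQ, hpQ⟩ := E.cover p
    obtain ⟨u, hu, hRQ⟩ := hD' R hR Q hQ
    obtain ⟨v, hv, hQP⟩ := hh Q hQ P.1 P.2
    obtain ⟨w, hw, hwR⟩ := hreg R hR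
    -- On the triple overlap the regular equation `w` of `D'` is corrected by the units relating
    -- `D'` to `E` and `E` to `D + div h`.
    have ho : IsOpen ((R.1 : Set X) ∩ Q.1 ∩ P.1.1) :=
      (R.1.isOpen.inter Q.1.isOpen).inter P.1.1.isOpen
    have hu' := (hu.mono (V := (R.1 : Set X) ∩ Q.1 ∩ P.1.1) fun x hx => hx.1).neg
    have hv' := (hv.mono (V := (R.1 : Set X) ∩ Q.1 ∩ P.1.1) fun x hx => ⟨hx.1.2, hx.2⟩).neg
    refine ⟨_, ho, ⟨⟨hpR, hpQ⟩, hp⟩, fun x hx => hx.2, _,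
      ((hw.mono fun x hx => hx.1.1).add_invertible ho hu').add_invertible ho hv', ?_⟩
    intro x hx hi
    rw [hwR x hx.1.1 hi, hRQ x hx.1 hi, hQP x ⟨hx.1.2, hx.2⟩ hi, ← EReal.coe_neg,
      ← EReal.coe_neg, ← EReal.coe_add, ← EReal.coe_add]
    congr 1
    ring)
  refine ⟨m, fun P x hx hi => by rw [hm P x hx hi]; exact EReal.coe_ne_bot _, ?_⟩
  rintro p ⟨Q, hQ, hpQ, hn⟩
  by_contra hp
  obtain ⟨P, hP⟩ := D.exists_pair p
  obtain ⟨W, hW, hpW, hWP, hs⟩ := (notMem_supp_iff hP).1 hp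
  obtain ⟨v, hv, hQP⟩ := hh Q hQ P.1 P.2
  have ho := hW.inter Q.1.isOpen
  refine hn ⟨W ∩ Q.1, ho, ⟨hpW, hpQ⟩, inter_subset_right, _,
    (hs.mono inter_subset_left).add ho (hv.mono fun x hx => ⟨hx.2, hWP hx.1⟩), ?_⟩
  intro x hx hi
  rw [hm P x (hWP hx.1) hi, hQP x ⟨hx.2, hWP hx.1⟩ hi, ← EReal.coe_add]
  congr 1
  ring

end Divisor

end Trop

namespace Trop

/-! ### Affine cells in `X` and break points of convex functions. -/

variable {X : Type*} [TopologicalSpace X]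

theorem Chart.IsCoord.eventually {φ : Chart X} {z : X} {y : Fin φ.n → ℝ} (h : φ.IsCoord z y) :
    ∀ᶠ z' in 𝓝 z, ∃ y', φ.IsCoord z' y' := by
  have h1 : ∀ᶠ t : Fin φ.n → TNum in 𝓝 (φ.hom z : Fin φ.n → TNum), ∀ i, (t i : EReal) ≠ ⊥ := by
    rw [Filter.eventually_all]
    intro i
    have hc : ContinuousAt (fun t : Fin φ.n → TNum => (t i : EReal))
        (φ.hom z : Fin φ.n → TNum) :=
      (continuous_subtype_val.comp (continuous_apply i)).continuousAt
    refine hc.eventually_ne ?_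
    rw [h.2]
    exact EReal.coe_ne_bot _
  have h2 := (continuous_subtype_val.continuousAt.comp (φ.hom.continuousAt h.1)).eventually h1
  filter_upwards [h2, φ.hom.open_source.mem_nhds h.1] with z' hz' hs
  refine ⟨fun i => (((φ.hom z' : Fin φ.n → TNum) i : TNum) : EReal).toReal, hs, ?_⟩
  funext i
  exact Subtype.ext (EReal.coe_toReal ((φ.hom z' : Fin φ.n → TNum) i).2 (hz' i)).symm

theorem Chart.IsCoord.mem_finSupport {φ : Chart X} {z : X} {y : Fin φ.n → ℝ}
    (h : φ.IsCoord z y) : y ∈ φ.cx.finSupport :=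
  BalancedComplex.finitePart_mem_support.1 (h.2 ▸ (φ.hom z).2)

theorem Chart.IsCoord.eventually_coord {φ : Chart X} {z : X} {y : Fin φ.n → ℝ}
    (h : φ.IsCoord z y) {Q : (Fin φ.n → ℝ) → Prop} :
    (∀ᶠ z' in 𝓝 z, ∀ y', φ.IsCoord z' y' → Q y') ↔ ∀ᶠ y' in 𝓝[φ.cx.finSupport] y, Q y' := by
  rw [Chart.eventually_coord h.1, h.2, BalancedComplex.finNhds_finitePart]

variable [TropicalVariety X]

theorem isInvertible_of_zAffine {φ : Chart X} (hφ : φ ∈ TropicalVariety.atlas (X := X)) {V : Set X}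
    (hV : IsOpen V) {f : X → EReal} (hc : ContinuousOn f V) {m : (Fin φ.n → ℤ) × ℝ}
    (hf : ∀ z ∈ V, ∃ y, φ.IsCoord z y ∧ f z = (zAffine m y : EReal)) : IsInvertible V f := by
  have hneg : ∀ y, zAffine (-m) y = -zAffine m y := fun y => by
    simp only [zAffine, Prod.fst_neg, Prod.snd_neg, Pi.neg_apply, Int.cast_neg, neg_mul,
      Finset.sum_neg_distrib]
    ring
  have key : ∀ (f : X → EReal) (m : (Fin φ.n → ℤ) × ℝ), ContinuousOn f V →
      (∀ z ∈ V, ∃ y, φ.IsCoord z y ∧ f z = (zAffine m y : EReal)) → IsRegular V f := by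
    intro f m hc hf
    refine ⟨hc, fun z hz => ?_, fun z hz => ?_⟩ <;> obtain ⟨y, hy, h⟩ := hf z hz
    · rw [h]; exact EReal.coe_ne_top _
    · refine ⟨φ, hφ, hy.1, V, hV, hz, Or.inr ⟨_, isLaurent_zAffine m, fun x hx y' hy' => ?_⟩⟩
      obtain ⟨y'', hy'', h'⟩ := hf x hx
      rw [h', hy''.unique hy']
  refine ⟨key f m hc hf, key _ (-m) (continuous_neg.comp_continuousOn hc) fun z hz => ?_⟩
  obtain ⟨y, hy, h⟩ := hf z hz
  exact ⟨y, hy, by rw [h, hneg, EReal.coe_neg]⟩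

/-- Arbitrarily close to `x` there is a connected open set, convex in a chart, on which each of
finitely many functions regular near `x` is `-∞` or `ℤ`-affine. -/
theorem exists_affine_cell {ι : Type*} [Finite ι] {U : Set X} (hU : IsOpen U) {x : X} (hx : x ∈ U)
    {f : ι → X → EReal} (hf : ∀ i, IsRegular U (f i)) :
    ∃ φ ∈ TropicalVariety.atlas (X := X), ∃ (Z : Set (Fin φ.n → ℝ)) (V : Set X), Convex ℝ Z ∧
      IsOpen V ∧ IsPreconnected V ∧ x ∈ closure V ∧ V ⊆ U ∧
      (∀ z ∈ V, ∃ y ∈ Z, φ.IsCoord z y) ∧ (∀ y ∈ Z, ∃ z ∈ V, φ.IsCoord z y) ∧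
      ∀ i, (∀ z ∈ V, f i z = ⊥) ∨ ∃ m, ∀ z ∈ V, ∀ y, φ.IsCoord z y → f i z = (zAffine m y : EReal)
    := by
  obtain ⟨φ, hφ, hxφ⟩ := exists_chart x
  have h1 : ∀ i, ∃ g, IsLaurent g ∧ ((∀ᶠ z in 𝓝 x, IsInner z → f i z = ⊥) ∨
      ∀ᶠ z in 𝓝 x, ∀ y, φ.IsCoord z y → f i z = (g y : EReal)) := by
    intro i
    rcases (isRegular_iff.1 (hf i)).2.2 x hx with h | h
    · exact ⟨_, isLaurent_const 0, Or.inl h⟩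
    · obtain ⟨g, hg, h⟩ := h φ hφ hxφ
      exact ⟨g, hg, Or.inr h⟩
  choose g hg hfg using h1
  have h2 : ∀ᶠ z in 𝓝 x, z ∈ U ∧ ∀ i, ((∀ᶠ z in 𝓝 x, IsInner z → f i z = ⊥) →
      IsInner z → f i z = ⊥) ∧ ((∀ᶠ z in 𝓝 x, ∀ y, φ.IsCoord z y → f i z = (g i y : EReal)) →
      ∀ y, φ.IsCoord z y → f i z = (g i y : EReal)) := by
    refine (hU.eventually_mem hx).and (Filter.eventually_all.2 fun i => ?_)
    refine Filter.Eventually.and ?_ ?_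
    · by_cases h : ∀ᶠ z in 𝓝 x, IsInner z → f i z = ⊥
      · filter_upwards [h] with z hz _ using hz
      · exact Filter.Eventually.of_forall fun _ h' => absurd h' h
    · by_cases h : ∀ᶠ z in 𝓝 x, ∀ y, φ.IsCoord z y → f i z = (g i y : EReal)
      · filter_upwards [h] with z hz _ using hz
      · exact Filter.Eventually.of_forall fun _ h' => absurd h' h
  obtain ⟨W, hW, hWo, hxW⟩ := eventually_nhds_iff.1 h2
  have hUfin : ∀ᶠ y in φ.cx.finNhds (φ.hom x : Fin φ.n → TNum), ∃ z ∈ W, φ.IsCoord z y := by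
    rw [← Chart.eventually_coord hxφ]
    filter_upwards [hWo.mem_nhds hxW] with z hz y hy using ⟨z, hz, hy⟩
  obtain ⟨Z, hZ, -, hZcl, hZU, hZs, hZn, hZg⟩ :=
    BalancedComplex.exists_cell (φ.hom x).2 hg hUfin
  let V : Set X := {z | z ∈ W ∧ ∃ y ∈ Z, φ.IsCoord z y}
  have hVZ : ∀ y ∈ Z, ∃ z ∈ V, φ.IsCoord z y := fun y hy => by
    obtain ⟨z, hzW, hz⟩ := hZU hy
    exact ⟨z, ⟨hzW, y, hy, hz⟩, hz⟩
  refine ⟨φ, hφ, Z, V, hZ, ?_, ?_, ?_, fun z hz => (hW z hz.1).1, fun z hz => hz.2, hVZ,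
    fun i => ?_⟩
  · rw [isOpen_iff_mem_nhds]
    rintro z ⟨hzW, y, hy, hzy⟩
    filter_upwards [hWo.mem_nhds hzW, hzy.eventually, hzy.eventually_coord.2 (hZn y hy)]
      with z' h3 ⟨y', h4⟩ h5 using ⟨h3, y', h5 y' h4, h4⟩
  · have hmem : ∀ y : Z, finitePart y.1 ∈ φ.cx.support := fun y =>
      BalancedComplex.finitePart_mem_support.2 (hZs y.2)
    let e : Z → X := fun y => φ.hom.symm ⟨finitePart y.1, hmem y⟩
    have he : ∀ (y : Z) z, φ.IsCoord z y.1 → z = e y := fun y z hz => by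
      have : φ.hom z = ⟨finitePart y.1, hmem y⟩ := Subtype.ext hz.2
      simp only [e]
      rw [← this, φ.hom.left_inv hz.1]
    have hcont : Continuous e := by
      rw [← continuousOn_univ]
      refine φ.hom.continuousOn_symm.comp (Continuous.continuousOn ?_) fun y _ => ?_
      · exact (isEmbedding_finitePart.continuous.comp continuous_subtype_val).subtype_mk _
      · obtain ⟨z, -, hz⟩ := hVZ y y.2
        have : φ.hom z = ⟨finitePart y.1, hmem y⟩ := Subtype.ext hz.2
        rw [← this]
        exact φ.hom.map_source hz.1
    have hrange : V = range e := by
      ext z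
      constructor
      · rintro ⟨-, y, hy, hz⟩
        exact ⟨⟨y, hy⟩, (he ⟨y, hy⟩ z hz).symm⟩
      · rintro ⟨y, rfl⟩
        obtain ⟨z, hz, hzy⟩ := hVZ y y.2
        rwa [← he y z hzy]
    have : PreconnectedSpace Z := isPreconnected_iff_preconnectedSpace.1 hZ.isPreconnected
    rw [hrange]
    exact isPreconnected_range hcont
  · rw [mem_closure_iff_nhds]
    intro O hO
    by_contra hne
    rw [not_nonempty_iff_eq_empty] at hne
    have h3 : ∀ᶠ y in φ.cx.finNhds (φ.hom x : Fin φ.n → TNum), y ∉ Z := by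
      rw [← Chart.eventually_coord hxφ]
      filter_upwards [hO, hWo.mem_nhds hxW] with z hzO hzW y hy hyZ
      exact (hne ▸ (⟨hzO, hzW, y, hyZ, hy⟩ : z ∈ O ∩ V) : z ∈ (∅ : Set X))
    rw [BalancedComplex.eventually_finNhds] at h3
    obtain ⟨_, h4, y, hy, rfl⟩ := mem_closure_iff_nhds.1 hZcl _ h3
    exact h4 y rfl (hZs hy) hy
  · rcases hfg i with h | h
    · left
      rintro z ⟨hzW, y, hy, hz⟩
      exact ((hW z hzW).2 i).1 h (hz.isInner hφ)
    · right
      obtain ⟨m, hm⟩ := hZg i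
      refine ⟨m, ?_⟩
      rintro z ⟨hzW, y, hy, hz⟩ y' hy'
      rw [((hW z hzW).2 i).2 h y' hy', hm y' (hz.unique hy' ▸ hy)]

/-- A convex piecewise linear function with `r ≥ 1` slopes does not have `r` break points. -/
theorem card_slopes_gt {r : ℕ} (hr : 0 < r) {T : Finset ℝ} {lo hi : Fin r → ℝ}
    (hlo : ∀ i, lo i ∈ T) (hhi : ∀ i, hi i ∈ T) (hlt : ∀ i, lo i < hi i)
    (hle : ∀ i j, i < j → hi i ≤ lo j) : r < T.card := by
  classical
  -- The right-hand slopes are distinct and the first left-hand slope lies below all of them, which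
  -- makes r + 1 slopes.
  have hmono : StrictMono hi := fun i j hij => (hle i j hij).trans_lt (hlt j)
  have hnot : lo ⟨0, hr⟩ ∉ Finset.univ.image hi := by
    simp only [Finset.mem_image, Finset.mem_univ, true_and, not_exists]
    intro i h
    have h1 := hlt ⟨0, hr⟩
    have h2 := hmono.monotone (Fin.mk_le_of_le_val (Nat.zero_le i) : (⟨0, hr⟩ : Fin r) ≤ i)
    linarith
  have hsub : insert (lo ⟨0, hr⟩) (Finset.univ.image hi) ⊆ T := by
    intro a ha
    rcases Finset.mem_insert.1 ha with rfl | ha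
    · exact hlo _
    · obtain ⟨i, -, rfl⟩ := Finset.mem_image.1 ha
      exact hhi i
  have := Finset.card_le_card hsub
  rw [Finset.card_insert_of_notMem hnot, Finset.card_image_of_injective _ hmono.injective,
    Finset.card_univ, Fintype.card_fin] at this
  omega

end Trop

namespace Trop

/-! ### The inequality `h0a ≤ h0`. -/

namespace Divisor

open GlobalSection

variable {X : Type*} [TopologicalSpace X] [TropicalVariety X] {D : Divisor X}

/-- A section that is invertible on a dense set is finite at all inner points. -/
theorem GlobalSection.val_ne_bot_of_dense {s : GlobalSection D} {U : Set X}
    (hU : ∀ x, x ∈ closure U) (h : ∀ x ∈ U, x ∉ s.supp) (P : D.pairs) (x : X) (hx : x ∈ P.1.1)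
    (hi : IsInner x) : s.val P x ≠ ⊥ := by
  rcases (isRegular_iff.1 (s.regular P)).2.2 x hx with hb | hl
  · exfalso
    obtain ⟨y, ⟨hy, hyP⟩, hyU⟩ := mem_closure_iff_nhds.1 (hU x) _
      (hb.eventually_nhds.and (P.1.1.isOpen.eventually_mem hx))
    obtain ⟨z, hz, hzb, hzs, hzP⟩ := ((frequently_isInner y).and_eventually
      (hy.and ((eventually_notMem_supp (h y hyU)).and (P.1.1.isOpen.eventually_mem hyP)))).exists
    exact val_ne_bot hzs hzP (hzb hz)
  · obtain ⟨φ, hφ, y, hy⟩ := hi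
    obtain ⟨g, -, hg⟩ := hl φ hφ hy.1
    rw [hg.self_of_nhds y hy]
    exact EReal.coe_ne_bot _

theorem h0a_le_h0 (D : Divisor X) : D.h0a ≤ D.h0 := by
  refine sSup_le ?_
  rintro _ ⟨k, rfl, s, hs⟩
  refine le_sInf ?_
  rintro _ ⟨j, rfl, p, hp⟩
  by_contra! hjk
  rw [Nat.cast_lt] at hjk
  refine hp ?_
  -- Here `k` is positive because it exceeds `j`.
  have hdense : ∀ x, x ∈ closure (smoothLocus (span s)) := fun x =>
    mem_closure_smoothLocus (by rw [hs x]; exact_mod_cast (Nat.zero_le j).trans_lt hjk |>.ne')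
  have hcount : ∀ x ∈ smoothLocus (span s), (k : ℕ∞) ≤ monomialCount (span s) x := fun x hx => by
    rw [← hs x, slopeCount, if_pos hx]
  have hinv : ∀ l, ∀ x ∈ smoothLocus (span s), x ∉ (s l).supp := fun l x hx =>
    hx _ (isExtremal_of_le_monomialCount (hcount x hx) l)
  choose P hP using fun i => D.exists_pair (p i)
  obtain ⟨c, ⟨l₀, hl₀⟩, hc⟩ := exists_tropical_solution hjk
    (A := fun i l => (s l).val (P i) (p i)) fun i l => (s l).val_ne_top _ _
  set m := comb Finset.univ c s with hm
  have hle : ∀ l P x, (c l : EReal) + (s l).val P x ≤ m.val P x := fun l P x =>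
    Finset.le_sup (f := fun l => (c l : EReal) + (s l).val P x) (Finset.mem_univ l)
  have hfin : ∀ P x, x ∈ P.1.1 → IsInner x → m.val P x ≠ ⊥ := by
    intro P x hx hi hbot
    have h1 := hle l₀ P x
    rw [hbot, le_bot_iff, EReal.add_eq_bot_iff] at h1
    exact h1.elim hl₀ ((s l₀).val_ne_bot_of_dense hdense (hinv l₀) P x hx hi)
  refine ⟨m.div hfin, m.div_mem_linearSystem hfin, fun i => m.supp_subset_supp_div hfin ?_⟩
  -- Two generators attain the value of `m` at `p i`. If `m` were invertible there, both would agree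
  -- with it up to constants near `p i`, in particular at nearby points of the smooth locus, where
  -- the k monomials differ.
  by_contra hi
  obtain ⟨a, -, ha⟩ := Finset.exists_mem_eq_sup Finset.univ ⟨l₀, Finset.mem_univ _⟩
    fun l => (c l : EReal) + (s l).val (P i) (p i)
  have ha : (c a : EReal) + (s a).val (P i) (p i) = m.val (P i) (p i) := ha.symm
  obtain ⟨b, hba, hb⟩ := hc i a (by rw [ha]; exact val_ne_bot hi (hP i))
  have hb : (c b : EReal) + (s b).val (P i) (p i) = m.val (P i) (p i) :=
    le_antisymm (hle b _ _) (ha ▸ hb)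
  have hsame := (sameMonomialAt_of_touch (hP i) (hle a _) ha hi).symm.trans
    (sameMonomialAt_of_touch (hP i) (hle b _) hb hi)
  obtain ⟨y, hy, hys⟩ := mem_closure_iff_nhds.1 (hdense (p i)) _ hsame.eventually
  exact not_sameMonomialAt_of_le_monomialCount (hcount y hys) hba.symm hy

/-! ### The inequality `h0 ≤ h0b`. -/

section Cell

variable {φ : Chart X} {Z : Set (Fin φ.n → ℝ)} {V : Set X} {P : D.pairs}

/-- Two sections that are `ℤ`-affine on a convex cell are equal up to a constant near a point of
the cell only if they are so on the whole cell. -/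
theorem SameMonomialAt.exists_const_of_cell (hZ : Convex ℝ Z) (hVP : V ⊆ P.1.1)
    (hVZ : ∀ z ∈ V, ∃ y ∈ Z, φ.IsCoord z y) (hZV : ∀ y ∈ Z, ∃ z ∈ V, φ.IsCoord z y)
    (hV : IsOpen V) {a b : GlobalSection D} {ma mb : (Fin φ.n → ℤ) × ℝ}
    (ha : ∀ z ∈ V, ∀ y, φ.IsCoord z y → a.val P z = (zAffine ma y : EReal))
    (hb : ∀ z ∈ V, ∀ y, φ.IsCoord z y → b.val P z = (zAffine mb y : EReal))
    {z : X} (hz : z ∈ V) (h : SameMonomialAt z a b) :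
    ∃ c : ℝ, ∀ y ∈ Z, zAffine ma y = c + zAffine mb y := by
  obtain ⟨c, hc⟩ := (sameMonomialAt_iff (hVP hz)).1 h
  obtain ⟨y₀, hy₀, hzy₀⟩ := hVZ z hz
  have h1 : ∀ᶠ z' in 𝓝 z, ∀ y, φ.IsCoord z' y → zAffine ma y = c + zAffine mb y := by
    filter_upwards [hc, hV.mem_nhds hz] with z' h1 h2 y hy
    rw [ha z' h2 y hy, hb z' h2 y hy, ← EReal.coe_add, EReal.coe_eq_coe_iff] at h1
    exact h1
  rw [hzy₀.eventually_coord] at h1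
  refine ⟨c, fun y hy => ?_⟩
  have hZs : ∀ y ∈ Z, y ∈ φ.cx.finSupport := fun y hy => by
    obtain ⟨z, -, hz⟩ := hZV y hy
    exact hz.mem_finSupport
  -- The relation holds at `y₀` and at a nearby point of the segment towards `y`; since both sides
  -- are affine, it extends to `y`.
  have hc : Filter.Tendsto (fun t : ℝ => y₀ + t • (y - y₀)) (𝓝[Ioo 0 1] 0)
      (𝓝[φ.cx.finSupport] y₀) := by
    refine tendsto_nhdsWithin_iff.2 ⟨?_, ?_⟩
    · have : Continuous (fun t : ℝ => y₀ + t • (y - y₀)) := by fun_prop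
      have := this.tendsto 0
      simp only [zero_smul, add_zero] at this
      exact this.mono_left nhdsWithin_le_nhds
    · filter_upwards [self_mem_nhdsWithin] with t ht
      exact hZs _ (hZ.add_smul_sub_mem hy₀ hy ⟨ht.1.le, ht.2.le⟩)
  have : (𝓝[Ioo (0 : ℝ) 1] 0).NeBot := left_nhdsWithin_Ioo_neBot one_pos
  obtain ⟨t, ht, ht0, -⟩ := ((hc.eventually h1).and self_mem_nhdsWithin).exists
  have h0 := h1.self_of_nhdsWithin (hZs y₀ hy₀)
  rw [zAffine_lineMap, zAffine_lineMap] at ht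
  have : t * (zAffine ma y - (c + zAffine mb y)) = 0 := by linear_combination ht - (1 - t) * h0
  rcases mul_eq_zero.1 this with h | h
  · exact absurd h ht0.ne'
  · linarith

/-- If a tropical combination of sections, each `-∞` or `ℤ`-affine on a cell, is not
invertible at a point of the cell, its value there is attained by two different monomials. -/
theorem exists_two_of_mem_supp {N : ℕ} {s : Fin N → GlobalSection D}
    (hφ : φ ∈ TropicalVariety.atlas (X := X)) (hV : IsOpen V)
    (hVP : V ⊆ P.1.1) (hVZ : ∀ z ∈ V, ∃ y ∈ Z, φ.IsCoord z y)
    {I : Set (Fin N)} {M : Fin N → (Fin φ.n → ℤ) × ℝ}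
    (hbot : ∀ l ∉ I, ∀ z ∈ V, (s l).val P z = ⊥)
    (hM : ∀ l ∈ I, ∀ z ∈ V, ∀ y, φ.IsCoord z y → (s l).val P z = (zAffine (M l) y : EReal))
    {c : Fin N → TNum} {z : X} (hz : z ∈ V)
    (hfin : (comb Finset.univ c s).val P z ≠ ⊥) (hsupp : z ∈ (comb Finset.univ c s).supp) :
    ∃ a ∈ I, ∃ b ∈ I, (¬ ∃ e : ℝ, ∀ y ∈ Z, zAffine (M a) y = e + zAffine (M b) y) ∧
      (c a : EReal) + (s a).val P z = (comb Finset.univ c s).val P z ∧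
      (c b : EReal) + (s b).val P z = (comb Finset.univ c s).val P z := by
  by_contra! hcon
  set m := comb Finset.univ c s with hm
  have hmval : ∀ x, m.val P x = Finset.univ.sup fun l => (c l : EReal) + (s l).val P x :=
    fun x => rfl
  have hne : (Finset.univ : Finset (Fin N)).Nonempty := by
    rw [Finset.nonempty_iff_ne_empty]
    intro h
    exact hfin (by rw [hmval, h, Finset.sup_empty])
  obtain ⟨a, -, ha⟩ := Finset.exists_mem_eq_sup Finset.univ hne
    fun l => (c l : EReal) + (s l).val P z
  rw [← hmval] at ha
  have hI : ∀ l, (c l : EReal) + (s l).val P z = m.val P z → l ∈ I := fun l hl => by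
    by_contra h
    exact hfin (by rw [← hl, hbot l h z hz, EReal.add_bot])
  have hca : (c a : EReal) ≠ ⊥ := fun h => hfin (by rw [ha, h, EReal.bot_add])
  have haI := hI a ha.symm
  obtain ⟨y₀, hy₀, hzy₀⟩ := hVZ z hz
  -- Terms that attain the maximum at `z` coincide with the `a`-term on the cell by `hcon`, and the
  -- others stay smaller by continuity. So near `z` the combination is a single monomial.
  have hloc : ∀ᶠ x in 𝓝 z, ∀ l, (c l : EReal) + (s l).val P x ≤ (c a : EReal) + (s a).val P x := by
    rw [Filter.eventually_all]
    intro l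
    by_cases hl : (c l : EReal) + (s l).val P z = m.val P z
    · have hlI := hI l hl
      obtain ⟨e, he⟩ : ∃ e : ℝ, ∀ y ∈ Z, zAffine (M a) y = e + zAffine (M l) y := by
        by_contra h
        push Not at h
        exact hcon a haI l hlI (fun e => h e) ha.symm hl
      have hcl : (c l : EReal) ≠ ⊥ := fun h => hfin (by rw [← hl, h, EReal.bot_add])
      filter_upwards [hV.mem_nhds hz] with x hx
      obtain ⟨y, hy, hxy⟩ := hVZ x hx
      have h1 := hl.trans ha
      rw [hM l hlI z hz y₀ hzy₀, hM a haI z hz y₀ hzy₀, he y₀ hy₀,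
        ← EReal.coe_toReal (c l).2 hcl, ← EReal.coe_toReal (c a).2 hca, ← EReal.coe_add,
        ← EReal.coe_add, EReal.coe_eq_coe_iff] at h1
      rw [hM l hlI x hx y hxy, hM a haI x hx y hxy, he y hy,
        ← EReal.coe_toReal (c l).2 hcl, ← EReal.coe_toReal (c a).2 hca, ← EReal.coe_add,
        ← EReal.coe_add, EReal.coe_le_coe_iff]
      linarith
    · have hlt : (c l : EReal) + (s l).val P z < (c a : EReal) + (s a).val P z := by
        rw [← ha]
        exact lt_of_le_of_ne (Finset.le_sup (f := fun l => (c l : EReal) + (s l).val P z)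
          (Finset.mem_univ l)) hl
      have hc : ∀ l, ContinuousAt (fun x => (c l : EReal) + (s l).val P x) z := fun l =>
        (((s l).regular P).const_add P.1.1.isOpen (c l)).1.continuousAt
          (P.1.1.isOpen.mem_nhds (hVP hz))
      filter_upwards [(hc l).eventually_lt (hc a) hlt] with x hx using hx.le
  have hsame : SameMonomialAt z m (s a) := by
    refine (sameMonomialAt_iff (hVP hz)).2 ⟨(c a : EReal).toReal, ?_⟩
    rw [EReal.coe_toReal (c a).2 hca]
    filter_upwards [hloc] with x hx
    rw [hmval]
    exact le_antisymm (Finset.sup_le fun l _ => hx l)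
      (Finset.le_sup (f := fun l => (c l : EReal) + (s l).val P x) (Finset.mem_univ a))
  refine hsame.notMem_supp ((notMem_supp_iff (hVP hz)).2 ⟨V, hV, hz, hVP, ?_⟩) hsupp
  refine isInvertible_of_zAffine hφ hV (((s a).regular P).1.mono hVP) (m := M a) fun x hx => ?_
  obtain ⟨y, -, hy⟩ := hVZ x hx
  exact ⟨y, hy, hM a haI x hx y hy⟩

end Cell

end Divisor

end Trop

namespace Trop

namespace Divisor

open GlobalSection

variable {X : Type*} [TopologicalSpace X] [TropicalVariety X] {D : Divisor X}

/-- There is a segment in a convex set along which finitely many `ℤ`-affine functions have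
different slopes unless they differ by a constant on the whole set. -/
theorem exists_generic_segment {n N : ℕ} {Z : Set (Fin n → ℝ)} (hZ : Convex ℝ Z)
    {y₀ : Fin n → ℝ} (hy₀ : y₀ ∈ Z) (M : Fin N → (Fin n → ℤ) × ℝ) :
    ∃ y₁ ∈ Z, ∀ a b, zLin (M a) (y₁ - y₀) = zLin (M b) (y₁ - y₀) ↔
      ∃ e : ℝ, ∀ y ∈ Z, zAffine (M a) y = e + zAffine (M b) y := by
  classical
  -- The constants make these differences vanish at `y₀`. At a generic `y₁` such a difference is
  -- zero only if it is zero on all of `Z`.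
  let α : Fin N × Fin N → (Fin n → ℤ) × ℝ := fun p =>
    ((M p.1).1 - (M p.2).1, -(zLin (M p.1) y₀ - zLin (M p.2) y₀))
  have hα : ∀ p y, zAffine (α p) y = zLin (M p.1) (y - y₀) - zLin (M p.2) (y - y₀) := by
    intro p y
    have h := zAffine_sub (M p.1) (M p.2) y
    simp only [zAffine_eq] at h
    have h2 : zAffine (α p) y = zAffine ((M p.1).1 - (M p.2).1, (M p.1).2 - (M p.2).2) y
        - ((M p.1).2 - (M p.2).2) - (zLin (M p.1) y₀ - zLin (M p.2) y₀) := by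
      simp only [α, zAffine]; ring
    rw [h2, zAffine_eq, h, map_sub, map_sub]
    ring
  obtain ⟨y₁, hy₁, hgen⟩ := exists_generic hZ ⟨y₀, hy₀⟩ (Finset.univ.image α)
  refine ⟨y₁, hy₁, fun a b => ⟨fun h => ?_, ?_⟩⟩
  · have h0 : ∀ z ∈ Z, zAffine (α (a, b)) z = 0 := by
      by_contra! hne
      refine hgen (α (a, b)) (Finset.mem_image_of_mem _ (Finset.mem_univ _)) hne ?_
      rw [hα]
      exact sub_eq_zero.2 h
    refine ⟨zAffine (M a) y₀ - zAffine (M b) y₀, fun y hy => ?_⟩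
    have h1 := h0 y hy
    rw [hα, map_sub, map_sub] at h1
    simp only [zAffine_eq]
    linarith
  · rintro ⟨e, he⟩
    have h0 := he y₀ hy₀
    have h1 := he y₁ hy₁
    simp only [zAffine_eq] at h0 h1
    rw [map_sub, map_sub]
    linarith

/-- The number of slopes, along a generic segment in a cell, of a system of generators of
`Γ(X, 𝒪(D))` is at least `h⁰(X, D)`: otherwise one takes as many points on the segment. -/
theorem h0_le_card_slopes {N : ℕ} {s : Fin N → GlobalSection D} (hs : span s = univ)
    {φ : Chart X} (hφ : φ ∈ TropicalVariety.atlas (X := X)) {Z : Set (Fin φ.n → ℝ)} {V : Set X}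
    {P : D.pairs} (hZ : Convex ℝ Z) (hV : IsOpen V) (hVP : V ⊆ P.1.1)
    (hVZ : ∀ z ∈ V, ∃ y ∈ Z, φ.IsCoord z y) (hZV : ∀ y ∈ Z, ∃ z ∈ V, φ.IsCoord z y)
    {I : Set (Fin N)} {M : Fin N → (Fin φ.n → ℤ) × ℝ}
    (hbot : ∀ l ∉ I, ∀ z ∈ V, (s l).val P z = ⊥)
    (hMI : ∀ l ∈ I, ∀ z ∈ V, ∀ y, φ.IsCoord z y → (s l).val P z = (zAffine (M l) y : EReal))
    {z₀ : X} (hz₀ : z₀ ∈ V) {y₀ y₁ : Fin φ.n → ℝ} (hy₀ : y₀ ∈ Z) (hzy₀ : φ.IsCoord z₀ y₀)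
    (hy₁ : y₁ ∈ Z) (hseg : ∀ a b, zLin (M a) (y₁ - y₀) = zLin (M b) (y₁ - y₀) ↔
      ∃ e : ℝ, ∀ y ∈ Z, zAffine (M a) y = e + zAffine (M b) y)
    {T : Finset ℝ} (hσT : ∀ l ∈ I, zLin (M l) (y₁ - y₀) ∈ T) : D.h0 ≤ T.card := by
  set σ : Fin N → ℝ := fun l => zLin (M l) (y₁ - y₀) with hσ
  set r := T.card with hr
  -- These are `r` distinct points of the segment. For `r = 0` there is no point, and what remains
  -- is that the linear system is empty.
  let t : Fin r → ℝ := fun i => (i : ℝ) / r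
  have ht : ∀ i, t i ∈ Icc (0 : ℝ) 1 := fun i =>
    ⟨by positivity, div_le_one_of_le₀ (by exact_mod_cast i.2.le) (by positivity)⟩
  have htlt : ∀ i j, i < j → t i < t j := fun i j hij => by
    have : (0 : ℝ) < r := by exact_mod_cast i.pos
    exact div_lt_div_of_pos_right (by exact_mod_cast hij) this
  have hpt : ∀ i, ∃ z ∈ V, φ.IsCoord z (y₀ + t i • (y₁ - y₀)) := fun i =>
    hZV _ (hZ.add_smul_sub_mem hy₀ hy₁ (ht i))
  choose p hpV hp using hpt
  have hno : ¬ ∃ E ∈ D.linearSystem, ∀ i, p i ∈ E.supp := by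
    rintro ⟨E, hE, hEp⟩
    obtain ⟨m, hfin, hsupp⟩ := exists_section_of_mem_linearSystem hE
    obtain ⟨c, rfl⟩ := mem_span_iff.1 (hs ▸ mem_univ m : m ∈ span s)
    have hle : ∀ l z, (c l : EReal) + (s l).val P z ≤ (comb Finset.univ c s).val P z :=
      fun l z => Finset.le_sup (f := fun l => (c l : EReal) + (s l).val P z) (Finset.mem_univ l)
    have hr0 : 0 < r := by
      rw [hr, Finset.card_pos]
      by_contra hemp
      refine hfin P z₀ (hVP hz₀) (hzy₀.isInner hφ) ?_
      rw [← le_bot_iff]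
      simp only [comb]
      refine Finset.sup_le fun l _ => ?_
      rw [hbot l (fun hl => hemp ⟨_, hσT l hl⟩) z₀ hz₀, EReal.add_bot]
    have hne : ∀ i, (comb Finset.univ c s).val P (p i) ≠ ⊥ := fun i =>
      hfin P (p i) (hVP (hpV i)) ((hp i).isInner hφ)
    have htwo : ∀ i, ∃ lo ∈ I, ∃ hi ∈ I, σ lo < σ hi ∧
        (c lo : EReal) + (s lo).val P (p i) = (comb Finset.univ c s).val P (p i) ∧
        (c hi : EReal) + (s hi).val P (p i) = (comb Finset.univ c s).val P (p i) := by
      intro i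
      obtain ⟨a, ha, b, hb, hab, h1, h2⟩ := exists_two_of_mem_supp hφ hV hVP hVZ hbot hMI
        (hpV i) (hne i) (hsupp (hEp i))
      rw [← hseg] at hab
      rcases lt_or_gt_of_ne hab with h | h
      · exact ⟨a, ha, b, hb, h, h1, h2⟩
      · exact ⟨b, hb, a, ha, h, h2, h1⟩
    choose lo hlo hi hhi hlt hloeq hhieq using htwo
    have hcne : ∀ l i, (c l : EReal) + (s l).val P (p i) = (comb Finset.univ c s).val P (p i) →
        (c l : EReal) ≠ ⊥ := fun l i h hc => hne i (by rw [← h, hc, EReal.bot_add])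
    have key : ∀ i l l', l ∈ I → l' ∈ I → (c l' : EReal) ≠ ⊥ →
        (c l : EReal) + (s l).val P (p i) = (comb Finset.univ c s).val P (p i) →
        (c l' : EReal).toReal + (zAffine (M l') y₀ + t i * σ l') ≤
          (c l : EReal).toReal + (zAffine (M l) y₀ + t i * σ l) := by
      intro i l l' hl hl' hc' h
      have h1 := hle l' (p i)
      rw [← h, hMI l hl _ (hpV i) _ (hp i), hMI l' hl' _ (hpV i) _ (hp i),
        ← EReal.coe_toReal (c l).2 (hcne l i h), ← EReal.coe_toReal (c l').2 hc',
        ← EReal.coe_add, ← EReal.coe_add, EReal.coe_le_coe_iff] at h1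
      simpa only [zAffine_add, map_smul, smul_eq_mul] using h1
    -- Convexity: comparing the upper slope at `t i` with the lower slope at the later point `t j`,
    -- at both points, puts them in order.
    have := card_slopes_gt hr0 (T := T) (lo := fun i => σ (lo i)) (hi := fun i => σ (hi i))
      (fun i => hσT _ (hlo i)) (fun i => hσT _ (hhi i)) hlt fun i j hij => by
        have h1 := key i (hi i) (lo j) (hhi i) (hlo j) (hcne _ j (hloeq j)) (hhieq i)
        have h2 := key j (lo j) (hi i) (hlo j) (hhi i) (hcne _ i (hhieq i)) (hloeq j)
        have h3 := htlt i j hij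
        by_contra! h4
        nlinarith
    exact lt_irrefl _ this
  exact sInf_le ⟨r, rfl, p, hno⟩

theorem h0_le_h0b (D : Divisor X) (hD : D.FinGen) : D.h0 ≤ D.h0b := by
  classical
  obtain ⟨N, s, hs⟩ := hD
  -- Testing all finite `k ≤ h0` also covers the case that `h0` is infinite.
  refine ENat.forall_natCast_le_iff_le.1 fun k hk => le_sSup ⟨k, rfl, fun x => ?_⟩
  obtain ⟨P, hP⟩ := D.exists_pair x
  obtain ⟨φ, hφ, Z, V, hZ, hV, hVc, hxV, hVP, hVZ, hZV, hcell⟩ :=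
    exists_affine_cell P.1.1.isOpen hP (f := fun l => (s l).val P) fun l => (s l).regular P
  have hchoice : ∀ l, ∃ m, (¬ ∀ z ∈ V, (s l).val P z = ⊥) →
      ∀ z ∈ V, ∀ y, φ.IsCoord z y → (s l).val P z = (zAffine m y : EReal) := fun l => by
    rcases hcell l with h | ⟨m, h⟩
    · exact ⟨0, fun h' => absurd h h'⟩
    · exact ⟨m, fun _ => h⟩
  choose M hM using hchoice
  set I : Set (Fin N) := {l | ¬ ∀ z ∈ V, (s l).val P z = ⊥} with hI
  have hMI : ∀ l ∈ I, ∀ z ∈ V, ∀ y, φ.IsCoord z y → (s l).val P z = (zAffine (M l) y : EReal) :=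
    fun l hl => hM l hl
  have hbot : ∀ l ∉ I, ∀ z ∈ V, (s l).val P z = ⊥ := fun l hl => not_not.1 hl
  obtain ⟨z₀, hz₀⟩ := closure_nonempty_iff.1 ⟨x, hxV⟩
  obtain ⟨y₀, hy₀, hzy₀⟩ := hVZ z₀ hz₀
  obtain ⟨y₁, hy₁, hseg⟩ := exists_generic_segment hZ hy₀ M
  set σ : Fin N → ℝ := fun l => zLin (M l) (y₁ - y₀) with hσ
  set T : Finset ℝ := (Finset.univ.filter fun l => l ∈ I).image σ with hT
  have hσT : ∀ l ∈ I, σ l ∈ T := fun l hl =>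
    Finset.mem_image_of_mem _ (Finset.mem_filter.2 ⟨Finset.mem_univ _, hl⟩)
  rcases le_or_gt k T.card with hkT | hkT
  -- Choose k distinct slopes and one generator for each; these generators are invertible and
  -- pairwise different throughout `V`.
  · obtain ⟨e⟩ : Nonempty (Fin k ↪ T) := Function.Embedding.nonempty_of_card_le
      (by rw [Fintype.card_fin, Fintype.card_coe]; exact hkT)
    have hmem : ∀ i, ∃ l ∈ I, σ l = e i := fun i => by
      obtain ⟨l, hl, h⟩ := Finset.mem_image.1 (e i).2
      exact ⟨l, (Finset.mem_filter.1 hl).2, h⟩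
    choose a haI ha using hmem
    refine ⟨fun i => s (a i), slopeCount_eq_of_connected hVc hxV (fun z hz i => ?_)
      fun z hz i j hij hsame => hij ?_⟩
    · refine (notMem_supp_iff (hVP hz)).2 ⟨V, hV, hz, hVP, isInvertible_of_zAffine hφ hV
        (((s (a i)).regular P).1.mono hVP) (m := M (a i)) fun w hw => ?_⟩
      obtain ⟨y, -, hy⟩ := hVZ w hw
      exact ⟨y, hy, hMI _ (haI i) w hw y hy⟩
    · have := (hseg (a i) (a j)).2
        (hsame.exists_const_of_cell hZ hVP hVZ hZV hV (hMI _ (haI i)) (hMI _ (haI j)) hz)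
      refine e.injective (Subtype.ext ?_)
      rw [← ha i, ← ha j]
      exact this
  · have h1 := h0_le_card_slopes hs hφ hZ hV hVP hVZ hZV hbot hMI hz₀ hy₀ hzy₀ hy₁ hseg hσT
    exact absurd (Nat.cast_le.1 (hk.trans h1)) (not_le.2 hkT)

end Divisor

end Trop
theorem mainTheorem2 {X : Type*} [TopologicalSpace X] [Trop.TropicalVariety X]
    (D : Trop.Divisor X) :
    D.h0a ≤ D.h0 ∧ (D.FinGen → D.h0 ≤ D.h0b) :=
  ⟨D.h0a_le_h0, D.h0_le_h0b⟩
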